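/- Let $H$ be a fixed finite connected graph, possibly with loops, in which every vertex has at most two neighbours (a vertex with a loop counts as a neighbour of itself). An instance of List $H$-Coloring is a pair $(G,L)$, where $G$ is a finite simple graph and $L$ assigns to each vertex $v$ of $G$ a list $L(v) \subseteq V(H)$; the question is whether there is a list homomorphism from $(G,L)$ to $H$, i.e. a map $\varphi : V(G) \to V(H)$ such that $\varphi(u)\varphi(v) \in E(H)$ for every $uv \in E(G)$ and $\varphi(v) \in L(v)$ for every $v \in V(G)$. Let $C_k$ denote the cycle with $k$ vertices and $P^*_3$ the path with three vertices with a loop added on each of its two endvertices. Graphs $H$ are considered up to isomorphism. Then List $H$-Coloring on instances $(G,L)$ in which $G$ has $n$ vertices and is connected of diameter exactly $2$ can be solved by a deterministic algorithm (a random access machine with unit-cost instructions, whose arithmetic is addition and truncated subtraction, and which is given the adjacency matrix of $G$ and the lists as bit vectors) 1. in time polynomial in $n$, if $H \notin \{C_3, C_5, P^*_3\}$; 2. in time $2^{O(n^{1/3} \log^2 n)}$, if $H \in \{C_3, C_5\}$; 3. in time $2^{O(n^{1/2} \log^{1/2} n)}$, if $H = P^*_3$. The algorithm, the polynomial and the constants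 hidden in the $O$-notation may depend on $H$, but not on $(G,L)$; logarithms are natural. -/

import Mathlib

/-- A finite or infinite undirected graph without multiple edges in which loops are allowed. -/
structure LoopGraph (V : Type*) where
  Adj : V → V → Prop
  symm : ∀ x y, Adj x y → Adj y x

namespace LoopGraph

/-- A simple graph, seen as a graph that happens to have no loops. -/
def ofSimpleGraph {V : Type*} (G : SimpleGraph V) : LoopGraph V where
  Adj := G.Adj
  symm _ _ h := h.symm

/-- The neighbours of `x`; a vertex with a loop is a neighbour of itself. -/
def neighborSet {V : Type*} (H : LoopGraph V) (x : V) : Set V := {y | H.Adj x y}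

/-- Connectedness; loops play no role for it, so it is that of the simple graph
obtained by deleting the loops. -/
def Connected {V : Type*} (H : LoopGraph V) : Prop := (SimpleGraph.fromRel H.Adj).Connected

/-- The cycle on `k` vertices, for `k ≥ 3`. -/
def cycle (k : ℕ) : LoopGraph (Fin k) := ofSimpleGraph (SimpleGraph.cycleGraph k)

/-- The graph `P*_k`: the path on the `k` vertices `0, …, k - 1`, together with a loop
on each of its two endvertices. -/
def pathLooped (k : ℕ) : LoopGraph (Fin k) where
  Adj x y := (SimpleGraph.pathGraph k).Adj x y ∨
    (x = y ∧ ((x : ℕ) = 0 ∨ (x : ℕ) + 1 = k))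
  symm x y h := by
    rcases h with h | ⟨rfl, h⟩
    · exact Or.inl h.symm
    · exact Or.inr ⟨rfl, h⟩

/-- Two graphs are isomorphic. -/
def IsIso {V W : Type*} (H : LoopGraph V) (H' : LoopGraph W) : Prop :=
  Nonempty (H.Adj ≃r H'.Adj)

/-- `φ` is a list homomorphism from `(G, L)` to `H`. -/
def IsListHom {V W : Type*} (G : SimpleGraph V) (L : V → Finset W) (H : LoopGraph W)
    (φ : V → W) : Prop :=
  (∀ u v, G.Adj u v → H.Adj (φ u) (φ v)) ∧ ∀ v, φ v ∈ L v

end LoopGraph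

/-! The machine model: a random access machine with unit-cost instructions. Its arithmetic is
limited to addition and truncated subtraction (no multiplication), so that it is polynomially
equivalent to multitape Turing machines. -/

namespace RAM

/-- A state: the registers, and a memory with indirect addressing. A program names only
finitely many registers. -/
structure State where
  reg : ℕ → ℕ
  mem : ℕ → ℕ

/-- The elementary instructions. -/
inductive Instr where
  /-- `R[i] := c` -/
  | const (i c : ℕ)
  /-- `R[i] := R[j] + R[l]` -/
  | add (i j l : ℕ)
  /-- `R[i] := max (R[j] - R[l]) 0` -/
  | sub (i j l : ℕ)
  /-- `R[i] := M[R[j]]` -/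
  | load (i j : ℕ)
  /-- `M[R[i]] := R[j]` -/
  | store (i j : ℕ)

/-- The effect of an elementary instruction. -/
def Instr.exec : Instr → State → State
  | const i c, s => { s with reg := Function.update s.reg i c }
  | add i j l, s => { s with reg := Function.update s.reg i (s.reg j + s.reg l) }
  | sub i j l, s => { s with reg := Function.update s.reg i (s.reg j - s.reg l) }
  | load i j, s => { s with reg := Function.update s.reg i (s.mem (s.reg j)) }
  | store i j, s => { s with mem := Function.update s.mem (s.reg i) (s.reg j) }

/-- Programs. -/
inductive Program where
  | instr (a : Instr)
  | seq (P Q : Program)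
  /-- `if R[i] ≠ 0 then P else Q` -/
  | ite (i : ℕ) (P Q : Program)
  /-- `while R[i] ≠ 0 do P` -/
  | loop (i : ℕ) (P : Program)

/-- `Runs P s s' t`: started in the state `s`, the program `P` halts in the state `s'` after
exactly `t` steps. Each elementary instruction and each test of a register is one step. -/
inductive Runs : Program → State → State → ℕ → Prop where
  | instr (a : Instr) (s : State) : Runs (.instr a) s (a.exec s) 1
  | seq {P Q : Program} {s s' s'' : State} {t t' : ℕ} :
      Runs P s s' t → Runs Q s' s'' t' → Runs (.seq P Q) s s'' (t + t')
  | ite_true {i : ℕ} {P Q : Program} {s s' : State} {t : ℕ} :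
      s.reg i ≠ 0 → Runs P s s' t → Runs (.ite i P Q) s s' (t + 1)
  | ite_false {i : ℕ} {P Q : Program} {s s' : State} {t : ℕ} :
      s.reg i = 0 → Runs Q s s' t → Runs (.ite i P Q) s s' (t + 1)
  | loop_done {i : ℕ} {P : Program} {s : State} :
      s.reg i = 0 → Runs (.loop i P) s s 1
  | loop_step {i : ℕ} {P : Program} {s s' s'' : State} {t t' : ℕ} :
      s.reg i ≠ 0 → Runs P s s' t → Runs (.loop i P) s' s'' t' →
        Runs (.loop i P) s s'' (t + 1 + t')

/-- The machine is deterministic: the final state and the number of steps are determined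
by the program and the initial state. -/
theorem Runs.deterministic {P : Program} {s s₁ s₂ : State} {t₁ t₂ : ℕ}
    (h₁ : Runs P s s₁ t₁) (h₂ : Runs P s s₂ t₂) : s₁ = s₂ ∧ t₁ = t₂ := by
  induction h₁ generalizing s₂ t₂ with
  | instr a s => cases h₂; exact ⟨rfl, rfl⟩
  | seq _ _ ih ih' =>
    cases h₂ with
    | seq h h' =>
      obtain ⟨rfl, rfl⟩ := ih h
      obtain ⟨rfl, rfl⟩ := ih' h'
      exact ⟨rfl, rfl⟩
  | ite_true hi _ ih =>
    cases h₂ with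
    | ite_true _ h => obtain ⟨rfl, rfl⟩ := ih h; exact ⟨rfl, rfl⟩
    | ite_false hi' _ => exact absurd hi' hi
  | ite_false hi _ ih =>
    cases h₂ with
    | ite_true hi' _ => exact absurd hi hi'
    | ite_false _ h => obtain ⟨rfl, rfl⟩ := ih h; exact ⟨rfl, rfl⟩
  | loop_done hi =>
    cases h₂ with
    | loop_done _ => exact ⟨rfl, rfl⟩
    | loop_step hi' _ _ => exact absurd hi hi'
  | loop_step hi _ _ ih ih' =>
    cases h₂ with
    | loop_done hi' => exact absurd hi' hi
    | loop_step _ h h' =>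
      obtain ⟨rfl, rfl⟩ := ih h
      obtain ⟨rfl, rfl⟩ := ih' h'
      exact ⟨rfl, rfl⟩

open Classical in
/-- The initial state that encodes an instance `(G, L)` with `n` vertices and `k` colours.
Register `0` holds `n`, all other registers hold `0`. The memory holds the adjacency matrix of
`G`, row by row, in the cells `0, …, n * n - 1`, then the `n` lists as rows of `k` bits each in
the next `n * k` cells, and `0` in all other cells. -/
noncomputable def input {n k : ℕ} (G : SimpleGraph (Fin n)) (L : Fin n → Finset (Fin k)) :
    State where
  reg i := if i = 0 then n else 0
  mem a :=
    if (∃ u v : Fin n, a = u * n + v ∧ G.Adj u v) ∨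
        (∃ (v : Fin n) (c : Fin k), a = n * n + (v * k + c) ∧ c ∈ L v)
    then 1 else 0

end RAM

/-- The program `P` solves List `H`-Colouring on graphs of diameter 2 in time `T`: on every
instance `(G, L)` in which `G` has `n` vertices and diameter 2, it halts after at most `T n`
steps, with `1` in register `0` if there is a list homomorphism from `(G, L)` to `H`, and with
`0` in register `0` otherwise. -/
def SolvesListColoringDiamTwo {k : ℕ} (H : LoopGraph (Fin k)) (P : RAM.Program)
    (T : ℕ → ℝ) : Prop :=
  ∀ (n : ℕ) (G : SimpleGraph (Fin n)) (L : Fin n → Finset (Fin k)),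
    G.Connected → G.diam = 2 →
      ∃ (s : RAM.State) (t : ℕ), RAM.Runs P (RAM.input G L) s t ∧ (t : ℝ) ≤ T n ∧
        ((∃ φ, LoopGraph.IsListHom G L H φ) → s.reg 0 = 1) ∧
        ((¬ ∃ φ, LoopGraph.IsListHom G L H φ) → s.reg 0 = 0)

/-!
List `H`-colouring is solved by guessing a partial colouring and completing it.

*Completion.* If `H` has maximum degree two, then an arc consistent family of lists in which each
vertex has a coloured neighbour has lists of size at most two. For such lists a greedy procedure
works: a colour is tried, arc consistency is restored, and the trial is kept if no list has become
empty. The lists that have shrunk are then singletons, and all other vertices can keep the colours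
of any solution, so nothing is lost (`ListColoring.isListHom_of_propagate`). A partial colouring
that leaves at most two colours to each vertex is called decisive; `ListColoring.Decisive.solved`
says that the completion succeeds if the guess is decisive for some list homomorphism. The result is
always verified, so wrong guesses do no harm.

*Guesses.* In a graph `G` of diameter two the neighbourhood of each vertex is a dominating set.

* If `H` is neither a triangle nor `P*_3`, then constantly many guesses suffice
  (`ListColoring.exists_decisive`). If all neighbours of some vertex have the same colour, then that
  colour and that vertex are guessed. Otherwise all colours occur and have degree two in `H`; as
  vertices of colours at distance more than two do not exist, there is no loop unless `H` has at
  most two vertices, and then one vertex of each colour makes a dominating set, as `H` is not a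
  triangle. This includes the cycle of length five, for which a polynomial bound is better than the
  required one.
* If `H` is a triangle, then `O(n ^ (1/3) log n)` guesses suffice
  (`ListColoring.exists_decisive_three`). This is clear if some vertex has fewer than `n ^ (1/3)`
  neighbours of some colour. Otherwise consider a colour class `X`. Half of the pairs in `X` have
  common neighbours of one colour `j`, and each of these has many neighbours of the third colour
  `l`. A counting argument gives `O(n ^ (1/3))` vertices that contain, for a constant fraction of
  the `v ∈ X`, two neighbours of different colours of a neighbour of `v`
  (`ListColoring.exists_reaching`). The colours of these vertices determine the colour of that
  neighbour of `v`, so `v` has at most two possible colours left. After `O(log n)` rounds no vertex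
  remains. Each guess is one of `O(n)` instructions, hence the second logarithm in the exponent.
* If `H` is `P*_3`, then a dominating set of size `O((n log n) ^ (1/2))` is computed and all its
  colourings are tried. If `s` is the smallest size of a closed neighbourhood, then a greedy
  dominating set has at most about `(n log n) / s` members, and a smallest closed neighbourhood is a
  dominating set of size `s`; the smaller of the two is taken (`RAM.dominateCmd_spec`).

*The machine.* The procedures are written in a small language with expressions `RAM.Expr` and
commands `RAM.Cmd`, whose loops have ranges given by parameters. `RAM.Cmd.compile_spec` is the
correctness of its compilation, and `RAM.Cmd.exists_cost_le` bounds the running time by a polynomial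
in the parameters. The parameters, among them the number of guesses, are themselves computed by such
commands (`RAM.exists_program`). The lemmas `RAM.solves_of_certificates` and
`RAM.solves_of_domination` combine this with the two kinds of guesses.
-/


namespace RAM

/-! ### Time-bounded executions -/

/-- `Tr P s T Q`: started in `s`, the program `P` halts after at most `T` steps in a state
that satisfies `Q`. -/
def Tr (P : Program) (s : State) (T : ℕ) (Q : State → Prop) : Prop :=
  ∃ s' t, Runs P s s' t ∧ t ≤ T ∧ Q s'

theorem Tr.mono {P : Program} {s : State} {T T' : ℕ} {Q Q' : State → Prop}
    (h : Tr P s T Q) (hT : T ≤ T') (hQ : ∀ s', Q s' → Q' s') : Tr P s T' Q' := by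
  obtain ⟨s', t, hr, ht, hq⟩ := h
  exact ⟨s', t, hr, ht.trans hT, hQ _ hq⟩

theorem Tr.instr {a : Instr} {s : State} {Q : State → Prop} (h : Q (a.exec s)) :
    Tr (.instr a) s 1 Q := ⟨_, _, .instr a s, le_rfl, h⟩

theorem Tr.seq {P R : Program} {s : State} {T T' : ℕ} {Q : State → Prop}
    (h : Tr P s T (fun s' => Tr R s' T' Q)) : Tr (.seq P R) s (T + T') Q := by
  obtain ⟨s', t, hr, ht, s'', t', hr', ht', hq⟩ := h
  exact ⟨s'', _, .seq hr hr', by omega, hq⟩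

theorem Tr.ite {i : ℕ} {P R : Program} {s : State} {T : ℕ} {Q : State → Prop}
    (h1 : s.reg i ≠ 0 → Tr P s T Q) (h2 : s.reg i = 0 → Tr R s T Q) :
    Tr (.ite i P R) s (T + 1) Q := by
  by_cases h : s.reg i = 0
  · obtain ⟨s', t, hr, ht, hq⟩ := h2 h
    exact ⟨s', _, .ite_false h hr, by omega, hq⟩
  · obtain ⟨s', t, hr, ht, hq⟩ := h1 h
    exact ⟨s', _, .ite_true h hr, by omega, hq⟩

/-- A loop that counts register `i` down; the invariant `I` is indexed by the number of
iterations that remain. -/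
theorem Tr.loop {i : ℕ} {P : Program} {T : ℕ} (I : ℕ → State → Prop)
    (h0 : ∀ s, I 0 s → s.reg i = 0)
    (hs : ∀ j s, I (j + 1) s → s.reg i ≠ 0 ∧ Tr P s T (I j)) (N : ℕ) (s : State) (h : I N s) :
    Tr (.loop i P) s (N * (T + 1) + 1) (I 0) := by
  induction N generalizing s with
  | zero => exact ⟨s, 1, .loop_done (h0 s h), by omega, h⟩
  | succ N ih =>
    obtain ⟨hne, s', t, hr, ht, hq⟩ := hs N s h
    obtain ⟨s'', t', hr', ht', hq'⟩ := ih s' hq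
    refine ⟨s'', _, .loop_step hne hr hr', ?_, hq'⟩
    have : (N + 1) * (T + 1) = N * (T + 1) + (T + 1) := by ring
    omega

/-- Straight-line code. -/
def block (a : Instr) : List Instr → Program
  | [] => .instr a
  | b :: l => .seq (.instr a) (block b l)

/-- The effect of straight-line code. -/
def execs : List Instr → State → State
  | [], s => s
  | a :: l, s => execs l (a.exec s)

theorem execs_append (l l' : List Instr) (s : State) :
    execs (l ++ l') s = execs l' (execs l s) := by
  induction l generalizing s with
  | nil => rfl
  | cons a l ih => exact ih _

theorem Instr.exec_const (i c : ℕ) (s : State) :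
    (const i c).exec s = { s with reg := Function.update s.reg i c } := rfl

theorem Instr.exec_add (i j l : ℕ) (s : State) :
    (add i j l).exec s = { s with reg := Function.update s.reg i (s.reg j + s.reg l) } := rfl

theorem Instr.exec_sub (i j l : ℕ) (s : State) :
    (sub i j l).exec s = { s with reg := Function.update s.reg i (s.reg j - s.reg l) } := rfl

theorem Tr.block {a : Instr} {l : List Instr} {s : State} {Q : State → Prop}
    (h : Q (execs l (a.exec s))) :
    Tr (block a l) s (l.length + 1) Q := by
  induction l generalizing a s with
  | nil => exact Tr.instr h
  | cons b l ih =>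
    have := Tr.seq (P := .instr a) (R := RAM.block b l) (s := s) (T := 1) (T' := l.length + 1)
      (Q := Q) (Tr.instr (ih h))
    exact this.mono (by simp; omega) (fun _ h => h)

/-! ### A structured language on top of the machine -/

/-- The variables and arrays of the structured language. -/
structure Store where
  var : ℕ → ℕ
  arr : ℕ → ℕ → ℕ

/-- What a command can read but not change: parameters, and the input in memory. The cells
of the input are those below `param 1`. -/
structure Env where
  param : ℕ → ℕ
  inp : ℕ → ℕ

/-- The store in which the variable `v` has got the value `x`. -/
def Store.set (σ : Store) (v x : ℕ) : Store := { σ with var := Function.update σ.var v x }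

/-- The store in which entry `i` of the array `a` has got the value `x`. -/
def Store.put (σ : Store) (a i x : ℕ) : Store :=
  { σ with arr := Function.update σ.arr a (Function.update (σ.arr a) i x) }

/-- Side-effect-free expressions, among them sums whose range is given by a parameter. -/
inductive Expr where
  | const (c : ℕ)
  | param (p : ℕ)
  | var (v : ℕ)
  | arr (a : ℕ) (e : Expr)
  | inp (e : Expr)
  | add (e₁ e₂ : Expr)
  | sub (e₁ e₂ : Expr)
  /-- `if e₁ ≠ 0 then e₂ else e₃` -/
  | cond (e₁ e₂ e₃ : Expr)
  /-- the sum of `e` over all values of the variable `v` below the parameter `p` -/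
  | sum (p v : ℕ) (e : Expr)

/-- The value of an expression. -/
def Expr.eval (Γ : Env) : Expr → Store → ℕ
  | const c, _ => c
  | param p, _ => Γ.param p
  | var v, σ => σ.var v
  | arr a e, σ => σ.arr a (e.eval Γ σ)
  | inp e, σ => if e.eval Γ σ < Γ.param 1 then Γ.inp (e.eval Γ σ) else 0
  | add e₁ e₂, σ => e₁.eval Γ σ + e₂.eval Γ σ
  | sub e₁ e₂, σ => e₁.eval Γ σ - e₂.eval Γ σ
  | cond e₁ e₂ e₃, σ => if e₁.eval Γ σ ≠ 0 then e₂.eval Γ σ else e₃.eval Γ σ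
  | sum p v e, σ => ∑ i ∈ Finset.range (Γ.param p), e.eval Γ (σ.set v i)

/-- Commands. The number of iterations of a loop is a parameter, so every command halts. -/
inductive Cmd where
  | assign (v : ℕ) (e : Expr)
  | store (a : ℕ) (i e : Expr)
  | seq (c₁ c₂ : Cmd)
  | ite (e : Expr) (c₁ c₂ : Cmd)
  /-- run `c` for all values of the variable `v` below the parameter `p`, in increasing order -/
  | forTo (p v : ℕ) (c : Cmd)

/-- `iter f v N σ` applies `f` for `v = 0, …, N - 1` in turn. -/
def iter (f : Store → Store) (v : ℕ) : ℕ → Store → Store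
  | 0, σ => σ
  | N + 1, σ => f ((iter f v N σ).set v N)

/-- The effect of a command. -/
def Cmd.eval (Γ : Env) : Cmd → Store → Store
  | assign v e, σ => σ.set v (e.eval Γ σ)
  | store a i e, σ => σ.put a (i.eval Γ σ) (e.eval Γ σ)
  | seq c₁ c₂, σ => c₂.eval Γ (c₁.eval Γ σ)
  | ite e c₁ c₂, σ => if e.eval Γ σ ≠ 0 then c₁.eval Γ σ else c₂.eval Γ σ
  | forTo p v c, σ => iter (c.eval Γ) v (Γ.param p) σ

/-- All arrays that occur have a number below `A`. -/
def Expr.Ok (A : ℕ) : Expr → Prop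
  | const _ => True
  | param _ => True
  | var _ => True
  | arr a e => a < A ∧ e.Ok A
  | inp e => e.Ok A
  | add e₁ e₂ => e₁.Ok A ∧ e₂.Ok A
  | sub e₁ e₂ => e₁.Ok A ∧ e₂.Ok A
  | cond e₁ e₂ e₃ => e₁.Ok A ∧ e₂.Ok A ∧ e₃.Ok A
  | sum _ _ e => e.Ok A

/-- All arrays that occur have a number below `A`. -/
def Cmd.Ok (A : ℕ) : Cmd → Prop
  | assign _ e => e.Ok A
  | store a i e => a < A ∧ i.Ok A ∧ e.Ok A
  | seq c₁ c₂ => c₁.Ok A ∧ c₂.Ok A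
  | ite e c₁ c₂ => e.Ok A ∧ c₁.Ok A ∧ c₂.Ok A
  | forTo _ _ c => c.Ok A

/-! ### Compilation -/

/-- Copy register `j` to register `i`, for `i ≠ j`. -/
def move (i j : ℕ) : List Instr := [.const i 0, .add i i j]

/-- Replace the index in the temporary register `d` by the address of that entry of the
array `a`. Entry `i` of the array `a < A` has the address `param 1 + A * i + a`. -/
def address (A a d : ℕ) : Program :=
  block (.const (3 * (d + 1) + 2) a)
    (.add (3 * (d + 1) + 2) (3 * (d + 1) + 2) 3 ::
      (List.replicate A (.add (3 * (d + 1) + 2) (3 * (d + 1) + 2) (3 * d + 2)) ++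
        move (3 * d + 2) (3 * (d + 1) + 2)))

/-- Code that leaves the value of an expression in the temporary register `d`. The parameter
`p`, the variable `v` and the temporary register `d` are kept in the registers
`3 * p`, `3 * v + 1` and `3 * d + 2`. -/
def Expr.compile (A : ℕ) : Expr → ℕ → Program
  | const c, d => .instr (.const (3 * d + 2) c)
  | param p, d => block (.const (3 * d + 2) 0) [.add (3 * d + 2) (3 * d + 2) (3 * p)]
  | var v, d => block (.const (3 * d + 2) 0) [.add (3 * d + 2) (3 * d + 2) (3 * v + 1)]
  | arr a e, d => .seq (e.compile A d) (.seq (address A a d)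
      (.instr (.load (3 * d + 2) (3 * d + 2))))
  | inp e, d => .seq (e.compile A d) (.seq (.instr (.sub (3 * (d + 1) + 2) 3 (3 * d + 2)))
      (.ite (3 * (d + 1) + 2) (.instr (.load (3 * d + 2) (3 * d + 2)))
        (.instr (.const (3 * d + 2) 0))))
  | add e₁ e₂, d => .seq (e₁.compile A d) (.seq (e₂.compile A (d + 1))
      (.instr (.add (3 * d + 2) (3 * d + 2) (3 * (d + 1) + 2))))
  | sub e₁ e₂, d => .seq (e₁.compile A d) (.seq (e₂.compile A (d + 1))
      (.instr (.sub (3 * d + 2) (3 * d + 2) (3 * (d + 1) + 2))))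
  | cond e₁ e₂ e₃, d => .seq (e₁.compile A d)
      (.ite (3 * d + 2) (e₂.compile A d) (e₃.compile A d))
  | sum p v e, d =>
      -- the temporary registers hold the old value of `v`, the partial sum and the counter
      .seq (block (.const (3 * d + 2) 0) [.add (3 * d + 2) (3 * d + 2) (3 * v + 1),
        .const (3 * (d + 1) + 2) 0, .const (3 * (d + 2) + 2) 0,
        .add (3 * (d + 2) + 2) (3 * (d + 2) + 2) (3 * p)])
      (.seq (.loop (3 * (d + 2) + 2)
        (.seq (block (.const (3 * (d + 3) + 2) 1)
            [.sub (3 * (d + 2) + 2) (3 * (d + 2) + 2) (3 * (d + 3) + 2),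
            .const (3 * v + 1) 0, .add (3 * v + 1) (3 * v + 1) (3 * (d + 2) + 2)])
          (.seq (e.compile A (d + 3))
            (.instr (.add (3 * (d + 1) + 2) (3 * (d + 1) + 2) (3 * (d + 3) + 2))))))
      (block (.const (3 * v + 1) 0) [.add (3 * v + 1) (3 * v + 1) (3 * d + 2),
        .const (3 * d + 2) 0, .add (3 * d + 2) (3 * d + 2) (3 * (d + 1) + 2)]))

/-- A bound for the running time of the code of an expression. -/
def Expr.cost (A : ℕ) (Γ : Env) : Expr → ℕ
  | const _ => 1
  | param _ => 2
  | var _ => 2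
  | arr _ e => e.cost A Γ + (A + 5)
  | inp e => e.cost A Γ + 3
  | add e₁ e₂ => e₁.cost A Γ + (e₂.cost A Γ + 1)
  | sub e₁ e₂ => e₁.cost A Γ + (e₂.cost A Γ + 1)
  | cond e₁ e₂ e₃ => e₁.cost A Γ + (e₂.cost A Γ + e₃.cost A Γ + 1)
  | sum p _ e => 5 + ((Γ.param p * (4 + (e.cost A Γ + 1) + 1) + 1) + 4)

/-- Code for a command that uses only the temporary registers from `d` on. -/
def Cmd.compile (A : ℕ) : Cmd → ℕ → Program
  | assign v e, d => .seq (e.compile A d)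
      (block (.const (3 * v + 1) 0) [.add (3 * v + 1) (3 * v + 1) (3 * d + 2)])
  | store a i e, d => .seq (i.compile A d) (.seq (address A a d)
      (.seq (e.compile A (d + 1)) (.instr (.store (3 * d + 2) (3 * (d + 1) + 2)))))
  | seq c₁ c₂, d => .seq (c₁.compile A d) (c₂.compile A d)
  | ite e c₁ c₂, d => .seq (e.compile A d)
      (.ite (3 * d + 2) (c₁.compile A d) (c₂.compile A d))
  | forTo p v c, d =>
      -- the temporary registers `d` and `d + 1` hold the number of iterations that remain
      -- and the number of those done
      .seq (block (.const (3 * d + 2) 0) [.add (3 * d + 2) (3 * d + 2) (3 * p),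
        .const (3 * (d + 1) + 2) 0])
      (.loop (3 * d + 2)
        (.seq (block (.const (3 * v + 1) 0) [.add (3 * v + 1) (3 * v + 1) (3 * (d + 1) + 2)])
          (.seq (c.compile A (d + 2))
            (block (.const (3 * (d + 2) + 2) 1)
              [.add (3 * (d + 1) + 2) (3 * (d + 1) + 2) (3 * (d + 2) + 2),
              .sub (3 * d + 2) (3 * d + 2) (3 * (d + 2) + 2)]))))

/-- A bound for the running time of the code of a command. -/
def Cmd.cost (A : ℕ) (Γ : Env) : Cmd → ℕ
  | assign _ e => e.cost A Γ + 2
  | store _ i e => i.cost A Γ + ((A + 4) + (e.cost A Γ + 1))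
  | seq c₁ c₂ => c₁.cost A Γ + c₂.cost A Γ
  | ite e c₁ c₂ => e.cost A Γ + (c₁.cost A Γ + c₂.cost A Γ + 1)
  | forTo p _ c => 3 + (Γ.param p * ((2 + (c.cost A Γ + 3)) + 1) + 1)

/-- The machine state `s` represents the store `σ` in the environment `Γ`. -/
structure Rel (A : ℕ) (Γ : Env) (σ : Store) (s : State) : Prop where
  param : ∀ p, s.reg (3 * p) = Γ.param p
  var : ∀ v, s.reg (3 * v + 1) = σ.var v
  inp : ∀ e, e < Γ.param 1 → s.mem e = Γ.inp e
  arr : ∀ a i, a < A → s.mem (Γ.param 1 + A * i + a) = σ.arr a i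

/-- Between `s` and `s'` only temporary registers from `d` on have changed. -/
def Frame (d : ℕ) (s s' : State) : Prop :=
  s'.mem = s.mem ∧ ∀ r, (∀ j, d ≤ j → r ≠ 3 * j + 2) → s'.reg r = s.reg r

theorem Frame.rel {A d : ℕ} {Γ : Env} {σ : Store} {s s' : State} (hf : Frame d s s')
    (h : Rel A Γ σ s) : Rel A Γ σ s' where
  param p := by rw [hf.2 _ (fun j _ => by omega), h.param]
  var p := by rw [hf.2 _ (fun j _ => by omega), h.var]
  inp e he := by rw [hf.1, h.inp e he]
  arr a i ha := by rw [hf.1, h.arr a i ha]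

theorem Frame.refl (d : ℕ) (s : State) : Frame d s s := ⟨rfl, fun _ _ => rfl⟩

theorem Frame.trans {d : ℕ} {s s' s'' : State} (h : Frame d s s') (h' : Frame d s' s'') :
    Frame d s s'' := ⟨h'.1.trans h.1, fun r hr => (h'.2 r hr).trans (h.2 r hr)⟩

theorem Frame.mono {d d' : ℕ} {s s' : State} (hd : d ≤ d') (h : Frame d' s s') :
    Frame d s s' := ⟨h.1, fun r hr => h.2 r fun j hj => hr j (hd.trans hj)⟩

theorem Frame.temp {d j : ℕ} {s s' : State} (h : Frame d s s') (hj : j < d) :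
    s'.reg (3 * j + 2) = s.reg (3 * j + 2) := h.2 _ fun i hi => by omega

theorem Frame.set {d i x : ℕ} {s s' : State} (h : Frame d s s') (hi : d ≤ i) :
    Frame d s { s' with reg := Function.update s'.reg (3 * i + 2) x } :=
  ⟨h.1, fun r hr => by
    simp only
    rw [Function.update_of_ne (hr i hi)]; exact h.2 r hr⟩

theorem execs_replicate_add (i j N : ℕ) (hij : i ≠ j) (s : State) :
    execs (List.replicate N (Instr.add i i j)) s =
      { s with reg := Function.update s.reg i (s.reg i + N * s.reg j) } := by
  induction N generalizing s with
  | zero => simp [execs]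
  | succ N ih =>
    simp only [List.replicate_succ, execs, ih, Instr.exec_add, Function.update_self,
      Function.update_idem, Function.update_of_ne hij.symm]
    congr 2
    ring

theorem address_spec (A a d : ℕ) (s : State) :
    Tr (address A a d) s (A + 4) (fun s' => s'.reg (3 * d + 2) =
      s.reg 3 + A * s.reg (3 * d + 2) + a ∧ Frame d s s') := by
  refine (Tr.block (Q := fun s' => s'.reg (3 * d + 2) =
      s.reg 3 + A * s.reg (3 * d + 2) + a ∧ Frame d s s') ?_).mono
    (by simp [move]) (fun _ h => h)
  have h1 : 3 * d + 2 ≠ 3 * (d + 1) + 2 := by omega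
  have h2 : 3 ≠ 3 * (d + 1) + 2 := by omega
  simp only [execs, execs_append, execs_replicate_add _ _ _ h1.symm, move,
    Instr.exec_const, Instr.exec_add]
  constructor
  · simp only [Function.update_self, Function.update_of_ne h1, Function.update_of_ne h1.symm,
      Function.update_of_ne h2]
    ring
  · refine Frame.set (Frame.set (Frame.set (Frame.set (Frame.set (Frame.refl d s) ?_) ?_) ?_) ?_)
      ?_ <;> omega

/-- What it means that the code `P` evaluates to `x` in the temporary register `d`. -/
abbrev Computes (d x : ℕ) (P : Program) (s : State) (T : ℕ) : Prop :=
  Tr P s T (fun s' => s'.reg (3 * d + 2) = x ∧ Frame d s s')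

theorem Expr.compile_spec {A : ℕ} {Γ : Env} (e : Expr) (he : e.Ok A) (d : ℕ) (σ : Store)
    (s : State) (h : Rel A Γ σ s) :
    Computes d (e.eval Γ σ) (e.compile A d) s (e.cost A Γ) := by
  induction e generalizing d σ s with
  | const c =>
    exact Tr.instr ⟨by simp [Instr.exec_const, eval], (Frame.refl d s).set le_rfl⟩
  | param p =>
    refine Tr.block (l := [_]) ?_
    simp only [execs, Instr.exec_const, Instr.exec_add]
    refine ⟨?_, ((Frame.refl d s).set le_rfl).set le_rfl⟩
    have : 3 * p ≠ 3 * d + 2 := by omega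
    simp [Function.update_of_ne this, h.param, eval]
  | var v =>
    refine Tr.block (l := [_]) ?_
    simp only [execs, Instr.exec_const, Instr.exec_add]
    refine ⟨?_, ((Frame.refl d s).set le_rfl).set le_rfl⟩
    have : 3 * v + 1 ≠ 3 * d + 2 := by omega
    simp [Function.update_of_ne this, h.var, eval]
  | arr a e ih =>
    refine Tr.seq ((ih he.2 d σ s h).mono le_rfl fun s₁ h₁ => ?_)
    refine (Tr.seq (T := A + 4) (T' := 1) ((address_spec A a d s₁).mono le_rfl
      fun s₂ h₂ => ?_)).mono (by omega) (fun _ h => h)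
    have hf := h₁.2.trans h₂.2
    refine Tr.instr ⟨?_, hf.set le_rfl⟩
    have h3 : s₁.reg 3 = Γ.param 1 := (h₁.2.rel h).param 1
    simp only [Instr.exec, Function.update_self]
    rw [h₂.1, h₁.1, h3, (hf.rel h).arr a _ he.1, eval]
  | inp e ih =>
    refine Tr.seq ((ih he d σ s h).mono le_rfl fun s₁ h₁ => ?_)
    have h3 : s₁.reg 3 = Γ.param 1 := (h₁.2.rel h).param 1
    have hne : 3 * d + 2 ≠ 3 * (d + 1) + 2 := by omega
    refine (Tr.seq (T := 1) (T' := 2) (Tr.instr ?_)).mono (by omega) (fun _ h => h)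
    have hf : Frame d s ((Instr.sub (3 * (d + 1) + 2) 3 (3 * d + 2)).exec s₁) :=
      h₁.2.set (by omega)
    refine Tr.ite (fun hi => Tr.instr ⟨?_, hf.set le_rfl⟩) (fun hi => Tr.instr ⟨?_, hf.set le_rfl⟩)
    · simp only [Instr.exec, Function.update_self, h3, h₁.1] at hi
      have hlt : e.eval Γ σ < Γ.param 1 := by omega
      simp only [Instr.exec, Function.update_self, Function.update_of_ne hne, h₁.1, eval, hlt,
        if_true]
      exact (h₁.2.rel h).inp _ hlt
    · simp only [Instr.exec, Function.update_self, h3, h₁.1] at hi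
      have hlt : ¬ e.eval Γ σ < Γ.param 1 := by omega
      simp [Instr.exec, eval, hlt]
  | add e₁ e₂ ih₁ ih₂ =>
    refine Tr.seq ((ih₁ he.1 d σ s h).mono le_rfl fun s₁ h₁ => ?_)
    refine Tr.seq ((ih₂ he.2 (d + 1) σ s₁ (h₁.2.rel h)).mono le_rfl fun s₂ h₂ => ?_)
    refine Tr.instr ⟨?_, (h₁.2.trans (h₂.2.mono (Nat.le_succ d))).set le_rfl⟩
    simp only [Instr.exec, Function.update_self]
    rw [h₂.1, h₂.2.temp (Nat.lt_succ_self d), h₁.1, eval]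
  | sub e₁ e₂ ih₁ ih₂ =>
    refine Tr.seq ((ih₁ he.1 d σ s h).mono le_rfl fun s₁ h₁ => ?_)
    refine Tr.seq ((ih₂ he.2 (d + 1) σ s₁ (h₁.2.rel h)).mono le_rfl fun s₂ h₂ => ?_)
    refine Tr.instr ⟨?_, (h₁.2.trans (h₂.2.mono (Nat.le_succ d))).set le_rfl⟩
    simp only [Instr.exec, Function.update_self]
    rw [h₂.1, h₂.2.temp (Nat.lt_succ_self d), h₁.1, eval]
  | cond e₁ e₂ e₃ ih₁ ih₂ ih₃ =>
    refine Tr.seq ((ih₁ he.1 d σ s h).mono le_rfl fun s₁ h₁ => ?_)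
    refine Tr.ite (fun hi => ?_) (fun hi => ?_)
    · rw [h₁.1] at hi
      refine (ih₂ he.2.1 d σ s₁ (h₁.2.rel h)).mono (by omega) fun s₂ h₂ => ?_
      exact ⟨by rw [h₂.1, eval, if_pos hi], h₁.2.trans h₂.2⟩
    · rw [h₁.1] at hi
      refine (ih₃ he.2.2 d σ s₁ (h₁.2.rel h)).mono (by omega) fun s₂ h₂ => ?_
      exact ⟨by rw [h₂.1, eval, if_neg (by simpa using hi)], h₁.2.trans h₂.2⟩
  | sum p v e ih =>
    -- before the loop body runs with counter value `j`, the values of `v` from `j` on are done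
    let I : ℕ → State → Prop := fun j s' => s'.reg (3 * (d + 2) + 2) = j ∧
      s'.reg (3 * d + 2) = σ.var v ∧
      s'.reg (3 * (d + 1) + 2) = ∑ i ∈ Finset.Ico j (Γ.param p), e.eval Γ (σ.set v i) ∧
      j ≤ Γ.param p ∧ s'.mem = s.mem ∧
      ∀ r, (∀ j, d ≤ j → r ≠ 3 * j + 2) → r ≠ 3 * v + 1 → s'.reg r = s.reg r
    have n1 : 3 * d + 2 ≠ 3 * (d + 1) + 2 := by omega
    have n2 : 3 * d + 2 ≠ 3 * (d + 2) + 2 := by omega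
    have n3 : 3 * d + 2 ≠ 3 * (d + 3) + 2 := by omega
    have n4 : 3 * (d + 1) + 2 ≠ 3 * (d + 2) + 2 := by omega
    have n5 : 3 * (d + 1) + 2 ≠ 3 * (d + 3) + 2 := by omega
    have n6 : 3 * (d + 2) + 2 ≠ 3 * (d + 3) + 2 := by omega
    have v0 : 3 * d + 2 ≠ 3 * v + 1 := by omega
    have v1 : 3 * (d + 1) + 2 ≠ 3 * v + 1 := by omega
    have v2 : 3 * (d + 2) + 2 ≠ 3 * v + 1 := by omega
    have v3 : 3 * (d + 3) + 2 ≠ 3 * v + 1 := by omega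
    have p0 : 3 * p ≠ 3 * d + 2 := by omega
    have p1 : 3 * p ≠ 3 * (d + 1) + 2 := by omega
    have p2 : 3 * p ≠ 3 * (d + 2) + 2 := by omega
    refine Tr.seq (Tr.block (l := [_, _, _, _]) ?_)
    refine Tr.seq ?_
    refine (Tr.loop (T := 4 + (e.cost A Γ + 1)) I (fun s' h => h.1) ?_ (Γ.param p) _ ?_).mono
      le_rfl ?_
    · rintro j s₁ ⟨c1, c2, c3, c4, c5, c6⟩
      refine ⟨by omega, Tr.seq (Tr.block (l := [_, _, _]) ?_)⟩
      simp only [execs, Instr.exec_const, Instr.exec_add, Instr.exec_sub, Function.update_self,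
        Function.update_of_ne n6, Function.update_of_ne v2, c1, Nat.add_sub_cancel, Nat.zero_add]
      set s₂ : State := ⟨Function.update (Function.update (Function.update (Function.update
        s₁.reg (3 * (d + 3) + 2) 1) (3 * (d + 2) + 2) j) (3 * v + 1) 0) (3 * v + 1) j,
        s₁.mem⟩ with hs₂
      have hrel : Rel A Γ (σ.set v j) s₂ := by
        refine ⟨fun q => ?_, fun w => ?_, fun x hx => ?_, fun a i ha => ?_⟩
        · have q1 : 3 * q ≠ 3 * v + 1 := by omega
          have q2 : 3 * q ≠ 3 * (d + 2) + 2 := by omega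
          have q3 : 3 * q ≠ 3 * (d + 3) + 2 := by omega
          simp only [hs₂, Function.update_of_ne q1, Function.update_of_ne q2,
            Function.update_of_ne q3]
          rw [c6 _ (fun j _ => by omega) q1, h.param]
        · have q2 : 3 * w + 1 ≠ 3 * (d + 2) + 2 := by omega
          have q3 : 3 * w + 1 ≠ 3 * (d + 3) + 2 := by omega
          by_cases hw : w = v
          · subst hw
            simp [hs₂, Store.set]
          · have q1 : 3 * w + 1 ≠ 3 * v + 1 := by omega
            simp only [hs₂, Function.update_of_ne q1, Function.update_of_ne q2,
              Function.update_of_ne q3, Store.set, Function.update_of_ne hw]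
            rw [c6 _ (fun j _ => by omega) q1, h.var]
        · simp only [hs₂, c5]; exact h.inp x hx
        · simp only [hs₂, c5]; exact h.arr a i ha
      refine Tr.seq ((ih he (d + 3) _ s₂ hrel).mono le_rfl fun s₃ h₃ => Tr.instr ?_)
      have t0 := h₃.2.temp (show d < d + 3 by omega)
      have t1 := h₃.2.temp (show d + 1 < d + 3 by omega)
      have t2 := h₃.2.temp (show d + 2 < d + 3 by omega)
      refine ⟨?_, ?_, ?_, by omega, ?_, ?_⟩
      · simp only [Instr.exec_add, Function.update_of_ne n4.symm, t2]
        simp [hs₂, Function.update_of_ne v2]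
      · simp only [Instr.exec_add, Function.update_of_ne n1, t0]
        simp only [hs₂, Function.update_of_ne v0, Function.update_of_ne n2,
          Function.update_of_ne n3, c2]
      · simp only [Instr.exec_add, Function.update_self, t1, h₃.1]
        simp only [hs₂, Function.update_of_ne v1, Function.update_of_ne n4,
          Function.update_of_ne n5, c3]
        rw [Finset.sum_eq_sum_Ico_succ_bot (show j < Γ.param p by omega), add_comm]
      · simp only [Instr.exec_add]; rw [h₃.2.1]; exact c5
      · intro r hr hrv
        simp only [Instr.exec_add, Function.update_of_ne (hr (d + 1) (by omega))]
        rw [h₃.2.2 r (fun i hi => hr i (by omega))]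
        simp only [hs₂, Function.update_of_ne hrv, Function.update_of_ne (hr (d + 2) (by omega)),
          Function.update_of_ne (hr (d + 3) (by omega))]
        exact c6 r hr hrv
    · simp only [execs, Instr.exec_const, Instr.exec_add, Function.update_self, Nat.zero_add]
      refine ⟨?_, ?_, ?_, le_rfl, rfl, ?_⟩
      · simp [p0, p1, p2, h.param]
      · simp only [Function.update_of_ne n1, Function.update_of_ne n2, Function.update_self,
          Function.update_of_ne v0.symm, h.var]
      · simp only [Function.update_of_ne n4, Function.update_self, Finset.Ico_self,
          Finset.sum_empty]
      · intro r hr hrv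
        simp only [Function.update_of_ne (hr d le_rfl),
          Function.update_of_ne (hr (d + 1) (by omega)),
          Function.update_of_ne (hr (d + 2) (by omega))]
    · rintro s₁ ⟨c1, c2, c3, c4, c5, c6⟩
      refine Tr.block (l := [_, _, _]) ?_
      simp only [execs, Instr.exec_const, Instr.exec_add, Function.update_self, Nat.zero_add]
      refine ⟨?_, c5, ?_⟩
      · simp [v1, c3, eval]
      · intro r hr
        simp only [Function.update_of_ne (hr d le_rfl)]
        by_cases hrv : r = 3 * v + 1
        · subst hrv
          simp [v0, c2, h.var]
        · simp only [Function.update_of_ne hrv]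
          exact c6 r hr hrv

theorem Cmd.compile_spec {A : ℕ} {Γ : Env} (c : Cmd) (hc : c.Ok A) (d : ℕ) (σ : Store)
    (s : State) (h : Rel A Γ σ s) :
    Tr (c.compile A d) s (c.cost A Γ) (fun s' => Rel A Γ (c.eval Γ σ) s' ∧
      ∀ j, j < d → s'.reg (3 * j + 2) = s.reg (3 * j + 2)) := by
  induction c generalizing d σ s with
  | assign v e =>
    refine Tr.seq ((e.compile_spec hc d σ s h).mono le_rfl fun s₁ h₁ => ?_)
    refine Tr.block (l := [_]) ?_
    have v0 : 3 * d + 2 ≠ 3 * v + 1 := by omega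
    have hr := h₁.2.rel h
    simp only [execs, Instr.exec_const, Instr.exec_add, Function.update_self, Nat.zero_add,
      Function.update_idem, Function.update_of_ne v0, h₁.1]
    refine ⟨⟨fun q => ?_, fun w => ?_, hr.inp, hr.arr⟩, fun j hj => ?_⟩
    · simp only
      rw [Function.update_of_ne (by omega), hr.param]
    · by_cases hw : w = v
      · subst hw
        simp [Cmd.eval, Store.set]
      · simp only [Cmd.eval, Store.set, Function.update_of_ne hw]
        rw [Function.update_of_ne (by omega), hr.var]
    · rw [Function.update_of_ne (by omega), h₁.2.temp hj]
  | store a i e =>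
    refine Tr.seq ((i.compile_spec hc.2.1 d σ s h).mono le_rfl fun s₁ h₁ => ?_)
    refine Tr.seq ((address_spec A a d s₁).mono le_rfl fun s₂ h₂ => ?_)
    have hf := h₁.2.trans h₂.2
    refine Tr.seq ((e.compile_spec hc.2.2 (d + 1) σ s₂ (hf.rel h)).mono le_rfl fun s₃ h₃ => ?_)
    have hr := (h₃.2.rel (hf.rel h))
    have h3 : s₁.reg 3 = Γ.param 1 := (h₁.2.rel h).param 1
    have haddr : s₃.reg (3 * d + 2) = Γ.param 1 + A * i.eval Γ σ + a := by
      rw [h₃.2.temp (Nat.lt_succ_self d), h₂.1, h₁.1, h3]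
    refine Tr.instr ⟨⟨hr.param, hr.var, fun x hx => ?_, fun b l hb => ?_⟩, fun j hj => ?_⟩
    · simp only [Instr.exec]
      rw [Function.update_of_ne (by rw [haddr]; omega), hr.inp x hx]
    · simp only [Instr.exec, haddr, Cmd.eval, Store.put, h₃.1]
      by_cases hba : b = a
      · subst hba
        by_cases hl : l = i.eval Γ σ
        · subst hl; simp
        · have hAl : A * l ≠ A * i.eval Γ σ := fun hh =>
            hl (Nat.eq_of_mul_eq_mul_left (by omega) hh)
          rw [Function.update_of_ne (by omega), Function.update_self, Function.update_of_ne hl,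
            hr.arr b l hb]
      · rw [Function.update_of_ne hba, Function.update_of_ne, hr.arr b l hb]
        -- the residue of an address modulo the number of arrays determines the array
        intro hh
        have h5 : A * l + b = A * i.eval Γ σ + a := by omega
        have h6 : (A * l + b) % A = (A * i.eval Γ σ + a) % A := by rw [h5]
        rw [Nat.mul_add_mod, Nat.mul_add_mod, Nat.mod_eq_of_lt hb, Nat.mod_eq_of_lt hc.1] at h6
        exact hba h6
    · simp only [Instr.exec]
      rw [h₃.2.temp (by omega), hf.temp hj]
  | seq c₁ c₂ ih₁ ih₂ =>
    refine Tr.seq ((ih₁ hc.1 d σ s h).mono le_rfl fun s₁ h₁ => ?_)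
    refine (ih₂ hc.2 d _ s₁ h₁.1).mono le_rfl fun s₂ h₂ => ⟨h₂.1, fun j hj => ?_⟩
    rw [h₂.2 j hj, h₁.2 j hj]
  | ite e c₁ c₂ ih₁ ih₂ =>
    refine Tr.seq ((e.compile_spec hc.1 d σ s h).mono le_rfl fun s₁ h₁ => ?_)
    refine Tr.ite (fun hi => ?_) (fun hi => ?_)
    · rw [h₁.1] at hi
      refine (ih₁ hc.2.1 d σ s₁ (h₁.2.rel h)).mono (by omega) fun s₂ h₂ => ⟨?_, fun j hj => ?_⟩
      · rw [eval, if_pos hi]; exact h₂.1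
      · rw [h₂.2 j hj, h₁.2.temp hj]
    · rw [h₁.1] at hi
      refine (ih₂ hc.2.2 d σ s₁ (h₁.2.rel h)).mono (by omega) fun s₂ h₂ => ⟨?_, fun j hj => ?_⟩
      · rw [eval, if_neg (by simpa using hi)]; exact h₂.1
      · rw [h₂.2 j hj, h₁.2.temp hj]
  | forTo p v c ih =>
    have n1 : 3 * d + 2 ≠ 3 * (d + 1) + 2 := by omega
    have n2 : 3 * d + 2 ≠ 3 * (d + 2) + 2 := by omega
    have n3 : 3 * (d + 1) + 2 ≠ 3 * (d + 2) + 2 := by omega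
    have v0 : 3 * d + 2 ≠ 3 * v + 1 := by omega
    have v1 : 3 * (d + 1) + 2 ≠ 3 * v + 1 := by omega
    let I : ℕ → State → Prop := fun j s' => j ≤ Γ.param p ∧ s'.reg (3 * d + 2) = j ∧
      s'.reg (3 * (d + 1) + 2) = Γ.param p - j ∧
      Rel A Γ (iter (c.eval Γ) v (Γ.param p - j) σ) s' ∧
      ∀ j, j < d → s'.reg (3 * j + 2) = s.reg (3 * j + 2)
    refine Tr.seq (Tr.block (l := [_, _]) ?_)
    refine (Tr.loop (T := 2 + (c.cost A Γ + 3)) I (fun s' h => h.2.1) ?_ (Γ.param p) _ ?_).mono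
      le_rfl ?_
    · rintro j s₁ ⟨c0, c1, c2, c3, c4⟩
      refine ⟨by omega, Tr.seq (Tr.block (l := [_]) ?_)⟩
      simp only [execs, Instr.exec_const, Instr.exec_add, Function.update_self, Nat.zero_add,
        Function.update_idem, Function.update_of_ne v1, c2]
      have hrel : Rel A Γ ((iter (c.eval Γ) v (Γ.param p - (j + 1)) σ).set v
          (Γ.param p - (j + 1)))
          ⟨Function.update s₁.reg (3 * v + 1) (Γ.param p - (j + 1)), s₁.mem⟩ := by
        refine ⟨fun q => ?_, fun w => ?_, c3.inp, c3.arr⟩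
        · simp only
          rw [Function.update_of_ne (by omega), c3.param]
        · by_cases hw : w = v
          · subst hw
            simp [Store.set]
          · simp only [Store.set, Function.update_of_ne hw]
            rw [Function.update_of_ne (by omega), c3.var]
      refine Tr.seq ((ih hc (d + 2) _ _ hrel).mono le_rfl fun s₃ h₃ => ?_)
      refine Tr.block (l := [_, _]) ?_
      have t0 := h₃.2 d (by omega)
      have t1 := h₃.2 (d + 1) (by omega)
      simp only [Function.update_of_ne v0, Function.update_of_ne v1, c1, c2] at t0 t1
      have hstep : Γ.param p - j = Γ.param p - (j + 1) + 1 := by omega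
      simp only [execs, Instr.exec_const, Instr.exec_add, Instr.exec_sub, Function.update_self,
        Function.update_of_ne n1, Function.update_of_ne n2, Function.update_of_ne n3,
        Function.update_of_ne n3.symm, t0, t1]
      refine ⟨by omega, by simp, ?_, ?_, fun i hi => ?_⟩
      · simp only [Function.update_of_ne n1.symm, Function.update_self]; omega
      · rw [hstep, iter]
        refine Frame.rel (d := d) (s := s₃) ?_ h₃.1
        exact (((Frame.refl d s₃).set (by omega)).set (by omega)).set le_rfl
      · simp only
        rw [Function.update_of_ne (by omega), Function.update_of_ne (by omega),
          Function.update_of_ne (by omega), h₃.2 i (by omega)]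
        simp only
        rw [Function.update_of_ne (by omega), c4 i hi]
    · have p0 : 3 * p ≠ 3 * d + 2 := by omega
      simp only [execs, Instr.exec_const, Instr.exec_add, Function.update_self, Nat.zero_add,
        Function.update_idem, Function.update_of_ne p0, h.param]
      refine ⟨le_rfl, ?_, ?_, ?_, fun i hi => ?_⟩
      · simp only [Function.update_of_ne n1, Function.update_self]
      · simp
      · rw [Nat.sub_self, iter]
        refine Frame.rel (d := d) (s := s) ?_ h
        exact ((Frame.refl d s).set le_rfl).set (by omega)
      · simp only
        rw [Function.update_of_ne (by omega), Function.update_of_ne (by omega)]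
    · rintro s₁ ⟨c0, c1, c2, c3, c4⟩
      exact ⟨by simpa [eval] using c3, c4⟩

/-! ### Cost bounds -/

/-- The cost of an expression is polynomial in any bound for the parameters. -/
theorem Expr.exists_cost_le (A : ℕ) (e : Expr) : ∃ C d : ℕ, ∀ (Γ : Env) (N : ℕ), 1 ≤ N →
    (∀ p, Γ.param p ≤ N) → e.cost A Γ ≤ C * N ^ d := by
  have one : ∀ {N : ℕ} (d : ℕ), 1 ≤ N → 1 ≤ N ^ d := fun d h => Nat.one_le_pow _ _ h
  have up : ∀ {N d d' : ℕ} (C : ℕ), 1 ≤ N → d ≤ d' → C * N ^ d ≤ C * N ^ d' := fun C h hd =>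
    Nat.mul_le_mul_left _ (Nat.pow_le_pow_right h hd)
  induction e with
  | const c => exact ⟨1, 0, fun Γ N hN _ => by simp [cost]⟩
  | param p => exact ⟨2, 0, fun Γ N hN _ => by simp [cost]⟩
  | var v => exact ⟨2, 0, fun Γ N hN _ => by simp [cost]⟩
  | arr a e ih =>
    obtain ⟨C, d, h⟩ := ih
    refine ⟨C + (A + 5), d, fun Γ N hN hp => ?_⟩
    have := h Γ N hN hp
    rw [cost]
    nlinarith [one d hN]
  | inp e ih =>
    obtain ⟨C, d, h⟩ := ih
    refine ⟨C + 3, d, fun Γ N hN hp => ?_⟩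
    have := h Γ N hN hp
    rw [cost]
    nlinarith [one d hN]
  | add e₁ e₂ ih₁ ih₂ =>
    obtain ⟨C₁, d₁, h₁⟩ := ih₁
    obtain ⟨C₂, d₂, h₂⟩ := ih₂
    refine ⟨C₁ + C₂ + 1, d₁ + d₂, fun Γ N hN hp => ?_⟩
    have g₁ := (h₁ Γ N hN hp).trans (up C₁ hN (Nat.le_add_right d₁ d₂))
    have g₂ := (h₂ Γ N hN hp).trans (up C₂ hN (Nat.le_add_left d₂ d₁))
    rw [cost]
    linarith [one (d₁ + d₂) hN]
  | sub e₁ e₂ ih₁ ih₂ =>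
    obtain ⟨C₁, d₁, h₁⟩ := ih₁
    obtain ⟨C₂, d₂, h₂⟩ := ih₂
    refine ⟨C₁ + C₂ + 1, d₁ + d₂, fun Γ N hN hp => ?_⟩
    have g₁ := (h₁ Γ N hN hp).trans (up C₁ hN (Nat.le_add_right d₁ d₂))
    have g₂ := (h₂ Γ N hN hp).trans (up C₂ hN (Nat.le_add_left d₂ d₁))
    rw [cost]
    linarith [one (d₁ + d₂) hN]
  | cond e₁ e₂ e₃ ih₁ ih₂ ih₃ =>
    obtain ⟨C₁, d₁, h₁⟩ := ih₁
    obtain ⟨C₂, d₂, h₂⟩ := ih₂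
    obtain ⟨C₃, d₃, h₃⟩ := ih₃
    refine ⟨C₁ + C₂ + C₃ + 1, d₁ + d₂ + d₃, fun Γ N hN hp => ?_⟩
    have g₁ := (h₁ Γ N hN hp).trans (up C₁ hN (show d₁ ≤ d₁ + d₂ + d₃ by omega))
    have g₂ := (h₂ Γ N hN hp).trans (up C₂ hN (show d₂ ≤ d₁ + d₂ + d₃ by omega))
    have g₃ := (h₃ Γ N hN hp).trans (up C₃ hN (show d₃ ≤ d₁ + d₂ + d₃ by omega))
    rw [cost]
    linarith [one (d₁ + d₂ + d₃) hN]
  | sum p v e ih =>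
    obtain ⟨C, d, h⟩ := ih
    refine ⟨C + 16, d + 1, fun Γ N hN hp => ?_⟩
    have g := h Γ N hN hp
    have h1 : Γ.param p * (4 + (e.cost A Γ + 1) + 1) ≤ N * (C * N ^ d + 6) :=
      Nat.mul_le_mul (hp p) (by omega)
    have h2 := one (d + 1) hN
    have h3 : N * 1 ≤ N * N ^ d := Nat.mul_le_mul_left _ (one d hN)
    rw [cost]
    calc 5 + (Γ.param p * (4 + (e.cost A Γ + 1) + 1) + 1 + 4)
        ≤ N * (C * N ^ d + 6) + 10 := by omega
      _ ≤ (C + 16) * N ^ (d + 1) := by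
        rw [pow_succ] at *
        nlinarith

/-- The cost of a command is polynomial in any bound for the parameters. -/
theorem Cmd.exists_cost_le (A : ℕ) (c : Cmd) : ∃ C d : ℕ, ∀ (Γ : Env) (N : ℕ), 1 ≤ N →
    (∀ p, Γ.param p ≤ N) → c.cost A Γ ≤ C * N ^ d := by
  have one : ∀ {N : ℕ} (d : ℕ), 1 ≤ N → 1 ≤ N ^ d := fun d h => Nat.one_le_pow _ _ h
  have up : ∀ {N d d' : ℕ} (C : ℕ), 1 ≤ N → d ≤ d' → C * N ^ d ≤ C * N ^ d' := fun C h hd =>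
    Nat.mul_le_mul_left _ (Nat.pow_le_pow_right h hd)
  induction c with
  | assign v e =>
    obtain ⟨C, d, h⟩ := e.exists_cost_le A
    refine ⟨C + 2, d, fun Γ N hN hp => ?_⟩
    have := h Γ N hN hp
    rw [cost]
    nlinarith [one d hN]
  | store a i e =>
    obtain ⟨C₁, d₁, h₁⟩ := i.exists_cost_le A
    obtain ⟨C₂, d₂, h₂⟩ := e.exists_cost_le A
    refine ⟨C₁ + C₂ + (A + 5), d₁ + d₂, fun Γ N hN hp => ?_⟩
    have g₁ := (h₁ Γ N hN hp).trans (up C₁ hN (Nat.le_add_right d₁ d₂))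
    have g₂ := (h₂ Γ N hN hp).trans (up C₂ hN (Nat.le_add_left d₂ d₁))
    rw [cost]
    nlinarith [one (d₁ + d₂) hN]
  | seq c₁ c₂ ih₁ ih₂ =>
    obtain ⟨C₁, d₁, h₁⟩ := ih₁
    obtain ⟨C₂, d₂, h₂⟩ := ih₂
    refine ⟨C₁ + C₂, d₁ + d₂, fun Γ N hN hp => ?_⟩
    have g₁ := (h₁ Γ N hN hp).trans (up C₁ hN (Nat.le_add_right d₁ d₂))
    have g₂ := (h₂ Γ N hN hp).trans (up C₂ hN (Nat.le_add_left d₂ d₁))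
    rw [cost]
    linarith
  | ite e c₁ c₂ ih₁ ih₂ =>
    obtain ⟨C₁, d₁, h₁⟩ := e.exists_cost_le A
    obtain ⟨C₂, d₂, h₂⟩ := ih₁
    obtain ⟨C₃, d₃, h₃⟩ := ih₂
    refine ⟨C₁ + C₂ + C₃ + 1, d₁ + d₂ + d₃, fun Γ N hN hp => ?_⟩
    have g₁ := (h₁ Γ N hN hp).trans (up C₁ hN (show d₁ ≤ d₁ + d₂ + d₃ by omega))
    have g₂ := (h₂ Γ N hN hp).trans (up C₂ hN (show d₂ ≤ d₁ + d₂ + d₃ by omega))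
    have g₃ := (h₃ Γ N hN hp).trans (up C₃ hN (show d₃ ≤ d₁ + d₂ + d₃ by omega))
    rw [cost]
    linarith [one (d₁ + d₂ + d₃) hN]
  | forTo p v c ih =>
    obtain ⟨C, d, h⟩ := ih
    refine ⟨C + 10, d + 1, fun Γ N hN hp => ?_⟩
    have g := h Γ N hN hp
    have h1 : Γ.param p * ((2 + (c.cost A Γ + 3)) + 1) ≤ N * (C * N ^ d + 6) :=
      Nat.mul_le_mul (hp p) (by omega)
    have h2 := one (d + 1) hN
    have h3 : N * 1 ≤ N * N ^ d := Nat.mul_le_mul_left _ (one d hN)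
    rw [cost]
    calc 3 + (Γ.param p * ((2 + (c.cost A Γ + 3)) + 1) + 1)
        ≤ N * (C * N ^ d + 6) + 4 := by omega
      _ ≤ (C + 10) * N ^ (d + 1) := by
        rw [pow_succ] at *
        nlinarith

end RAM

namespace RAM

/-! ### Conditions as expressions -/

/-- An expression, read as a condition. -/
def Expr.Holds (Γ : Env) (σ : Store) (e : Expr) : Prop := e.eval Γ σ ≠ 0

namespace Expr

/-- Negation. -/
def not (a : Expr) : Expr := cond a (const 0) (const 1)
/-- Conjunction. -/
def and (a b : Expr) : Expr := cond a b (const 0)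
/-- Disjunction: sums of natural numbers vanish only if both summands do. -/
def or (a b : Expr) : Expr := add a b
/-- Implication. -/
def imp (a b : Expr) : Expr := cond a b (const 1)
/-- The value of `a` is less than that of `b`, that is, the truncated difference is not zero. -/
def lt (a b : Expr) : Expr := sub b a
/-- The values of `a` and `b` are equal. -/
def eq (a b : Expr) : Expr := not (add (sub a b) (sub b a))
/-- There is a value of the variable `v` below the parameter `p` for which `e` holds. -/
def ex (p v : ℕ) (e : Expr) : Expr := sum p v e
/-- For all values of the variable `v` below the parameter `p`, the condition `e` holds. -/
def all (p v : ℕ) (e : Expr) : Expr := not (ex p v (not e))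
/-- One of the conditions of a list holds. -/
def any : List Expr → Expr
  | [] => const 0
  | e :: l => or e (any l)
/-- A multiple by a constant. -/
def smul (e : Expr) : ℕ → Expr
  | 0 => const 0
  | c + 1 => add (smul e c) e
/-- The product of `e` and the parameter `p`; the variable `v` must not occur in `e`. -/
def pmul (p v : ℕ) (e : Expr) : Expr := sum p v e

variable {Γ : Env} {σ : Store}

@[simp] theorem holds_not (a : Expr) : (not a).Holds Γ σ ↔ ¬ a.Holds Γ σ := by
  by_cases h : a.eval Γ σ = 0 <;> simp [Holds, not, eval, h]

@[simp] theorem holds_and (a b : Expr) :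
    (and a b).Holds Γ σ ↔ a.Holds Γ σ ∧ b.Holds Γ σ := by
  by_cases h : a.eval Γ σ = 0 <;> simp [Holds, and, eval, h]

@[simp] theorem holds_or (a b : Expr) :
    (or a b).Holds Γ σ ↔ a.Holds Γ σ ∨ b.Holds Γ σ := by
  simp only [Holds, or, eval]; omega

@[simp] theorem holds_imp (a b : Expr) :
    (imp a b).Holds Γ σ ↔ (a.Holds Γ σ → b.Holds Γ σ) := by
  by_cases h : a.eval Γ σ = 0 <;> simp [Holds, imp, eval, h]

@[simp] theorem holds_lt (a b : Expr) :
    (lt a b).Holds Γ σ ↔ a.eval Γ σ < b.eval Γ σ := by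
  simp only [Holds, lt, eval]; omega

@[simp] theorem holds_eq (a b : Expr) :
    (eq a b).Holds Γ σ ↔ a.eval Γ σ = b.eval Γ σ := by
  rw [eq, holds_not]; simp only [Holds, eval]; omega

@[simp] theorem holds_ex (p v : ℕ) (e : Expr) :
    (ex p v e).Holds Γ σ ↔ ∃ i < Γ.param p, e.Holds Γ (σ.set v i) := by
  simp [Holds, ex, eval, Finset.sum_eq_zero_iff]

@[simp] theorem holds_all (p v : ℕ) (e : Expr) :
    (all p v e).Holds Γ σ ↔ ∀ i < Γ.param p, e.Holds Γ (σ.set v i) := by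
  simp [all]

@[simp] theorem holds_any (l : List Expr) :
    (any l).Holds Γ σ ↔ ∃ e ∈ l, e.Holds Γ σ := by
  induction l with
  | nil => simp [any, Holds, eval]
  | cons e l ih => simp [any, ih]

theorem holds_const (c : ℕ) : (const c).Holds Γ σ ↔ c ≠ 0 := Iff.rfl

theorem holds_arr (a : ℕ) (e : Expr) : (arr a e).Holds Γ σ ↔ σ.arr a (e.eval Γ σ) ≠ 0 := Iff.rfl

theorem eval_cond (a b c : Expr) [Decidable (a.Holds Γ σ)] :
    (cond a b c).eval Γ σ = if a.Holds Γ σ then b.eval Γ σ else c.eval Γ σ := by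
  by_cases h : a.Holds Γ σ
  · rw [if_pos h, eval]; exact if_pos h
  · rw [if_neg h, eval]; exact if_neg h

@[simp] theorem eval_smul (e : Expr) (c : ℕ) : (smul e c).eval Γ σ = c * e.eval Γ σ := by
  induction c with
  | zero => simp [smul, eval]
  | succ c ih => simp [smul, eval, ih, add_mul]

/-- The array `a` does not occur. -/
def NoArr (a : ℕ) : Expr → Prop
  | const _ => True
  | param _ => True
  | var _ => True
  | arr b e => b ≠ a ∧ e.NoArr a
  | inp e => e.NoArr a
  | add e₁ e₂ => e₁.NoArr a ∧ e₂.NoArr a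
  | sub e₁ e₂ => e₁.NoArr a ∧ e₂.NoArr a
  | cond e₁ e₂ e₃ => e₁.NoArr a ∧ e₂.NoArr a ∧ e₃.NoArr a
  | sum _ _ e => e.NoArr a

/-- The variable `v` is not read. -/
def NoVar (v : ℕ) : Expr → Prop
  | const _ => True
  | param _ => True
  | var w => w ≠ v
  | arr _ e => e.NoVar v
  | inp e => e.NoVar v
  | add e₁ e₂ => e₁.NoVar v ∧ e₂.NoVar v
  | sub e₁ e₂ => e₁.NoVar v ∧ e₂.NoVar v
  | cond e₁ e₂ e₃ => e₁.NoVar v ∧ e₂.NoVar v ∧ e₃.NoVar v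
  | sum _ _ e => e.NoVar v

theorem eval_congr {a : ℕ} (e : Expr) (he : e.NoArr a) {σ τ : Store} (hv : σ.var = τ.var)
    (ha : ∀ b, b ≠ a → σ.arr b = τ.arr b) : e.eval Γ σ = e.eval Γ τ := by
  induction e generalizing σ τ with
  | const c => rfl
  | param p => rfl
  | var v => simp [eval, hv]
  | arr b e ih => simp [eval, ha b he.1, ih he.2 hv ha]
  | inp e ih => simp [eval, ih he hv ha]
  | add e₁ e₂ ih₁ ih₂ => simp [eval, ih₁ he.1 hv ha, ih₂ he.2 hv ha]
  | sub e₁ e₂ ih₁ ih₂ => simp [eval, ih₁ he.1 hv ha, ih₂ he.2 hv ha]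
  | cond e₁ e₂ e₃ ih₁ ih₂ ih₃ =>
    simp [eval, ih₁ he.1 hv ha, ih₂ he.2.1 hv ha, ih₃ he.2.2 hv ha]
  | sum p v e ih =>
    exact Finset.sum_congr rfl fun i _ => ih he (by simp [Store.set, hv]) ha

theorem eval_congr_var {v : ℕ} (e : Expr) (he : e.NoVar v) {σ τ : Store}
    (hv : ∀ w, w ≠ v → σ.var w = τ.var w) (ha : σ.arr = τ.arr) :
    e.eval Γ σ = e.eval Γ τ := by
  induction e generalizing σ τ with
  | const c => rfl
  | param p => rfl
  | var w => exact hv w he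
  | arr b e ih => simp [eval, ha, ih he hv ha]
  | inp e ih => simp [eval, ih he hv ha]
  | add e₁ e₂ ih₁ ih₂ => simp [eval, ih₁ he.1 hv ha, ih₂ he.2 hv ha]
  | sub e₁ e₂ ih₁ ih₂ => simp [eval, ih₁ he.1 hv ha, ih₂ he.2 hv ha]
  | cond e₁ e₂ e₃ ih₁ ih₂ ih₃ =>
    simp [eval, ih₁ he.1 hv ha, ih₂ he.2.1 hv ha, ih₃ he.2.2 hv ha]
  | sum p u e ih =>
    refine Finset.sum_congr rfl fun i _ => ih he (fun w hw => ?_) ha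
    simp only [Store.set, Function.update_apply]
    split_ifs
    · rfl
    · exact hv w hw

theorem eval_pmul (p v : ℕ) (e : Expr) (he : e.NoVar v) :
    (pmul p v e).eval Γ σ = Γ.param p * e.eval Γ σ := by
  have h : ∀ i ∈ Finset.range (Γ.param p), e.eval Γ (σ.set v i) = e.eval Γ σ := fun i _ =>
    eval_congr_var e he (fun w hw => by simp [Store.set, hw]) rfl
  rw [pmul, eval, Finset.sum_congr rfl h]
  simp

end Expr

@[simp] theorem Store.set_arr (σ : Store) (v x : ℕ) : (σ.set v x).arr = σ.arr := rfl

@[simp] theorem Store.set_var (σ : Store) (v x w : ℕ) :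
    (σ.set v x).var w = if w = v then x else σ.var w := by
  simp [Store.set, Function.update_apply]

@[simp] theorem Store.put_var (σ : Store) (a i x : ℕ) : (σ.put a i x).var = σ.var := rfl

theorem Store.put_arr_of_ne (σ : Store) {a b : ℕ} (i x : ℕ) (h : b ≠ a) :
    (σ.put a i x).arr b = σ.arr b := by
  simp [Store.put, h]

/-! ### Frame conditions for commands -/

/-- The variable `v` is not written. -/
def Cmd.KeepsVar (v : ℕ) : Cmd → Prop
  | assign w _ => w ≠ v
  | store _ _ _ => True
  | seq c₁ c₂ => c₁.KeepsVar v ∧ c₂.KeepsVar v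
  | ite _ c₁ c₂ => c₁.KeepsVar v ∧ c₂.KeepsVar v
  | forTo _ w c => w ≠ v ∧ c.KeepsVar v

/-- The array `a` is not written. -/
def Cmd.KeepsArr (a : ℕ) : Cmd → Prop
  | assign _ _ => True
  | store b _ _ => b ≠ a
  | seq c₁ c₂ => c₁.KeepsArr a ∧ c₂.KeepsArr a
  | ite _ c₁ c₂ => c₁.KeepsArr a ∧ c₂.KeepsArr a
  | forTo _ _ c => c.KeepsArr a

/-- The rule for loops: an invariant that is indexed by the number of iterations done. -/
theorem iter_induction {f : Store → Store} {v : ℕ} (I : ℕ → Store → Prop) {N : ℕ} {σ : Store}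
    (h0 : I 0 σ) (hs : ∀ i < N, ∀ τ, I i τ → I (i + 1) (f (τ.set v i))) :
    I N (iter f v N σ) := by
  induction N with
  | zero => exact h0
  | succ N ih => exact hs N (Nat.lt_succ_self N) _ (ih fun i hi => hs i (by omega))

theorem Cmd.eval_var {Γ : Env} {v : ℕ} (c : Cmd) (hc : c.KeepsVar v) (σ : Store) :
    (c.eval Γ σ).var v = σ.var v := by
  induction c generalizing σ with
  | assign w e => simp [eval, Ne.symm hc]
  | store a i e => rfl
  | seq c₁ c₂ ih₁ ih₂ => rw [eval, ih₂ hc.2, ih₁ hc.1]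
  | ite e c₁ c₂ ih₁ ih₂ =>
    rw [eval]
    split_ifs
    · exact ih₁ hc.1 σ
    · exact ih₂ hc.2 σ
  | forTo p w c ih =>
    rw [eval]
    refine iter_induction (fun _ τ => τ.var v = σ.var v) rfl fun i _ τ h => ?_
    rw [ih hc.2]
    simpa [Ne.symm hc.1] using h

theorem Cmd.eval_arr {Γ : Env} {a : ℕ} (c : Cmd) (hc : c.KeepsArr a) (σ : Store) :
    (c.eval Γ σ).arr a = σ.arr a := by
  induction c generalizing σ with
  | assign w e => rfl
  | store b i e => exact σ.put_arr_of_ne _ _ (Ne.symm hc)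
  | seq c₁ c₂ ih₁ ih₂ => rw [eval, ih₂ hc.2, ih₁ hc.1]
  | ite e c₁ c₂ ih₁ ih₂ =>
    rw [eval]
    split_ifs
    · exact ih₁ hc.1 σ
    · exact ih₂ hc.2 σ
  | forTo p w c ih =>
    rw [eval]
    refine iter_induction (fun _ τ => τ.arr a = σ.arr a) rfl fun i _ τ h => ?_
    rw [ih hc]
    simpa using h

namespace Cmd

variable {Γ : Env}

/-- A command without relevant effect: no other command uses the variable `90`. -/
def skip : Cmd := assign 90 (.const 0)

/-- The commands of a list in turn. -/
def seqs : List Cmd → Cmd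
  | [] => skip
  | c :: l => seq c (seqs l)

/-- Set the entries of the array `a` below `param 0` to the values of `e`, which may depend on
the variable `v` for the index. -/
def map (a v : ℕ) (e : Expr) : Cmd := forTo 0 v (store a (.var v) e)

/-- Simultaneous `map`s for a family of arrays. -/
def maps {k : ℕ} (a : Fin k → ℕ) (v : ℕ) (e : Fin k → Expr) : Cmd :=
  seqs ((List.finRange k).map fun c => map (a c) v (e c))

@[simp] theorem keepsVar_seqs (v : ℕ) (l : List Cmd) :
    (seqs l).KeepsVar v ↔ 90 ≠ v ∧ ∀ c ∈ l, c.KeepsVar v := by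
  induction l with
  | nil => simp [seqs, skip, KeepsVar]
  | cons c l ih => simp [seqs, KeepsVar, ih]; tauto

@[simp] theorem keepsArr_seqs (a : ℕ) (l : List Cmd) :
    (seqs l).KeepsArr a ↔ ∀ c ∈ l, c.KeepsArr a := by
  induction l with
  | nil => simp [seqs, skip, KeepsArr]
  | cons c l ih => simp [seqs, KeepsArr, ih]

@[simp] theorem keepsVar_map (a v w : ℕ) (e : Expr) : (map a v e).KeepsVar w ↔ v ≠ w := by
  simp [map, KeepsVar]

@[simp] theorem keepsArr_map (a v b : ℕ) (e : Expr) : (map a v e).KeepsArr b ↔ a ≠ b := by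
  simp [map, KeepsArr]

@[simp] theorem keepsVar_maps {k : ℕ} (a : Fin k → ℕ) (v w : ℕ) (e : Fin k → Expr) :
    (maps a v e).KeepsVar w ↔ 90 ≠ w ∧ ∀ _ : Fin k, v ≠ w := by
  simp [maps]

@[simp] theorem keepsArr_maps {k : ℕ} (a : Fin k → ℕ) (v b : ℕ) (e : Fin k → Expr) :
    (maps a v e).KeepsArr b ↔ ∀ c, a c ≠ b := by
  simp [maps]

@[simp] theorem ok_seqs (A : ℕ) (l : List Cmd) : (seqs l).Ok A ↔ ∀ c ∈ l, c.Ok A := by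
  induction l with
  | nil => simp [seqs, skip, Ok, Expr.Ok]
  | cons c l ih => simp [seqs, Ok, ih]

@[simp] theorem ok_map (A a v : ℕ) (e : Expr) : (map a v e).Ok A ↔ a < A ∧ e.Ok A := by
  simp [map, Ok, Expr.Ok]

@[simp] theorem ok_maps {k : ℕ} (A : ℕ) (a : Fin k → ℕ) (v : ℕ) (e : Fin k → Expr) :
    (maps a v e).Ok A ↔ ∀ c, a c < A ∧ (e c).Ok A := by
  simp [maps]

theorem eval_map {a v : ℕ} {e : Expr} (he : e.NoArr a) (σ : Store) {i : ℕ}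
    (hi : i < Γ.param 0) : ((map a v e).eval Γ σ).arr a i = e.eval Γ (σ.set v i) := by
  let I : ℕ → Store → Prop := fun N τ => (∀ w, w ≠ v → τ.var w = σ.var w) ∧
    (∀ b, b ≠ a → τ.arr b = σ.arr b) ∧ ∀ i < N, τ.arr a i = e.eval Γ (σ.set v i)
  have key : I (Γ.param 0) (iter ((store a (.var v) e).eval Γ) v (Γ.param 0) σ) := by
    refine iter_induction I ⟨fun _ _ => rfl, fun _ _ => rfl, fun _ h => by omega⟩ ?_
    rintro j hj τ ⟨h1, h2, h3⟩
    refine ⟨fun w hw => by simp [eval, hw, h1 w hw], fun b hb => ?_, fun l hl => ?_⟩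
    · rw [eval, Store.put_arr_of_ne _ _ _ hb, Store.set_arr, h2 b hb]
    · by_cases hlj : l = j
      · subst hlj
        simp only [eval, Store.put, Expr.eval, Store.set_var, if_true, Function.update_self]
        refine Expr.eval_congr e he (funext fun w => ?_) h2
        by_cases hw : w = v <;> simp [hw, h1]
      · simp only [eval, Store.put, Expr.eval, Store.set_var, if_true, Function.update_self,
          Function.update_of_ne hlj]
        exact h3 l (by omega)
  exact key.2.2 i hi

theorem eval_maps {k : ℕ} {a : Fin k → ℕ} (ha : Function.Injective a) {v : ℕ}
    {e : Fin k → Expr} (he : ∀ c c', (e c).NoArr (a c'))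
    (σ : Store) (c : Fin k) {i : ℕ} (hi : i < Γ.param 0) :
    ((maps a v e).eval Γ σ).arr (a c) i = (e c).eval Γ (σ.set v i) := by
  have key : ∀ (l : List (Fin k)) (τ : Store), l.Nodup → c ∈ l →
      ((seqs (l.map fun c => map (a c) v (e c))).eval Γ τ).arr (a c) i =
        (e c).eval Γ (τ.set v i) := by
    intro l
    induction l with
    | nil => intro τ _ h; simp at h
    | cons c' l ih =>
      intro τ hl hc
      rw [List.nodup_cons] at hl
      rw [List.map_cons, seqs, eval]
      by_cases hcc : c = c'
      · subst hcc
        rw [eval_arr _ _ _, eval_map (he c c) τ hi]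
        simp only [keepsArr_seqs, List.mem_map, forall_exists_index, and_imp,
          forall_apply_eq_imp_iff₂, keepsArr_map]
        intro d hd hh
        exact hl.1 (ha hh ▸ hd)
      · rw [ih _ hl.2 (by simpa [hcc] using hc)]
        refine Expr.eval_congr (e c) (he c c') (funext fun w => ?_) fun b hb => ?_
        · by_cases hw : w = v
          · simp [hw]
          · simp only [Store.set_var, hw, if_false]
            exact eval_var _ (by simpa using Ne.symm hw) _
        · simp only [Store.set_arr]
          exact eval_arr _ (by simpa using Ne.symm hb) _
  exact key _ σ (List.nodup_finRange k) (List.mem_finRange c)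

end Cmd

end RAM

/-! ### Arc consistency, and list colouring with lists of size two -/

namespace ListColoring

open LoopGraph

variable {n k : ℕ} (G : SimpleGraph (Fin n)) (H : LoopGraph (Fin k))

open Classical in
/-- One round of arc consistency: remove all colours that have no partner in the list of some
neighbour. -/
noncomputable def pass (X : Fin n → Finset (Fin k)) : Fin n → Finset (Fin k) := fun v =>
  (X v).filter fun c => ∀ u, G.Adj v u → ∃ b ∈ X u, H.Adj c b

/-- `N` rounds of arc consistency. -/
noncomputable def propagate (N : ℕ) (X : Fin n → Finset (Fin k)) : Fin n → Finset (Fin k) :=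
  (pass G H)^[N] X

variable {G H}

theorem mem_pass {X : Fin n → Finset (Fin k)} {v : Fin n} {c : Fin k} :
    c ∈ pass G H X v ↔ c ∈ X v ∧ ∀ u, G.Adj v u → ∃ b ∈ X u, H.Adj c b := by
  classical
  simp [pass]

theorem pass_subset (X : Fin n → Finset (Fin k)) (v : Fin n) : pass G H X v ⊆ X v :=
  fun _ h => (mem_pass.1 h).1

theorem propagate_subset (N : ℕ) (X : Fin n → Finset (Fin k)) (v : Fin n) :
    propagate G H N X v ⊆ X v := by
  induction N with
  | zero => exact fun _ h => h
  | succ N ih =>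
    rw [propagate, Function.iterate_succ_apply']
    exact (pass_subset _ v).trans ih

theorem isListHom_propagate {X : Fin n → Finset (Fin k)} {φ : Fin n → Fin k}
    (h : IsListHom G X H φ) (N : ℕ) : IsListHom G (propagate G H N X) H φ := by
  induction N with
  | zero => exact h
  | succ N ih =>
    refine ⟨h.1, fun v => ?_⟩
    rw [propagate, Function.iterate_succ_apply']
    exact mem_pass.2 ⟨ih.2 v, fun u hu => ⟨φ u, ih.2 u, h.1 v u hu⟩⟩

theorem sum_card_le (X : Fin n → Finset (Fin k)) : ∑ v, (X v).card ≤ n * k := by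
  calc ∑ v, (X v).card ≤ ∑ _v : Fin n, k :=
        Finset.sum_le_sum fun v _ => (Finset.card_le_univ _).trans (by simp)
    _ = n * k := by simp

/-- After `n * k` rounds nothing changes any more: each round that changes something
removes a colour from a list. -/
theorem pass_propagate {N : ℕ} (hN : n * k ≤ N) (X : Fin n → Finset (Fin k)) :
    pass G H (propagate G H N X) = propagate G H N X := by
  have key : ∀ N, pass G H (propagate G H N X) = propagate G H N X ∨
      N + ∑ v, (propagate G H N X v).card ≤ n * k := by
    intro N
    induction N with
    | zero => exact Or.inr (by simpa using sum_card_le _)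
    | succ N ih =>
      have hs : propagate G H (N + 1) X = pass G H (propagate G H N X) :=
        Function.iterate_succ_apply' _ _ _
      rcases ih with ih | ih
      · left; rw [hs, ih, ih]
      · by_cases heq : pass G H (propagate G H N X) = propagate G H N X
        · left; rw [hs, heq, heq]
        · right
          obtain ⟨v, hv⟩ := Function.ne_iff.1 heq
          have hlt : ∑ v, (propagate G H (N + 1) X v).card < ∑ v, (propagate G H N X v).card := by
            rw [hs]
            refine Finset.sum_lt_sum (fun u _ => Finset.card_le_card (pass_subset _ u))
              ⟨v, Finset.mem_univ v, Finset.card_lt_card ?_⟩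
            exact (pass_subset _ v).ssubset_of_ne hv
          omega
  rcases key N with h | h
  · exact h
  · have h0 : ∑ v, (propagate G H N X v).card = 0 := by omega
    funext v
    have : propagate G H N X v = ∅ := by
      rw [← Finset.card_eq_zero]
      exact Finset.sum_eq_zero_iff.1 h0 v (Finset.mem_univ v)
    rw [this, ← Finset.subset_empty, ← this]
    exact pass_subset _ v

variable (G H)

open Classical in
/-- Give `v` the colour `c` if `c` is in its list and arc consistency does not refute that. -/
noncomputable def trial (N : ℕ) (X : Fin n → Finset (Fin k)) (v : Fin n) (c : Fin k) :
    Fin n → Finset (Fin k) :=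
  if c ∈ X v ∧ ∀ u, (propagate G H N (Function.update X v {c}) u).Nonempty then
    propagate G H N (Function.update X v {c})
  else X

/-- Try all colours of a list for `v`. -/
noncomputable def trials (N : ℕ) (v : Fin n) (l : List (Fin k)) (X : Fin n → Finset (Fin k)) :
    Fin n → Finset (Fin k) :=
  l.foldl (fun X c => trial G H N X v c) X

/-- Try all colours for the first `i` vertices in turn. -/
noncomputable def solve (N : ℕ) (X : Fin n → Finset (Fin k)) : ℕ → Fin n → Finset (Fin k)
  | 0 => X
  | i + 1 => if h : i < n then trials G H N ⟨i, h⟩ (List.finRange k) (solve N X i)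
      else solve N X i

variable {G H}

/-- If arc consistency leaves no list empty, then satisfiability is preserved: the lists that
have shrunk are singletons, and all others can keep their colours. -/
theorem isListHom_of_propagate {N : ℕ} (hN : n * k ≤ N) {X Y : Fin n → Finset (Fin k)}
    {φ : Fin n → Fin k} (hX : ∀ v, (X v).card ≤ 2) (hφ : IsListHom G X H φ)
    (hYX : ∀ v, Y v ⊆ X v) (hne : ∀ v, (propagate G H N Y v).Nonempty) :
    ∃ ψ, IsListHom G (propagate G H N Y) H ψ := by
  classical
  set Z := propagate G H N Y with hZ
  have hZX : ∀ v, Z v ⊆ X v := fun v => (propagate_subset N Y v).trans (hYX v)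
  have hfix : ∀ v c, c ∈ Z v → ∀ u, G.Adj v u → ∃ b ∈ Z u, H.Adj c b := by
    intro v c hc
    have hc' : c ∈ pass G H Z v := by rw [hZ, pass_propagate hN]; exact hc
    exact (mem_pass.1 hc').2
  have hor : ∀ v, (∃ c, Z v = {c}) ∨ Z v = X v := by
    intro v
    have h1 := Finset.card_pos.2 (hne v)
    by_cases h : (Z v).card = 1
    · exact Or.inl (Finset.card_eq_one.1 h)
    · exact Or.inr (Finset.eq_of_subset_of_card_le (hZX v) (by have := hX v; omega))
  let ψ : Fin n → Fin k := fun v => if h : ∃ c, Z v = {c} then h.choose else φ v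
  have hψ : ∀ v, (Z v = {ψ v}) ∨ (Z v = X v ∧ ψ v = φ v) := by
    intro v
    by_cases h : ∃ c, Z v = {c}
    · left; simp only [ψ, h, dif_pos]; exact h.choose_spec
    · right; exact ⟨(hor v).resolve_left h, by simp only [ψ, h, dif_neg, not_false_eq_true]⟩
  have hmem : ∀ v, ψ v ∈ Z v := by
    intro v
    rcases hψ v with h | ⟨h, h'⟩
    · rw [h]; exact Finset.mem_singleton_self _
    · rw [h, h']; exact hφ.2 v
  refine ⟨ψ, fun u v huv => ?_, hmem⟩
  rcases hψ v with h | ⟨h, h'⟩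
  · obtain ⟨b, hb, hab⟩ := hfix u (ψ u) (hmem u) v huv
    rw [h, Finset.mem_singleton] at hb
    exact hb ▸ hab
  · rcases hψ u with g | ⟨g, g'⟩
    · obtain ⟨b, hb, hab⟩ := hfix v (ψ v) (hmem v) u huv.symm
      rw [g, Finset.mem_singleton] at hb
      exact H.symm _ _ (hb ▸ hab)
    · rw [h', g']; exact hφ.1 u v huv

theorem trial_subset (N : ℕ) (X : Fin n → Finset (Fin k)) (v : Fin n) (c : Fin k) (u : Fin n) :
    trial G H N X v c u ⊆ X u := by
  rw [trial]
  split_ifs with h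
  · refine (propagate_subset _ _ u).trans ?_
    by_cases huv : u = v
    · subst huv; simpa using h.1
    · rw [Function.update_of_ne huv]
  · exact fun _ h => h

theorem trial_satisfiable {N : ℕ} (hN : n * k ≤ N) {X : Fin n → Finset (Fin k)}
    (hX : ∀ v, (X v).card ≤ 2) (hφ : ∃ φ, IsListHom G X H φ) (v : Fin n) (c : Fin k) :
    ∃ φ, IsListHom G (trial G H N X v c) H φ := by
  rw [trial]
  split_ifs with h
  · obtain ⟨φ, hφ⟩ := hφ
    refine isListHom_of_propagate hN hX hφ (fun u => ?_) h.2
    by_cases huv : u = v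
    · subst huv; simpa using h.1
    · rw [Function.update_of_ne huv]
  · exact hφ

/-- The lists `X` have size at most two and admit a colouring. -/
def Easy (G : SimpleGraph (Fin n)) (H : LoopGraph (Fin k)) (X : Fin n → Finset (Fin k)) : Prop :=
  (∀ v, (X v).card ≤ 2) ∧ ∃ φ, IsListHom G X H φ

theorem Easy.trial_easy {N : ℕ} (hN : n * k ≤ N) {X : Fin n → Finset (Fin k)} (h : Easy G H X)
    (v : Fin n) (c : Fin k) : Easy G H (trial G H N X v c) :=
  ⟨fun u => (Finset.card_le_card (trial_subset N X v c u)).trans (h.1 u),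
    trial_satisfiable hN h.1 h.2 v c⟩

theorem trials_subset (N : ℕ) (v : Fin n) (l : List (Fin k)) (X : Fin n → Finset (Fin k))
    (u : Fin n) : trials G H N v l X u ⊆ X u := by
  induction l generalizing X with
  | nil => exact fun _ h => h
  | cons c l ih => exact (ih _).trans (trial_subset N X v c u)

theorem Easy.trials_easy {N : ℕ} (hN : n * k ≤ N) (v : Fin n) (l : List (Fin k))
    {X : Fin n → Finset (Fin k)} (h : Easy G H X) : Easy G H (trials G H N v l X) := by
  induction l generalizing X with
  | nil => exact h
  | cons c l ih => exact ih (h.trial_easy hN v c)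

theorem Easy.card_pos {X : Fin n → Finset (Fin k)} (h : Easy G H X) (v : Fin n) :
    0 < (X v).card := by
  obtain ⟨φ, hφ⟩ := h.2
  exact Finset.card_pos.2 ⟨φ v, hφ.2 v⟩

/-- The trial of the right colour succeeds, and each successful trial fixes the colour of `v`. -/
theorem card_trials {N : ℕ} (hN : n * k ≤ N) (v : Fin n) (l : List (Fin k))
    {X : Fin n → Finset (Fin k)} (h : Easy G H X)
    (hl : ∃ φ, IsListHom G X H φ ∧ φ v ∈ l) : (trials G H N v l X v).card = 1 := by
  classical
  induction l generalizing X with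
  | nil => obtain ⟨φ, -, h⟩ := hl; simp at h
  | cons c l ih =>
    by_cases hc : c ∈ X v ∧ ∀ u, (propagate G H N (Function.update X v {c}) u).Nonempty
    · have hsub : (trials G H N v (c :: l) X v) ⊆ {c} := by
        refine (trials_subset N v l (trial G H N X v c) v).trans ?_
        rw [trial, if_pos hc]
        refine (propagate_subset _ _ v).trans ?_
        rw [Function.update_self]
      have h1 := Finset.card_le_card hsub
      have h2 := (h.trials_easy hN v (c :: l)).card_pos v
      rw [Finset.card_singleton] at h1
      omega
    · obtain ⟨φ, hφ, hmem⟩ := hl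
      have ht : trial G H N X v c = X := by rw [trial, if_neg hc]
      rw [trials, List.foldl_cons, ht]
      refine ih h ⟨φ, hφ, ?_⟩
      rcases List.mem_cons.1 hmem with hφc | hmem
      · exfalso
        refine hc ⟨hφc ▸ hφ.2 v, fun u => ⟨φ u, ?_⟩⟩
        refine (isListHom_propagate (X := Function.update X v {c}) ⟨hφ.1, fun u => ?_⟩ N).2 u
        by_cases huv : u = v
        · subst huv; simp [hφc]
        · rw [Function.update_of_ne huv]; exact hφ.2 u
      · exact hmem

/-- Lists of size at most two are solved greedily. -/
theorem solve_spec {N : ℕ} (hN : n * k ≤ N) {X : Fin n → Finset (Fin k)} (h : Easy G H X)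
    (i : ℕ) : Easy G H (solve G H N X i) ∧ ∀ v : Fin n, v < i → (solve G H N X i v).card = 1 := by
  induction i with
  | zero => exact ⟨h, fun v hv => absurd hv (by omega)⟩
  | succ i ih =>
    rw [solve]
    split_ifs with hi
    · have he := ih.1.trials_easy hN ⟨i, hi⟩ (List.finRange k)
      refine ⟨he, fun v hv => ?_⟩
      by_cases hvi : (v : ℕ) = i
      · have : v = ⟨i, hi⟩ := Fin.ext hvi
        subst this
        obtain ⟨φ, hφ⟩ := ih.1.2
        exact card_trials hN _ _ ih.1 ⟨φ, hφ, List.mem_finRange _⟩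
      · have h1 := Finset.card_le_card (trials_subset (G := G) (H := H) N ⟨i, hi⟩
          (List.finRange k) (solve G H N X i) v)
        have h2 := ih.2 v (by omega)
        have h3 := he.card_pos v
        omega
    · exact ⟨ih.1, fun v hv => ih.2 v (by have := v.2; omega)⟩

/-- The lists that remain when a partial colouring `A` has been fixed; a value of `A` that is
not below `k` means that the vertex is not coloured. -/
def restrict (L : Fin n → Finset (Fin k)) (A : Fin n → ℕ) : Fin n → Finset (Fin k) := fun v =>
  (L v).filter fun c => A v = c ∨ k ≤ A v

/-- The lists are singletons and give a list homomorphism. -/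
def Solved (G : SimpleGraph (Fin n)) (H : LoopGraph (Fin k)) (L X : Fin n → Finset (Fin k)) :
    Prop :=
  (∀ v, ∃ c ∈ L v, ∀ d, d ∈ X v ↔ d = c) ∧
    ∀ u v, G.Adj u v → ∃ c ∈ X u, ∃ d ∈ X v, H.Adj c d

theorem Solved.exists_isListHom {L X : Fin n → Finset (Fin k)} (h : Solved G H L X) :
    ∃ φ, IsListHom G L H φ := by
  choose φ hφ hφ' using h.1
  refine ⟨φ, fun u v huv => ?_, hφ⟩
  obtain ⟨c, hc, d, hd, hcd⟩ := h.2 u v huv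
  rw [hφ'] at hc hd
  exact hc ▸ hd ▸ hcd

/-- The partial colouring `A` extends to the list homomorphism `φ`, and it determines the
colours of all vertices up to two possibilities. -/
def Decisive (G : SimpleGraph (Fin n)) (H : LoopGraph (Fin k)) (φ : Fin n → Fin k)
    (A : Fin n → ℕ) : Prop :=
  (∀ v, A v < k → A v = φ v) ∧
    ∀ Y : Fin n → Finset (Fin k), (∀ v c, c ∈ Y v → A v < k → A v = c) →
      (∀ v c, c ∈ Y v → ∀ u, G.Adj v u → ∃ b ∈ Y u, H.Adj c b) → ∀ v, (Y v).card ≤ 2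

theorem Decisive.solved {N : ℕ} (hN : n * k ≤ N) {L : Fin n → Finset (Fin k)}
    {φ : Fin n → Fin k} (hφ : IsListHom G L H φ) {A : Fin n → ℕ} (h : Decisive G H φ A) :
    Solved G H L (solve G H N (propagate G H N (restrict L A)) n) := by
  have h0 : IsListHom G (restrict L A) H φ := by
    refine ⟨hφ.1, fun v => Finset.mem_filter.2 ⟨hφ.2 v, ?_⟩⟩
    by_cases hv : A v < k
    · exact Or.inl (h.1 v hv)
    · exact Or.inr (by omega)
  have he : Easy G H (propagate G H N (restrict L A)) := by
    refine ⟨h.2 _ (fun v c hc hv => ?_) (fun v c hc => ?_), φ, isListHom_propagate h0 N⟩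
    · rcases (Finset.mem_filter.1 (propagate_subset N _ v hc)).2 with h | h
      · exact h
      · omega
    · rw [← pass_propagate hN] at hc
      exact (mem_pass.1 hc).2
  have hsub : ∀ i v, solve G H N (propagate G H N (restrict L A)) i v ⊆ L v := by
    intro i v
    induction i with
    | zero => exact (propagate_subset N _ v).trans (Finset.filter_subset _ _)
    | succ i ih =>
      rw [solve]
      split_ifs
      · exact (trials_subset N _ _ _ v).trans ih
      · exact ih
  obtain ⟨⟨-, ψ, hψ⟩, hcard⟩ := solve_spec hN he n
  refine ⟨fun v => ⟨ψ v, hsub n v (hψ.2 v), fun d => ?_⟩, fun u v huv =>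
    ⟨ψ u, hψ.2 u, ψ v, hψ.2 v, hψ.1 u v huv⟩⟩
  obtain ⟨c, hc⟩ := Finset.card_eq_one.1 (hcard v v.2)
  have hψc := hψ.2 v
  rw [hc, Finset.mem_singleton] at hψc ⊢
  rw [hψc]

end ListColoring

/-! ### The list colouring procedure as a command -/

namespace RAM

open ListColoring

variable {n k : ℕ} {G : SimpleGraph (Fin n)} {L : Fin n → Finset (Fin k)}

theorem input_adj (u v : Fin n) : (input G L).mem (u * n + v) ≠ 0 ↔ G.Adj u v := by
  classical
  have hn : 0 < n := u.pos
  simp only [input]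
  constructor
  · intro h
    split_ifs at h with hc
    · rcases hc with ⟨u', v', h1, h2⟩ | ⟨v', c, h1, h2⟩
      · have hu : (u : ℕ) = u' := by
          have := congrArg (· / n) h1
          simpa [Nat.mul_comm _ n, Nat.mul_add_div hn, Nat.div_eq_of_lt] using this
        have hv : (v : ℕ) = v' := by rw [hu] at h1; omega
        rw [Fin.ext hu, Fin.ext hv]; exact h2
      · have : (u : ℕ) * n + v < n * n := by
          calc (u : ℕ) * n + v < u * n + n := by omega
            _ = (u + 1) * n := by ring
            _ ≤ n * n := Nat.mul_le_mul_right _ u.2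
        omega
    · exact absurd rfl h
  · intro h
    rw [if_pos (Or.inl ⟨u, v, rfl, h⟩)]
    exact one_ne_zero

theorem input_list (v : Fin n) (c : Fin k) :
    (input G L).mem (n * n + (v * k + c)) ≠ 0 ↔ c ∈ L v := by
  classical
  have hk : 0 < k := c.pos
  simp only [input]
  constructor
  · intro h
    split_ifs at h with hc
    · rcases hc with ⟨u', v', h1, h2⟩ | ⟨v', c', h1, h2⟩
      · have : (u' : ℕ) * n + v' < n * n := by
          calc (u' : ℕ) * n + v' < u' * n + n := by omega
            _ = (u' + 1) * n := by ring
            _ ≤ n * n := Nat.mul_le_mul_right _ u'.2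
        omega
      · have h1' : (v : ℕ) * k + c = v' * k + c' := by omega
        have hu : (v : ℕ) = v' := by
          have := congrArg (· / k) h1'
          simpa [Nat.mul_comm _ k, Nat.mul_add_div hk, Nat.div_eq_of_lt] using this
        have hv : (c : ℕ) = c' := by rw [hu] at h1'; omega
        rw [Fin.ext hu, Fin.ext hv]; exact h2
    · exact absurd rfl h
  · intro h
    rw [if_pos (Or.inr ⟨v, c, rfl, h⟩)]
    exact one_ne_zero

/-- The environment provides the instance `(G, L)`: parameter `0` is the number of vertices,
parameter `1` the length of the input and parameter `2` the address of the first list. -/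
structure IsInstance (Γ : Env) (G : SimpleGraph (Fin n)) (L : Fin n → Finset (Fin k)) : Prop where
  vertices : Γ.param 0 = n
  length : Γ.param 1 = n * n + n * k
  lists : Γ.param 2 = n * n
  inp : Γ.inp = (input G L).mem

/-- Array `0` holds the addresses of the rows of the adjacency matrix. -/
def HasRows (n : ℕ) (σ : Store) : Prop := ∀ u < n, σ.arr 0 u = u * n

/-- `u` and `v` are adjacent. -/
def Expr.adj (u v : Expr) : Expr := inp (add (arr 0 u) v)

/-- The colour `c` is in the list of `v`. -/
def Expr.inList (k c : ℕ) (v : Expr) : Expr := inp (add (param 2) (add (smul v k) (const c)))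

variable {Γ : Env} {σ : Store}

theorem holds_adj (hΓ : IsInstance Γ G L) (hσ : HasRows n σ) {e f : Expr} (u v : Fin n)
    (he : e.eval Γ σ = u) (hf : f.eval Γ σ = v) : (Expr.adj e f).Holds Γ σ ↔ G.Adj u v := by
  have hlt : (u : ℕ) * n + v < Γ.param 1 := by
    rw [hΓ.length]
    calc (u : ℕ) * n + v < u * n + n := by omega
      _ = (u + 1) * n := by ring
      _ ≤ n * n := Nat.mul_le_mul_right _ u.2
      _ ≤ _ := Nat.le_add_right _ _
  simp only [Expr.Holds, Expr.adj, Expr.eval, he, hf, hσ u u.2, if_pos hlt, hΓ.inp]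
  exact input_adj u v

theorem holds_inList (hΓ : IsInstance Γ G L) {e : Expr} (v : Fin n) (c : Fin k)
    (he : e.eval Γ σ = v) : (Expr.inList k c e).Holds Γ σ ↔ c ∈ L v := by
  have hlt : n * n + (k * (v : ℕ) + c) < Γ.param 1 := by
    rw [hΓ.length]
    have : k * (v : ℕ) + c < n * k := by
      calc k * (v : ℕ) + c < k * v + k := by omega
        _ = (v + 1) * k := by ring
        _ ≤ n * k := Nat.mul_le_mul_right _ v.2
    omega
  simp only [Expr.Holds, Expr.inList, Expr.eval, Expr.eval_smul, he, hΓ.lists, if_pos hlt, hΓ.inp]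
  rw [mul_comm k]
  exact input_list v c

theorem holds_ex_vertex (hn : Γ.param 0 = n) (v : ℕ) (e : Expr) :
    (Expr.ex 0 v e).Holds Γ σ ↔ ∃ u : Fin n, e.Holds Γ (σ.set v u) := by
  rw [Expr.holds_ex, hn]
  exact ⟨fun ⟨i, hi, h⟩ => ⟨⟨i, hi⟩, h⟩, fun ⟨u, h⟩ => ⟨u, u.2, h⟩⟩

theorem holds_all_vertex (hn : Γ.param 0 = n) (v : ℕ) (e : Expr) :
    (Expr.all 0 v e).Holds Γ σ ↔ ∀ u : Fin n, e.Holds Γ (σ.set v u) := by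
  rw [Expr.holds_all, hn]
  exact ⟨fun h u => h u u.2, fun h i hi => h ⟨i, hi⟩⟩

theorem Expr.holds_any_map {α : Type*} (f : α → Expr) (l : List α) :
    (any (l.map f)).Holds Γ σ ↔ ∃ a ∈ l, (f a).Holds Γ σ := by
  simp [holds_any]

theorem Expr.holds_any_finRange (f : Fin k → Expr) :
    (any ((List.finRange k).map f)).Holds Γ σ ↔ ∃ a, (f a).Holds Γ σ := by
  simp

theorem Cmd.eval_ite_pos {e : Expr} {c d : Cmd} (h : e.Holds Γ σ) :
    (Cmd.ite e c d).eval Γ σ = c.eval Γ σ := if_pos h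

theorem Cmd.eval_ite_neg {e : Expr} {c d : Cmd} (h : ¬ e.Holds Γ σ) :
    (Cmd.ite e c d).eval Γ σ = d.eval Γ σ := if_neg h

/-- The arrays for the current lists, one array for each colour. -/
def lst (c : ℕ) : ℕ := 4 + 3 * c
/-- The arrays for the next round of lists. -/
def tmp (c : ℕ) : ℕ := 5 + 3 * c
/-- The arrays for a copy of the lists. -/
def sav (c : ℕ) : ℕ := 6 + 3 * c

theorem lst_injective : Function.Injective fun c : Fin k => lst c :=
  fun a b h => Fin.ext (by simp only [lst] at h; omega)

theorem tmp_injective : Function.Injective fun c : Fin k => tmp c :=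
  fun a b h => Fin.ext (by simp only [tmp] at h; omega)

theorem sav_injective : Function.Injective fun c : Fin k => sav c :=
  fun a b h => Fin.ext (by simp only [sav] at h; omega)

/-- The lists `X` are stored in the arrays `a`. -/
def Stores (σ : Store) (a : ℕ → ℕ) (X : Fin n → Finset (Fin k)) : Prop :=
  ∀ (v : Fin n) (c : Fin k), σ.arr (a c) v ≠ 0 ↔ c ∈ X v

theorem Stores.congr {σ τ : Store} {a : ℕ → ℕ} {X : Fin n → Finset (Fin k)}
    (h : Stores σ a X) (hτ : ∀ c : Fin k, τ.arr (a c) = σ.arr (a c)) : Stores τ a X := by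
  intro v c
  rw [hτ c]
  exact h v c

theorem stores_maps (hn : Γ.param 0 = n) {a : ℕ → ℕ}
    (ha : Function.Injective fun c : Fin k => a c) {v : ℕ} {e : Fin k → Expr}
    (he : ∀ c c' : Fin k, (e c).NoArr (a c')) {X : Fin n → Finset (Fin k)}
    (h : ∀ (u : Fin n) (c : Fin k), (e c).Holds Γ (σ.set v u) ↔ c ∈ X u) :
    Stores ((Cmd.maps (fun c : Fin k => a c) v e).eval Γ σ) a X := by
  intro u c
  rw [Cmd.eval_maps ha he σ c (by rw [hn]; exact u.2)]
  exact h u c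

/-- Copy lists. -/
def copy (k : ℕ) (a b : ℕ → ℕ) : Cmd :=
  .maps (fun c : Fin k => a c) 10 fun c => .arr (b c) (.var 10)

theorem copy_spec (hn : Γ.param 0 = n) {a b : ℕ → ℕ}
    (ha : Function.Injective fun c : Fin k => a c) (hab : ∀ c c' : Fin k, b c ≠ a c')
    {X : Fin n → Finset (Fin k)} (h : Stores σ b X) : Stores ((copy k a b).eval Γ σ) a X := by
  refine stores_maps (e := fun c => .arr (b c) (.var 10)) hn ha
    (fun c c' => ⟨hab c c', trivial⟩) fun u c => ?_
  simpa [Expr.holds_arr, Expr.eval] using h u c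

open Classical in
/-- The neighbours of a colour. -/
noncomputable def nbrs (H : LoopGraph (Fin k)) (c : Fin k) : List (Fin k) :=
  (List.finRange k).filter fun b => H.Adj c b

theorem mem_nbrs {H : LoopGraph (Fin k)} {c b : Fin k} : b ∈ nbrs H c ↔ H.Adj c b := by
  classical
  simp [nbrs]

variable (H : LoopGraph (Fin k))

/-- One round of arc consistency. -/
noncomputable def passCmd : Cmd :=
  .seq (.maps (fun c : Fin k => tmp c) 10 fun c => .and (.arr (lst c) (.var 10))
    (.all 0 11 (.imp (.adj (.var 10) (.var 11))
      (.any ((nbrs H c).map fun b : Fin k => .arr (lst b) (.var 11))))))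
  (copy k lst tmp)

/-- Arc consistency. -/
noncomputable def propagateCmd : Cmd := .forTo 1 13 (passCmd H)

theorem noArr_any {a : ℕ} {l : List Expr} (h : ∀ e ∈ l, e.NoArr a) : (Expr.any l).NoArr a := by
  induction l with
  | nil => trivial
  | cons e l ih =>
    exact ⟨h e (by simp), ih fun e he => h e (by simp [he])⟩

theorem passCmd_spec (hΓ : IsInstance Γ G L) (hσ : HasRows n σ)
    {X : Fin n → Finset (Fin k)} (h : Stores σ lst X) :
    Stores ((passCmd H).eval Γ σ) lst (pass G H X) := by
  refine copy_spec hΓ.vertices lst_injective (fun c c' => by simp only [tmp, lst]; omega) ?_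
  refine stores_maps hΓ.vertices tmp_injective (fun c c' => ?_) fun u c => ?_
  · simp only [Expr.and, Expr.all, Expr.not, Expr.ex, Expr.imp, Expr.adj, Expr.NoArr, and_true]
    refine ⟨by simp only [tmp, lst]; omega, by simp only [tmp]; omega, noArr_any ?_⟩
    intro e he
    obtain ⟨b, -, rfl⟩ := List.mem_map.1 he
    exact ⟨by simp only [tmp, lst]; omega, trivial⟩
  · rw [Expr.holds_and, holds_all_vertex hΓ.vertices, mem_pass, ← h u c]
    refine and_congr (by simp [Expr.holds_arr, Expr.eval]) (forall_congr' fun v => ?_)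
    rw [Expr.holds_imp, holds_adj hΓ (u := u) (v := v) (by exact hσ) (by simp [Expr.eval])
      (by simp [Expr.eval])]
    refine imp_congr_right fun _ => ?_
    simp only [Expr.holds_any, List.mem_map, exists_exists_and_eq_and, mem_nbrs, Expr.holds_arr,
      Expr.eval, Store.set_var, if_true, Store.set_arr]
    exact exists_congr fun b => by rw [h v b, and_comm]

theorem propagateCmd_keepsArr {a : ℕ} (ha : ∀ c : Fin k, lst c ≠ a ∧ tmp c ≠ a) :
    (propagateCmd H).KeepsArr a := by
  simp only [propagateCmd, passCmd, copy, Cmd.KeepsArr, Cmd.keepsArr_maps]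
  exact ⟨fun c => (ha c).2, fun c => (ha c).1⟩

theorem propagateCmd_keepsVar {w : ℕ} (hw : w ∉ [10, 13, 90]) :
    (propagateCmd H).KeepsVar w := by
  simp only [List.mem_cons, List.not_mem_nil, or_false, not_or] at hw
  simp [propagateCmd, passCmd, copy, Cmd.KeepsVar, Ne.symm hw.1, Ne.symm hw.2.1, Ne.symm hw.2.2]

theorem propagateCmd_spec (hΓ : IsInstance Γ G L) (hσ : HasRows n σ)
    {X : Fin n → Finset (Fin k)} (h : Stores σ lst X) :
    Stores ((propagateCmd H).eval Γ σ) lst (propagate G H (n * n + n * k) X) := by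
  rw [propagateCmd, Cmd.eval, ← hΓ.length]
  refine (iter_induction (fun i τ => HasRows n τ ∧ Stores τ lst (propagate G H i X)) ⟨hσ, h⟩
    fun i _ τ hτ => ⟨?_, ?_⟩).2
  · intro u hu
    rw [Cmd.eval_arr _ _ _]
    · exact hτ.1 u hu
    · simp only [passCmd, copy, Cmd.KeepsArr, Cmd.keepsArr_maps, tmp, lst]
      exact ⟨fun c => by omega, fun c => by omega⟩
  · rw [propagate, Function.iterate_succ_apply']
    exact passCmd_spec (σ := τ.set 13 i) H hΓ hτ.1 hτ.2

/-- Try the colour `c` for the vertex in variable `12`. -/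
noncomputable def trialCmd (c : Fin k) : Cmd :=
  .ite (.arr (lst c) (.var 12))
    (.seq (copy k sav lst) (.seq
      (.maps (fun d : Fin k => lst d) 10 fun d => .and (.arr (sav d) (.var 10))
        (.or (.not (.eq (.var 10) (.var 12))) (.const (if d = c then 1 else 0))))
      (.seq (propagateCmd H)
        (.ite (.all 0 10 (.any ((List.finRange k).map fun d : Fin k => .arr (lst d) (.var 10))))
          .skip (copy k lst sav)))))
    .skip

theorem trialCmd_keepsArr (c : Fin k) {a : ℕ} (ha : a < 4) : (trialCmd H c).KeepsArr a := by
  simp only [trialCmd, Cmd.skip, copy, Cmd.KeepsArr, Cmd.keepsArr_maps, and_true]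
  refine ⟨fun c => by simp only [sav]; omega, fun c => by simp only [lst]; omega,
    propagateCmd_keepsArr H fun c => by simp only [lst, tmp]; omega,
    ⟨trivial, fun c => by simp only [lst]; omega⟩⟩

theorem trialCmd_keepsVar (c : Fin k) {w : ℕ} (hw : w ∉ [10, 13, 90]) :
    (trialCmd H c).KeepsVar w := by
  have h := propagateCmd_keepsVar H hw
  simp only [List.mem_cons, List.not_mem_nil, or_false, not_or] at hw
  simp [trialCmd, Cmd.skip, copy, Cmd.KeepsVar, h, Ne.symm hw.1, Ne.symm hw.2.2]

theorem trialCmd_spec (hΓ : IsInstance Γ G L) (hσ : HasRows n σ)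
    {X : Fin n → Finset (Fin k)} (h : Stores σ lst X) (v : Fin n) (hv : σ.var 12 = v)
    (c : Fin k) : Stores ((trialCmd H c).eval Γ σ) lst (trial G H (n * n + n * k) X v c) := by
  classical
  have hmem : (Expr.arr (lst c) (.var 12)).Holds Γ σ ↔ c ∈ X v := by
    simpa [Expr.holds_arr, Expr.eval, hv] using h v c
  rw [trialCmd, trial]
  by_cases hc : c ∈ X v
  · rw [Cmd.eval_ite_pos (hmem.2 hc)]
    simp only [hc, true_and]
    rw [Cmd.eval, Cmd.eval, Cmd.eval]
    set σ₁ := (copy k sav lst).eval Γ σ with hσ₁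
    have h₁ : Stores σ₁ sav X := copy_spec hΓ.vertices sav_injective
      (fun c c' => by simp only [lst, sav]; omega) h
    have hv₁ : σ₁.var 12 = v := by
      rw [hσ₁, Cmd.eval_var _ (by simp [copy]), hv]
    have hr₁ : HasRows n σ₁ := by
      intro u hu
      rw [hσ₁, Cmd.eval_arr _ (by simp [copy, sav]), hσ u hu]
    set σ₂ := (Cmd.maps (fun d : Fin k => lst d) 10 fun d => .and (.arr (sav d) (.var 10))
        (.or (.not (.eq (.var 10) (.var 12))) (.const (if d = c then 1 else 0)))).eval Γ σ₁
      with hσ₂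
    have h₂ : Stores σ₂ lst (Function.update X v {c}) := by
      refine stores_maps hΓ.vertices lst_injective (fun d d' => ?_) fun u d => ?_
      · simp only [Expr.and, Expr.or, Expr.not, Expr.eq, Expr.NoArr, and_true]
        simp only [lst, sav]; omega
      · simp only [Expr.holds_and, Expr.holds_or, Expr.holds_not, Expr.holds_eq, Expr.holds_arr,
          Expr.eval, Store.set_var, Store.set_arr, Expr.holds_const]
        have h₁' : ¬ σ₁.arr (sav d) u = 0 ↔ d ∈ X u := h₁ u d
        by_cases huv : u = v
        · subst huv
          by_cases hd : d = c
          · subst hd; simp [hc, h₁']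
          · simp [hd, hv₁]
        · have : (u : ℕ) ≠ v := fun hh => huv (Fin.ext hh)
          simp [huv, hv₁, this, h₁']
    have hs₂ : Stores σ₂ sav X := h₁.congr fun d => by
      rw [hσ₂, Cmd.eval_arr _ (by
        simp only [Cmd.keepsArr_maps]; intro d; simp only [sav, lst]; omega)]
    have hr₂ : HasRows n σ₂ := by
      intro u hu
      rw [hσ₂, Cmd.eval_arr _ (by simp [lst]), hr₁ u hu]
    set σ₃ := (propagateCmd H).eval Γ σ₂ with hσ₃
    have h₃ := propagateCmd_spec H hΓ hr₂ h₂
    have hs₃ : Stores σ₃ sav X := hs₂.congr fun d => by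
      rw [hσ₃, Cmd.eval_arr _ (propagateCmd_keepsArr H fun c => by
        simp only [lst, sav, tmp]; omega)]
    have hne : (Expr.all 0 10
        (.any ((List.finRange k).map fun d : Fin k => .arr (lst d) (.var 10)))).Holds Γ σ₃ ↔
          ∀ u, (propagate G H (n * n + n * k) (Function.update X v {c}) u).Nonempty := by
      rw [holds_all_vertex hΓ.vertices]
      refine forall_congr' fun u => ?_
      rw [Expr.holds_any_finRange]
      refine exists_congr fun d => ?_
      rw [← h₃ u d, Expr.holds_arr, Expr.eval, Store.set_var, if_pos rfl, Store.set_arr]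
    by_cases hall : ∀ u, (propagate G H (n * n + n * k) (Function.update X v {c}) u).Nonempty
    · rw [Cmd.eval_ite_pos (hne.2 hall), if_pos hall]
      exact h₃
    · rw [Cmd.eval_ite_neg (mt hne.1 hall), if_neg hall]
      exact copy_spec hΓ.vertices lst_injective (fun c c' => by simp only [lst, sav]; omega) hs₃
  · rw [Cmd.eval_ite_neg (mt hmem.1 hc), if_neg fun hh => hc hh.1]
    exact h

/-- The greedy procedure for lists of size two. -/
noncomputable def solveCmd : Cmd := .forTo 0 12 (.seqs ((List.finRange k).map (trialCmd H)))

theorem trialsCmd_spec (hΓ : IsInstance Γ G L) (l : List (Fin k)) {σ : Store} (hσ : HasRows n σ)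
    {X : Fin n → Finset (Fin k)} (h : Stores σ lst X) (v : Fin n) (hv : σ.var 12 = v) :
    Stores ((Cmd.seqs (l.map (trialCmd H))).eval Γ σ) lst
      (trials G H (n * n + n * k) v l X) := by
  induction l generalizing σ X with
  | nil => exact h
  | cons c l ih =>
    rw [List.map_cons, Cmd.seqs, Cmd.eval]
    refine ih (fun u hu => ?_) (trialCmd_spec H hΓ hσ h v hv c) ?_
    · rw [Cmd.eval_arr _ (trialCmd_keepsArr H c (by omega)), hσ u hu]
    · rw [Cmd.eval_var _ (trialCmd_keepsVar H c (by simp)), hv]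

theorem solveCmd_spec (hΓ : IsInstance Γ G L) (hσ : HasRows n σ)
    {X : Fin n → Finset (Fin k)} (h : Stores σ lst X) :
    Stores ((solveCmd H).eval Γ σ) lst (solve G H (n * n + n * k) X n) := by
  rw [solveCmd, Cmd.eval, hΓ.vertices]
  refine (iter_induction (fun i τ => HasRows n τ ∧
    Stores τ lst (solve G H (n * n + n * k) X i)) ⟨hσ, h⟩ fun i hi τ hτ => ⟨fun u hu => ?_, ?_⟩).2
  · rw [Cmd.eval_arr, Store.set_arr, hτ.1 u hu]
    rw [Cmd.keepsArr_seqs]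
    intro c hc
    obtain ⟨d, -, rfl⟩ := List.mem_map.1 hc
    exact trialCmd_keepsArr H d (by omega)
  · rw [solve, dif_pos hi]
    exact trialsCmd_spec (σ := τ.set 12 i) H hΓ _ hτ.1 hτ.2 ⟨i, hi⟩ (by simp)

/-- The lists are singletons and give a list homomorphism. -/
noncomputable def solvedExpr : Expr :=
  .and (.all 0 10 (.any ((List.finRange k).map fun c : Fin k => .and (.inList k c (.var 10))
      (.not (.any ((List.finRange k).map fun d : Fin k => .cond (.arr (lst d) (.var 10))
        (.const (if d = c then 0 else 1)) (.const (if d = c then 1 else 0))))))))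
    (.all 0 10 (.all 0 11 (.imp (.adj (.var 10) (.var 11))
      (.any ((List.finRange k).map fun c : Fin k => .and (.arr (lst c) (.var 10))
        (.any ((nbrs H c).map fun d : Fin k => .arr (lst d) (.var 11))))))))

theorem holds_solvedExpr (hΓ : IsInstance Γ G L) (hσ : HasRows n σ)
    {X : Fin n → Finset (Fin k)} (h : Stores σ lst X) :
    (solvedExpr H).Holds Γ σ ↔ Solved G H L X := by
  classical
  rw [solvedExpr, Expr.holds_and, holds_all_vertex hΓ.vertices, holds_all_vertex hΓ.vertices,
    Solved]
  refine and_congr (forall_congr' fun v => ?_) (forall_congr' fun u => ?_)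
  · rw [Expr.holds_any_finRange]
    refine exists_congr fun c => ?_
    rw [Expr.holds_and, holds_inList hΓ v c (by simp [Expr.eval]), Expr.holds_not,
      Expr.holds_any_finRange, not_exists]
    refine and_congr_right fun _ => forall_congr' fun d => ?_
    rw [← h v d]
    have : (Expr.arr (lst d) (.var 10)).Holds Γ (σ.set 10 v) ↔ σ.arr (lst d) v ≠ 0 := by
      simp [Expr.holds_arr, Expr.eval]
    rw [Expr.Holds, Expr.eval_cond]
    simp only [this]
    by_cases h1 : σ.arr (lst d) v = 0 <;> by_cases h2 : d = c <;> simp [h1, h2, Expr.eval]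
  · rw [holds_all_vertex hΓ.vertices]
    refine forall_congr' fun v => ?_
    rw [Expr.holds_imp, holds_adj hΓ (u := u) (v := v) (by exact hσ) (by simp [Expr.eval])
      (by simp [Expr.eval]), Expr.holds_any_finRange]
    refine imp_congr_right fun _ => exists_congr fun c => ?_
    rw [Expr.holds_and, Expr.holds_any_map, ← h u c]
    refine and_congr (by simp [Expr.holds_arr, Expr.eval]) (exists_congr fun d => ?_)
    rw [← h v d, mem_nbrs, and_comm]
    refine and_congr (by simp [Expr.holds_arr, Expr.eval]) Iff.rfl

/-- Complete the partial colouring in array `1`, and set variable `0` to `1` if that succeeds. -/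
noncomputable def completeCmd : Cmd :=
  .seq (.maps (fun c : Fin k => lst c) 10 fun c => .and (.inList k c (.var 10))
    (.or (.eq (.arr 1 (.var 10)) (.const c)) (.not (.lt (.arr 1 (.var 10)) (.const k)))))
  (.seq (propagateCmd H) (.seq (solveCmd H) (.ite (solvedExpr H) (.assign 0 (.const 1)) .skip)))

theorem completeCmd_keepsArr {a : ℕ} (ha : a < 4) : (completeCmd H).KeepsArr a := by
  simp only [completeCmd, solveCmd, Cmd.KeepsArr, Cmd.keepsArr_maps, Cmd.keepsArr_seqs, Cmd.skip,
    and_true]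
  refine ⟨fun c => by simp only [lst]; omega,
    propagateCmd_keepsArr H fun c => by simp only [lst, tmp]; omega, fun c hc => ?_⟩
  obtain ⟨d, -, rfl⟩ := List.mem_map.1 hc
  exact trialCmd_keepsArr H d ha

open Classical in
theorem completeCmd_spec (hΓ : IsInstance Γ G L) (hσ : HasRows n σ) :
    ((completeCmd H).eval Γ σ).var 0 =
      if Solved G H L (solve G H (n * n + n * k) (propagate G H (n * n + n * k)
        (restrict L fun v => σ.arr 1 v)) n) then 1 else σ.var 0 := by
  rw [completeCmd, Cmd.eval, Cmd.eval, Cmd.eval]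
  set σ₁ := (Cmd.maps (fun c : Fin k => lst c) 10 fun c => .and (.inList k c (.var 10))
    (.or (.eq (.arr 1 (.var 10)) (.const c))
      (.not (.lt (.arr 1 (.var 10)) (.const k))))).eval Γ σ with hσ₁
  have h₁ : Stores σ₁ lst (restrict L fun v => σ.arr 1 v) := by
    refine stores_maps hΓ.vertices lst_injective (fun d d' => ?_) fun u d => ?_
    · simp only [Expr.and, Expr.or, Expr.not, Expr.eq, Expr.lt, Expr.inList, Expr.NoArr, and_true]
      have h1 : 1 ≠ lst d' := by simp only [lst]; omega
      refine ⟨?_, ⟨h1, trivial, h1⟩, trivial, h1⟩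
      have : ∀ c, (Expr.smul (.var 10) c).NoArr (lst d') := by
        intro c
        induction c with
        | zero => trivial
        | succ c ih => exact ⟨ih, trivial⟩
      simpa using this k
    · rw [Expr.holds_and, holds_inList hΓ u d (by simp [Expr.eval])]
      simp [restrict, Expr.eval]
  have hr₁ : HasRows n σ₁ := by
    intro u hu
    rw [hσ₁, Cmd.eval_arr _ (by simp [lst]), hσ u hu]
  have h₂ := propagateCmd_spec H hΓ hr₁ h₁
  set σ₂ := (propagateCmd H).eval Γ σ₁ with hσ₂
  have hr₂ : HasRows n σ₂ := by
    intro u hu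
    rw [hσ₂, Cmd.eval_arr _ (propagateCmd_keepsArr H fun c => by simp [lst, tmp]), hr₁ u hu]
  have h₃ := solveCmd_spec H hΓ hr₂ h₂
  set σ₃ := (solveCmd H).eval Γ σ₂ with hσ₃
  have hk : ∀ w, w ∉ [10, 13, 90] → w ≠ 12 → (solveCmd H).KeepsVar w := by
    intro w hw h12
    simp only [solveCmd, Cmd.KeepsVar, Cmd.keepsVar_seqs]
    have h90 : 90 ≠ w := by rintro rfl; simp at hw
    refine ⟨Ne.symm h12, h90, fun c hc => ?_⟩
    obtain ⟨d, -, rfl⟩ := List.mem_map.1 hc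
    exact trialCmd_keepsVar H d hw
  have hr₃ : HasRows n σ₃ := by
    intro u hu
    rw [hσ₃, Cmd.eval_arr, hr₂ u hu]
    simp only [solveCmd, Cmd.KeepsArr, Cmd.keepsArr_seqs]
    intro c hc
    obtain ⟨d, -, rfl⟩ := List.mem_map.1 hc
    exact trialCmd_keepsArr H d (by omega)
  have hv : σ₃.var 0 = σ.var 0 := by
    rw [hσ₃, Cmd.eval_var _ (hk 0 (by simp) (by simp)), hσ₂,
      Cmd.eval_var _ (propagateCmd_keepsVar H (by simp)), hσ₁, Cmd.eval_var _ (by simp)]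
  have hs := holds_solvedExpr H hΓ hr₃ h₃
  split_ifs with hc
  · rw [Cmd.eval_ite_pos (hs.2 hc)]
    simp [Cmd.eval, Expr.eval]
  · rw [Cmd.eval_ite_neg (mt hs.1 hc)]
    simp [Cmd.skip, Cmd.eval, hv]

end RAM

namespace RAM

open LoopGraph ListColoring

/-! ### Programs that compute their loop bounds -/

/-- The environment in which the parameter `p` has got the value `x`. -/
def Env.setParam (Γ : Env) (p x : ℕ) : Env := { Γ with param := Function.update Γ.param p x }

theorem Env.setParam_param (Γ : Env) (p x q : ℕ) :
    (Γ.setParam p x).param q = if q = p then x else Γ.param q := by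
  simp [Env.setParam, Function.update_apply]

/-- A stage runs a command and then sets a parameter to the value of an expression. -/
structure Stage where
  cmd : Cmd
  val : Expr
  idx : ℕ

/-- The effect of a stage. -/
def Stage.run (S : Stage) (x : Env × Store) : Env × Store :=
  (x.1.setParam S.idx (S.val.eval x.1 (S.cmd.eval x.1 x.2)), S.cmd.eval x.1 x.2)

/-- The effect of several stages. -/
def runStages : List Stage → Env × Store → Env × Store
  | [], x => x
  | S :: l, x => runStages l (S.run x)

/-- `N` bounds all parameters at the beginning of each stage. -/
def ParamsLE (N : ℕ) : List Stage → Env × Store → Prop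
  | [], _ => True
  | S :: l, x => (∀ p, x.1.param p ≤ N) ∧ ParamsLE N l (S.run x)

/-- All arrays that occur have a number below `A`, and parameter `1` is not changed. -/
def Stage.Ok (A : ℕ) (S : Stage) : Prop := S.cmd.Ok A ∧ S.val.Ok A ∧ S.idx ≠ 1

/-- Code that moves the temporary register `0` to a parameter. -/
def toParam (p : ℕ) : Program := block (.const (3 * p) 0) [.add (3 * p) (3 * p) 2]

/-- The code of a stage. -/
def Stage.compile (A : ℕ) (S : Stage) : Program :=
  .seq (S.cmd.compile A 0) (.seq (S.val.compile A 0) (toParam S.idx))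

theorem toParam_spec {p : ℕ} {s : State} {Q : State → Prop}
    (h : Q { s with reg := Function.update s.reg (3 * p) (s.reg 2) }) : Tr (toParam p) s 2 Q := by
  refine Tr.block (l := [_]) ?_
  have h2 : 2 ≠ 3 * p := by omega
  simpa only [execs, Instr.exec_const, Instr.exec_add, Function.update_self,
    Function.update_of_ne h2, Function.update_idem, Nat.zero_add] using h

theorem Stage.compile_spec {A : ℕ} {S : Stage} (hS : S.Ok A) {Γ : Env} {σ : Store} {s : State}
    (h : Rel A Γ σ s) : Tr (S.compile A) s (S.cmd.cost A Γ + (S.val.cost A Γ + 2))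
      (fun s' => Rel A (S.run (Γ, σ)).1 (S.run (Γ, σ)).2 s') := by
  obtain ⟨hc, he, hp⟩ := hS
  refine Tr.seq ((S.cmd.compile_spec hc 0 σ s h).mono le_rfl fun s₁ h₁ => Tr.seq ?_)
  refine (S.val.compile_spec he 0 _ s₁ h₁.1).mono le_rfl fun s₂ h₂ => toParam_spec ?_
  have hr := h₂.2.rel h₁.1
  have h1 : (Γ.setParam S.idx (S.val.eval Γ (S.cmd.eval Γ σ))).param 1 = Γ.param 1 := by
    rw [Env.setParam_param, if_neg hp.symm]
  refine ⟨fun q => ?_, fun v => ?_, fun x hx => ?_, fun a i ha => ?_⟩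
  · simp only [Stage.run, Env.setParam_param]
    by_cases hq : q = S.idx
    · subst hq
      simpa using h₂.1
    · rw [Function.update_of_ne (by omega), if_neg hq, hr.param]
  · simp only [Stage.run]
    rw [Function.update_of_ne (by omega), hr.var]
  · exact hr.inp x (by simpa only [Stage.run, h1] using hx)
  · simp only [Stage.run, h1]
    exact hr.arr a i ha

/-- The code of several stages. -/
def compileStages (A : ℕ) : List Stage → Program
  | [] => .instr (.const 2 0)
  | S :: l => .seq (S.compile A) (compileStages A l)

theorem compileStages_spec {A : ℕ} {l : List Stage} (hl : ∀ S ∈ l, S.Ok A) :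
    ∃ C d : ℕ, ∀ (x : Env × Store) (s : State) (N : ℕ), 1 ≤ N → ParamsLE N l x →
      Rel A x.1 x.2 s → Tr (compileStages A l) s (C * N ^ d)
        (fun s' => Rel A (runStages l x).1 (runStages l x).2 s') := by
  induction l with
  | nil =>
    refine ⟨1, 0, fun x s N hN _ h => (Tr.instr ?_).mono (by simp) fun _ h => h⟩
    exact (((Frame.refl 0 s).set (i := 0) le_rfl)).rel h
  | cons S l ih =>
    obtain ⟨C₀, d₀, h₀⟩ := ih fun S' h => hl S' (List.mem_cons_of_mem S h)
    have hS := hl S List.mem_cons_self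
    obtain ⟨C₁, d₁, h₁⟩ := S.cmd.exists_cost_le A
    obtain ⟨C₂, d₂, h₂⟩ := S.val.exists_cost_le A
    refine ⟨C₁ + (C₂ + 2) + C₀, d₀ + d₁ + d₂, fun x s N hN hx h => ?_⟩
    have up : ∀ {d d' : ℕ} (C : ℕ), d ≤ d' → C * N ^ d ≤ C * N ^ d' := fun C hd =>
      Nat.mul_le_mul_left _ (Nat.pow_le_pow_right hN hd)
    have one : 1 ≤ N ^ (d₀ + d₁ + d₂) := Nat.one_le_pow _ _ hN
    have g₁ := (h₁ x.1 N hN hx.1).trans (up C₁ (show d₁ ≤ d₀ + d₁ + d₂ by omega))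
    have g₂ := (h₂ x.1 N hN hx.1).trans (up C₂ (show d₂ ≤ d₀ + d₁ + d₂ by omega))
    have g₀ := up C₀ (show d₀ ≤ d₀ + d₁ + d₂ by omega)
    refine (Tr.seq (T' := C₀ * N ^ d₀) ((S.compile_spec hS h).mono le_rfl fun s₁ h₁ =>
      h₀ (S.run x) s₁ N hN hx.2 h₁)).mono ?_ fun _ h => h
    rw [add_mul, add_mul, add_mul]
    omega

/-- The environment of the instance `(G, L)` before any other parameter has been set. -/
noncomputable def startEnv {n k : ℕ} (G : SimpleGraph (Fin n)) (L : Fin n → Finset (Fin k)) :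
    Env where
  param p := if p = 0 then n else if p = 1 then n * n + n * k else 0
  inp := (input G L).mem

/-- Stages yield a machine program, whose running time is polynomial in any bound for the
parameters. -/
theorem exists_program (k A : ℕ) {l : List Stage} (hl : ∀ S ∈ l, S.Ok A) :
    ∃ (P : Program) (C d : ℕ), ∀ (n : ℕ) (G : SimpleGraph (Fin n)) (L : Fin n → Finset (Fin k))
      (N : ℕ), 1 ≤ N → n ≤ N → (∀ σ, ParamsLE N l (startEnv G L, σ)) →
        ∃ σ s t, Runs P (input G L) s t ∧ t ≤ C * N ^ d ∧
          s.reg 0 = (runStages l (startEnv G L, σ)).1.param 0 := by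
  obtain ⟨C, d, h⟩ := compileStages_spec hl
  let e : Expr := .add (.sum 0 0 (.param 0)) (.smul (.param 0) k)
  have he : e.Ok 0 := by
    refine ⟨trivial, ?_⟩
    induction k with
    | zero => trivial
    | succ k ih => exact ⟨ih, trivial⟩
  obtain ⟨C', d', h'⟩ := e.exists_cost_le 0
  refine ⟨.seq (.seq (e.compile 0 0) (toParam 1)) (compileStages A l), C' + 2 + C, d' + d,
    fun n G L N hN hn hP => ?_⟩
  -- before the length of the input is known, the input is not yet part of the environment
  let Γ₀ : Env := ⟨fun p => if p = 0 then n else 0, (input G L).mem⟩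
  have hrel : Rel 0 Γ₀ ⟨fun _ => 0, fun _ _ => 0⟩ (input G L) := by
    refine ⟨fun p => ?_, fun v => ?_, fun x hx => ?_, fun a i ha => ?_⟩
    · simp [input, Γ₀]
    · simp [input]
    · simp [Γ₀] at hx
    · omega
  have hcost : e.cost 0 Γ₀ ≤ C' * N ^ d' := h' Γ₀ N hN fun p => by
    simp only [Γ₀]; split_ifs <;> omega
  have htr : Tr (.seq (e.compile 0 0) (toParam 1)) (input G L) (e.cost 0 Γ₀ + 2)
      (fun s => ∃ σ, Rel A (startEnv G L) σ s) := by
    refine Tr.seq ((e.compile_spec he 0 _ _ hrel).mono le_rfl fun s₁ h₁ => toParam_spec ?_)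
    have hr := h₁.2.rel hrel
    have hlen : s₁.reg 2 = n * n + n * k := by
      have h2 := h₁.1
      rw [Nat.mul_zero, Nat.zero_add] at h2
      rw [h2]
      simp [e, Γ₀, Expr.eval, mul_comm]
    refine ⟨⟨fun v => s₁.reg (3 * v + 1), fun a i =>
      s₁.mem ((startEnv G L).param 1 + A * i + a)⟩, fun p => ?_, fun v => ?_, fun x _ => ?_,
      fun _ _ _ => rfl⟩
    · by_cases hp : p = 1
      · subst hp
        simpa [startEnv] using hlen
      · simp only
        rw [Function.update_of_ne (by omega), hr.param]
        simp [Γ₀, startEnv, hp]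
    · simp only
      rw [Function.update_of_ne (by omega)]
    · rw [startEnv, ← h₁.2.1]
  obtain ⟨s₁, t₁, hr₁, ht₁, σ, hσ⟩ := htr
  obtain ⟨s₂, t₂, hr₂, ht₂, hs₂⟩ := h (startEnv G L, σ) s₁ N hN (hP σ) hσ
  refine ⟨σ, s₂, _, .seq hr₁ hr₂, ?_, by simpa using hs₂.param 0⟩
  have one : 1 ≤ N ^ (d' + d) := Nat.one_le_pow _ _ hN
  have g₁ : C' * N ^ d' ≤ C' * N ^ (d' + d) :=
    Nat.mul_le_mul_left _ (Nat.pow_le_pow_right hN (by omega))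
  have g₂ : C * N ^ d ≤ C * N ^ (d' + d) :=
    Nat.mul_le_mul_left _ (Nat.pow_le_pow_right hN (by omega))
  rw [add_mul, add_mul]
  omega

/-! ### Exhaustive search -/

theorem Expr.ok_any {A : ℕ} {l : List Expr} (h : ∀ e ∈ l, e.Ok A) : (Expr.any l).Ok A := by
  induction l with
  | nil => trivial
  | cons e l ih => exact ⟨h e (by simp), ih fun e he => h e (by simp [he])⟩

theorem Expr.ok_any_map {A : ℕ} {α : Type*} {f : α → Expr} {l : List α}
    (h : ∀ a, (f a).Ok A) : (Expr.any (l.map f)).Ok A :=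
  ok_any fun _ he => by obtain ⟨a, -, rfl⟩ := List.mem_map.1 he; exact h a

theorem Expr.ok_smul {A : ℕ} {e : Expr} (h : e.Ok A) (c : ℕ) : (Expr.smul e c).Ok A := by
  induction c with
  | zero => trivial
  | succ c ih => exact ⟨ih, h⟩

theorem completeCmd_ok {k : ℕ} (H : LoopGraph (Fin k)) : (completeCmd H).Ok (7 + 3 * k) := by
  have hl : ∀ c : Fin k, lst c < 7 + 3 * k := fun c => by simp only [lst]; omega
  have ht : ∀ c : Fin k, tmp c < 7 + 3 * k := fun c => by simp only [tmp]; omega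
  have hs : ∀ c : Fin k, sav c < 7 + 3 * k := fun c => by simp only [sav]; omega
  have h0 : 0 < 7 + 3 * k := by omega
  have h1 : 1 < 7 + 3 * k := by omega
  have hsm : (Expr.smul (.var 10) k).Ok (7 + 3 * k) := Expr.ok_smul (e := .var 10) trivial k
  have hp : (propagateCmd H).Ok (7 + 3 * k) := by
    simp only [propagateCmd, passCmd, copy, Cmd.Ok, Cmd.ok_maps, Expr.and, Expr.all, Expr.ex,
      Expr.not, Expr.imp, Expr.adj, Expr.Ok, and_true, hl, ht, h0, true_and]
    exact ⟨fun c => Expr.ok_any_map fun d => ⟨hl d, trivial⟩, fun _ => trivial⟩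
  simp only [completeCmd, solveCmd, solvedExpr, Cmd.skip, Cmd.Ok, Cmd.ok_maps, Cmd.ok_seqs,
    Expr.and, Expr.or, Expr.eq, Expr.lt, Expr.all, Expr.ex, Expr.not, Expr.imp, Expr.adj,
    Expr.inList, Expr.Ok, and_true, hl, hp, h0, h1, hsm, true_and, implies_true]
  refine ⟨fun c hc => ?_, ?_, ?_⟩
  · obtain ⟨d, -, rfl⟩ := List.mem_map.1 hc
    simp only [trialCmd, copy, Cmd.skip, Cmd.Ok, Cmd.ok_maps, Expr.and, Expr.or, Expr.eq,
      Expr.all, Expr.ex, Expr.not, Expr.Ok, and_true, hl, hp, hs, true_and, implies_true]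
    exact Expr.ok_any_map fun d => ⟨hl d, trivial⟩
  · refine Expr.ok_any_map fun c => ?_
    exact ⟨⟨trivial, hsm, trivial⟩, ⟨Expr.ok_any_map (f := fun d : Fin k =>
      .cond (.arr (lst d) (.var 10)) (.const (if d = c then 0 else 1))
        (.const (if d = c then 1 else 0))) fun d => ⟨⟨hl d, trivial⟩, trivial, trivial⟩,
      trivial, trivial⟩, trivial⟩
  · exact Expr.ok_any_map fun c => ⟨⟨hl c, trivial⟩,
      Expr.ok_any_map fun d => ⟨hl d, trivial⟩, trivial⟩

/-- A search for a solution: the variable `0` is set to `1` by a successful iteration. -/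
theorem search_spec {f : Store → Store} {v M : ℕ} {σ : Store} (J : Store → Prop) (S : Prop)
    (hσ : J σ) (h0 : σ.var 0 = 0)
    (hf : ∀ i < M, ∀ τ, J τ → J (f (τ.set v i)) ∧
      ((f (τ.set v i)).var 0 = τ.var 0 ∨ ((f (τ.set v i)).var 0 = 1 ∧ S)))
    (hS : S → ∃ i < M, ∀ τ, J τ → (f (τ.set v i)).var 0 = 1) :
    (S → (iter f v M σ).var 0 = 1) ∧ (¬ S → (iter f v M σ).var 0 = 0) := by
  have key : ∀ N, N ≤ M → J (iter f v N σ) ∧ ((iter f v N σ).var 0 = 0 ∨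
      ((iter f v N σ).var 0 = 1 ∧ S)) ∧
      ((∃ i < N, ∀ τ, J τ → (f (τ.set v i)).var 0 = 1) → (iter f v N σ).var 0 = 1) := by
    intro N
    induction N with
    | zero => exact fun _ => ⟨hσ, Or.inl h0, fun ⟨i, hi, _⟩ => absurd hi (by omega)⟩
    | succ N ih =>
      intro hN
      obtain ⟨h1, h2, h3⟩ := ih (by omega)
      obtain ⟨g1, g2⟩ := hf N (by omega) _ h1
      rw [iter]
      refine ⟨g1, ?_, ?_⟩
      · rcases g2 with g2 | g2
        · rw [g2]; exact h2
        · exact Or.inr g2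
      · rintro ⟨i, hi, hi'⟩
        rcases Nat.lt_succ_iff_lt_or_eq.1 hi with hi | rfl
        · rcases g2 with g2 | g2
          · rw [g2]; exact h3 ⟨i, hi, hi'⟩
          · exact g2.1
        · exact hi' _ h1
  obtain ⟨-, h2, h3⟩ := key M le_rfl
  refine ⟨fun h => h3 (hS h), fun h => ?_⟩
  rcases h2 with h2 | h2
  · exact h2
  · exact absurd h2.2 h

end RAM

namespace ListColoring

/-! ### Certificates -/

variable {n k : ℕ} {G : SimpleGraph (Fin n)}

open Classical in
/-- An instruction `y` of a certificate changes a partial colouring. If `y = c * n + v` with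
`c < k`, then `v` gets the colour `c`; if `y = (k + c) * n + v` with `c < k`, then all neighbours
of `v` get the colour `c`; all other instructions have no effect. -/
noncomputable def instruct (G : SimpleGraph (Fin n)) (k : ℕ) (A : Fin n → ℕ) (y : ℕ) :
    Fin n → ℕ := fun w =>
  if y / n < k then (if (w : ℕ) = y % n then y / n else A w)
  else if y / n < k + k ∧ ∃ v : Fin n, (v : ℕ) = y % n ∧ G.Adj w v then y / n - k
  else A w

/-- The number of instructions. -/
def numInstr (k n : ℕ) : ℕ := (2 * k + 1) * n

/-- The partial colouring `A` arises from at most `m` instructions, beginning with the one that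
colours no vertex; the value `k` stands for the lack of a colour. -/
def Obtainable (G : SimpleGraph (Fin n)) (k m : ℕ) (A : Fin n → ℕ) : Prop :=
  ∃ l : List ℕ, l.length ≤ m ∧ (∀ y ∈ l, y < numInstr k n) ∧
    l.foldl (instruct G k) (fun _ => k) = A

theorem Obtainable.zero : Obtainable G k 0 fun _ => k := ⟨[], le_rfl, by simp, rfl⟩

theorem Obtainable.mono {m m' : ℕ} {A : Fin n → ℕ} (h : Obtainable G k m A) (hm : m ≤ m') :
    Obtainable G k m' A := by
  obtain ⟨l, h1, h2⟩ := h
  exact ⟨l, h1.trans hm, h2⟩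

theorem Obtainable.snoc {m : ℕ} {A : Fin n → ℕ} (h : Obtainable G k m A) {y : ℕ}
    (hy : y < numInstr k n) : Obtainable G k (m + 1) (instruct G k A y) := by
  obtain ⟨l, h1, h2, h3⟩ := h
  refine ⟨l ++ [y], by simpa using h1, fun z hz => ?_, by simp [h3]⟩
  rcases List.mem_append.1 hz with hz | hz
  · exact h2 z hz
  · rw [List.mem_singleton.1 hz]; exact hy

theorem lt_numInstr {d v : ℕ} (hd : d < 2 * k + 1) (hv : v < n) : d * n + v < numInstr k n := by
  calc d * n + v < d * n + n := by omega
    _ = (d + 1) * n := by ring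
    _ ≤ _ := Nat.mul_le_mul_right _ hd

theorem mul_add_div_mod {d v : ℕ} (hv : v < n) :
    (d * n + v) / n = d ∧ (d * n + v) % n = v := by
  have hn : 0 < n := by omega
  constructor
  · rw [mul_comm, Nat.mul_add_div hn, Nat.div_eq_of_lt hv, add_zero]
  · rw [Nat.mul_comm, Nat.mul_add_mod, Nat.mod_eq_of_lt hv]

open Classical in
/-- One instruction colours a single vertex. -/
theorem Obtainable.update {m : ℕ} {A : Fin n → ℕ} (h : Obtainable G k m A) (v : Fin n)
    (c : Fin k) : Obtainable G k (m + 1) (Function.update A v c) := by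
  have h1 := h.snoc (y := (c : ℕ) * n + v) (lt_numInstr (by omega) v.2)
  convert h1 using 1
  funext w
  obtain ⟨h2, h3⟩ := mul_add_div_mod (d := (c : ℕ)) v.2
  rw [instruct, h2, h3, if_pos c.2, Function.update_apply]
  simp only [Fin.ext_iff]

open Classical in
/-- One instruction colours all neighbours of a vertex. -/
theorem Obtainable.nbrs {m : ℕ} {A : Fin n → ℕ} (h : Obtainable G k m A) (v : Fin n)
    (c : Fin k) : Obtainable G k (m + 1) (fun w => if G.Adj w v then (c : ℕ) else A w) := by
  have h1 := h.snoc (y := (k + c) * n + v) (lt_numInstr (by omega) v.2)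
  convert h1 using 1
  funext w
  obtain ⟨h2, h3⟩ := mul_add_div_mod (d := k + (c : ℕ)) v.2
  have hc : k + (c : ℕ) < k + k := by omega
  have h4 : (∃ v' : Fin n, (v' : ℕ) = v ∧ G.Adj w v') ↔ G.Adj w v :=
    ⟨fun ⟨v', e, h⟩ => Fin.ext e ▸ h, fun h => ⟨v, rfl, h⟩⟩
  have hc' : ¬ k + (c : ℕ) < k := by omega
  simp only [instruct, h2, h3, hc, hc', h4, if_false, true_and, Nat.add_sub_cancel_left]

open Classical in
/-- The vertices of a finite set are coloured one by one. -/
theorem Obtainable.finset {m : ℕ} {A : Fin n → ℕ} (h : Obtainable G k m A) (S : Finset (Fin n))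
    (f : Fin n → Fin k) :
    Obtainable G k (m + S.card) (fun w => if w ∈ S then (f w : ℕ) else A w) := by
  induction S using Finset.induction_on with
  | empty => simpa using h
  | insert v S hv ih =>
    rw [Finset.card_insert_of_notMem hv, ← add_assoc]
    convert ih.update v (f v) using 1
    funext w
    by_cases hw : w = v
    · subst hw; simp
    · simp [hw]

/-- Shorter certificates can be padded with instructions that have no effect. -/
theorem Obtainable.exists_length_eq {m : ℕ} {A : Fin n → ℕ} (hn : 0 < n)
    (h : Obtainable G k m A) : ∃ l : List ℕ, l.length = m ∧ (∀ y ∈ l, y < numInstr k n) ∧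
    l.foldl (instruct G k) (fun _ => k) = A := by
  obtain ⟨l, h1, h2, h3⟩ := h
  have hnop : ∀ A : Fin n → ℕ, instruct G k A (2 * k * n + 0) = A := by
    intro A
    funext w
    rw [instruct, (mul_add_div_mod (d := 2 * k) hn).1, if_neg (by omega), if_neg (by omega)]
  refine ⟨l ++ List.replicate (m - l.length) (2 * k * n + 0), by simp; omega, fun y hy => ?_, ?_⟩
  · rcases List.mem_append.1 hy with hy | hy
    · exact h2 y hy
    · rw [List.eq_of_mem_replicate hy]
      exact lt_numInstr (by omega) hn
  · rw [List.foldl_append, h3]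
    generalize m - l.length = j
    induction j with
    | zero => rfl
    | succ j ih => rw [List.replicate_succ, List.foldl_cons, hnop, ih]

theorem ofDigits_lt {B : ℕ} {l : List ℕ} (h : ∀ y ∈ l, y < B) :
    Nat.ofDigits B l < B ^ l.length := by
  induction l with
  | nil => simp
  | cons y l ih =>
    have h1 := h y (by simp)
    have h2 := ih fun z hz => h z (by simp [hz])
    rw [Nat.ofDigits_cons, List.length_cons, pow_succ]
    nlinarith

end ListColoring

namespace RAM

open LoopGraph ListColoring

variable {n k : ℕ} {G : SimpleGraph (Fin n)} {L : Fin n → Finset (Fin k)} {Γ : Env} {σ : Store}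

theorem Cmd.eval_seq (c d : Cmd) (σ : Store) :
    (Cmd.seq c d).eval Γ σ = d.eval Γ (c.eval Γ σ) := rfl

theorem Cmd.eval_assign (v : ℕ) (e : Expr) (σ : Store) :
    (Cmd.assign v e).eval Γ σ = σ.set v (e.eval Γ σ) := rfl

theorem Cmd.eval_for (p v : ℕ) (c : Cmd) (σ : Store) :
    (Cmd.forTo p v c).eval Γ σ = iter (c.eval Γ) v (Γ.param p) σ := rfl

theorem card_filter_mul_le {b x M : ℕ} (hb : 0 < b) (hx : x / b ≤ M) :
    ∑ j ∈ Finset.range M, (if b * (j + 1) ≤ x then 1 else 0) = x / b := by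
  rw [← Finset.sum_filter, Finset.sum_const, smul_eq_mul, mul_one]
  have : (Finset.range M).filter (fun j => b * (j + 1) ≤ x) = Finset.range (x / b) := by
    ext j
    simp only [Finset.mem_filter, Finset.mem_range]
    rw [mul_comm, ← Nat.le_div_iff_mul_le hb]
    omega
  rw [this, Finset.card_range]

/-- The quotient of the variable `v` by the parameter `p`, if it is at most the parameter `q`. -/
def Expr.quot (q p v : ℕ) : Expr :=
  .sum q 20 (.cond (.lt (.var v) (.pmul p 21 (.add (.var 20) (.const 1)))) (.const 0) (.const 1))

theorem Expr.eval_quot {q p v : ℕ} (hv : v ≠ 20) (hp : 0 < Γ.param p)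
    (h : σ.var v / Γ.param p ≤ Γ.param q) :
    (Expr.quot q p v).eval Γ σ = σ.var v / Γ.param p := by
  classical
  rw [← card_filter_mul_le hp h, Expr.quot, Expr.eval]
  refine Finset.sum_congr rfl fun j _ => ?_
  rw [Expr.eval_cond]
  have hnv : (Expr.add (.var 20) (.const 1)).NoVar 21 := ⟨by simp [Expr.NoVar], trivial⟩
  simp only [Expr.holds_lt, Expr.eval_pmul _ _ _ hnv]
  simp only [Expr.eval, Store.set_var, if_neg hv, if_true]
  split_ifs <;> omega

/-- Execute the instruction in variable `6`. -/
def instructCmd (k : ℕ) : Cmd :=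
  .seq (.assign 7 (.quot 5 0 6)) (.seq (.assign 8 (.sub (.var 6) (.pmul 0 20 (.var 7))))
    (.seq (.map 2 10 (.cond (.lt (.var 7) (.const k))
      (.cond (.eq (.var 10) (.var 8)) (.var 7) (.arr 1 (.var 10)))
      (.cond (.and (.lt (.var 7) (.const (k + k))) (.adj (.var 10) (.var 8)))
        (.sub (.var 7) (.const k)) (.arr 1 (.var 10)))))
    (.map 1 10 (.arr 2 (.var 10)))))

theorem instructCmd_keepsVar {w : ℕ} (hw : w < 7) : (instructCmd k).KeepsVar w := by
  simp only [instructCmd, Cmd.KeepsVar, Cmd.keepsVar_map]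
  omega

theorem instructCmd_keepsArr {a : ℕ} (ha : a ≠ 1) (ha' : a ≠ 2) :
    (instructCmd k).KeepsArr a := by
  simp only [instructCmd, Cmd.KeepsArr, Cmd.keepsArr_map]
  exact ⟨trivial, trivial, ha'.symm, ha.symm⟩

theorem instructCmd_spec (hΓ : IsInstance Γ G L) (h5 : Γ.param 5 = numInstr k n)
    (hσ : HasRows n σ) {A : Fin n → ℕ} (hA : ∀ v : Fin n, σ.arr 1 v = A v) {y : ℕ}
    (hy : σ.var 6 = y) (hy' : y < numInstr k n) (v : Fin n) :
    ((instructCmd k).eval Γ σ).arr 1 v = instruct G k A y v := by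
  classical
  have hn : 0 < n := v.pos
  have h0 := hΓ.vertices
  rw [instructCmd, Cmd.eval_seq, Cmd.eval_seq, Cmd.eval_seq, Cmd.eval_assign, Cmd.eval_assign,
    Cmd.eval_map (by exact ⟨by decide, trivial⟩) _ (by rw [h0]; exact v.2)]
  rw [Expr.eval, Store.set_arr, Expr.eval, Store.set_var, if_pos rfl]
  have hq : (Expr.quot 5 0 6).eval Γ σ = y / n := by
    rw [Expr.eval_quot (by decide) (by rw [h0]; exact hn), h0, hy]
    rw [hy, h0, h5]
    exact (Nat.div_le_self y n).trans hy'.le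
  rw [hq]
  set σ₁ := σ.set 7 (y / n) with hσ₁
  have hm : (Expr.sub (.var 6) (.pmul 0 20 (.var 7))).eval Γ σ₁ = y % n := by
    have hnv : (Expr.var 7).NoVar 20 := by simp [Expr.NoVar]
    simp only [Expr.eval, Expr.eval_pmul _ _ _ hnv, h0]
    have := Nat.mod_add_div y n
    simp [hσ₁, hy]
    omega
  rw [hm]
  set σ₂ := σ₁.set 8 (y % n) with hσ₂
  have hrow : HasRows n (σ₂.set 10 v) := hσ
  rw [Cmd.eval_map _ _ (by rw [h0]; exact v.2)]
  · have hadj : (Expr.adj (.var 10) (.var 8)).Holds Γ (σ₂.set 10 v) ↔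
        ∃ u : Fin n, (u : ℕ) = y % n ∧ G.Adj v u := by
      have hu : y % n < n := Nat.mod_lt _ hn
      rw [holds_adj hΓ hrow v ⟨y % n, hu⟩ (by simp [Expr.eval]) (by simp [Expr.eval, hσ₂])]
      exact ⟨fun h => ⟨_, rfl, h⟩, fun ⟨u, e, h⟩ => by
        have : u = ⟨y % n, hu⟩ := Fin.ext e
        exact this ▸ h⟩
    simp only [Expr.eval_cond, Expr.holds_lt, Expr.holds_eq, Expr.holds_and, hadj]
    simp [Expr.eval, hσ₂, hσ₁, instruct, hA]
  · simp [Expr.NoArr, Expr.lt, Expr.eq, Expr.not, Expr.and, Expr.adj]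

/-- Split off the last digit of variable `3`, in base `param 5`, and execute it. -/
def digitCmd (k : ℕ) : Cmd :=
  .seq (.assign 5 (.quot 6 5 3)) (.seq (.assign 6 (.sub (.var 3) (.pmul 5 20 (.var 5))))
    (.seq (.assign 3 (.var 5)) (instructCmd k)))

theorem digitCmd_spec (hΓ : IsInstance Γ G L) (h5 : Γ.param 5 = numInstr k n)
    (hσ : HasRows n σ) {A : Fin n → ℕ} (hA : ∀ v : Fin n, σ.arr 1 v = A v) {y x : ℕ}
    (hy : y < numInstr k n) (hx : σ.var 3 = y + numInstr k n * x) (hM : σ.var 3 ≤ Γ.param 6) :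
    ((digitCmd k).eval Γ σ).var 3 = x ∧
      ∀ v : Fin n, ((digitCmd k).eval Γ σ).arr 1 v = instruct G k A y v := by
  have hB : 0 < numInstr k n := by omega
  have hq : (Expr.quot 6 5 3).eval Γ σ = x := by
    rw [Expr.eval_quot (by decide) (by rw [h5]; exact hB) ((Nat.div_le_self _ _).trans hM), h5, hx,
      Nat.add_mul_div_left _ _ hB, Nat.div_eq_of_lt hy, zero_add]
  have hnv : (Expr.var 5).NoVar 20 := by simp [Expr.NoVar]
  have hr : (Expr.sub (.var 3) (.pmul 5 20 (.var 5))).eval Γ (σ.set 5 x) = y := by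
    simp only [Expr.eval, Expr.eval_pmul _ _ _ hnv, h5]
    simp [hx]
  rw [digitCmd, Cmd.eval_seq, Cmd.eval_seq, Cmd.eval_seq, Cmd.eval_assign 5, hq,
    Cmd.eval_assign 6, hr, Cmd.eval_assign]
  constructor
  · rw [Cmd.eval_var _ (instructCmd_keepsVar (by omega))]
    simp [Expr.eval]
  · exact fun v => instructCmd_spec hΓ h5 (by exact hσ) (by simpa using hA)
      (by simp [Expr.eval]) hy v

/-- Decode the certificate in variable `2`, and complete the partial colouring. -/
noncomputable def certificateCmd (H : LoopGraph (Fin k)) : Cmd :=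
  .seq (.map 1 10 (.const k)) (.seq (.assign 3 (.var 2))
    (.seq (.forTo 4 4 (digitCmd k)) (completeCmd H)))

theorem digitCmd_keepsVar {w : ℕ} (hw : w < 3) : (digitCmd k).KeepsVar w := by
  have := instructCmd_keepsVar (k := k) (w := w) (by omega)
  simp only [digitCmd, Cmd.KeepsVar, this, and_true]
  omega

theorem digitCmd_keepsArr {a : ℕ} (ha : a ≠ 1) (ha' : a ≠ 2) : (digitCmd k).KeepsArr a := by
  simp only [digitCmd, Cmd.KeepsArr, instructCmd_keepsArr ha ha', true_and]

theorem certificateCmd_keepsArr (H : LoopGraph (Fin k)) : (certificateCmd H).KeepsArr 0 := by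
  simp only [certificateCmd, Cmd.KeepsArr, Cmd.keepsArr_map, completeCmd_keepsArr H (a := 0)
    (by omega), digitCmd_keepsArr (k := k) (a := 0) (by omega) (by omega)]
  simp

/-- The environment for the decoding of certificates with `K` instructions. -/
structure CertEnv (Γ : Env) (G : SimpleGraph (Fin n)) (L : Fin n → Finset (Fin k)) (K : ℕ) :
    Prop extends IsInstance Γ G L where
  length_cert : Γ.param 4 = K
  base : Γ.param 5 = numInstr k n
  num : Γ.param 6 = numInstr k n ^ K

theorem certificateCmd_sound (H : LoopGraph (Fin k)) {K : ℕ} (hΓ : CertEnv Γ G L K)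
    (hσ : HasRows n σ) : ((certificateCmd H).eval Γ σ).var 0 = σ.var 0 ∨
      ((certificateCmd H).eval Γ σ).var 0 = 1 ∧ ∃ φ, IsListHom G L H φ := by
  classical
  rw [certificateCmd, Cmd.eval_seq, Cmd.eval_seq, Cmd.eval_seq]
  set σ₁ := (Cmd.forTo 4 4 (digitCmd k)).eval Γ ((Cmd.assign 3 (.var 2)).eval Γ
    ((Cmd.map 1 10 (.const k)).eval Γ σ)) with hσ₁
  have hr : HasRows n σ₁ := by
    intro u hu
    rw [hσ₁, Cmd.eval_arr _ (by exact digitCmd_keepsArr (by omega) (by omega)),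
      Cmd.eval_arr _ (by trivial), Cmd.eval_arr _ (by simp), hσ u hu]
  have hv : σ₁.var 0 = σ.var 0 := by
    rw [hσ₁, Cmd.eval_var _ (by exact ⟨by decide, digitCmd_keepsVar (by omega)⟩),
      Cmd.eval_var _ (by simp [Cmd.KeepsVar]), Cmd.eval_var _ (by simp)]
  rw [completeCmd_spec H hΓ.toIsInstance hr]
  split_ifs with h
  · exact Or.inr ⟨rfl, h.exists_isListHom⟩
  · exact Or.inl hv

theorem certificateCmd_complete (H : LoopGraph (Fin k)) {K : ℕ} (hΓ : CertEnv Γ G L K)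
    (hσ : HasRows n σ) {φ : Fin n → Fin k} (hφ : IsListHom G L H φ) {A : Fin n → ℕ}
    (hA : Decisive G H φ A) {l : List ℕ} (hl : l.length = K) (hl' : ∀ y ∈ l, y < numInstr k n)
    (hlA : l.foldl (instruct G k) (fun _ => k) = A)
    (h2 : σ.var 2 = Nat.ofDigits (numInstr k n) l) :
    ((certificateCmd H).eval Γ σ).var 0 = 1 := by
  classical
  rw [certificateCmd, Cmd.eval_seq, Cmd.eval_seq, Cmd.eval_seq]
  set σ₀ := (Cmd.assign 3 (.var 2)).eval Γ ((Cmd.map 1 10 (.const k)).eval Γ σ) with hσ₀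
  have hr₀ : HasRows n σ₀ := by
    intro u hu
    rw [hσ₀, Cmd.eval_arr _ (by trivial), Cmd.eval_arr _ (by simp), hσ u hu]
  have hA₀ : ∀ v : Fin n, σ₀.arr 1 v = k := by
    intro v
    rw [hσ₀, Cmd.eval_arr _ (by trivial),
      Cmd.eval_map (by trivial) _ (by rw [hΓ.vertices]; exact v.2), Expr.eval]
  have h3 : σ₀.var 3 = Nat.ofDigits (numInstr k n) l := by
    rw [hσ₀, Cmd.eval]
    simp only [Expr.eval, Store.set_var, if_true]
    rw [Cmd.eval_var _ (by simp), h2]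
  have hlt := ofDigits_lt hl'
  rw [hl] at hlt
  have key : HasRows n ((Cmd.forTo 4 4 (digitCmd k)).eval Γ σ₀) ∧
      ∀ v : Fin n, ((Cmd.forTo 4 4 (digitCmd k)).eval Γ σ₀).arr 1 v =
        (l.take K).foldl (instruct G k) (fun _ => k) v := by
    rw [Cmd.eval, hΓ.length_cert]
    let I : ℕ → Store → Prop := fun i τ => HasRows n τ ∧
      τ.var 3 = Nat.ofDigits (numInstr k n) (l.drop i) ∧
      τ.var 3 ≤ Nat.ofDigits (numInstr k n) l ∧
      ∀ v : Fin n, τ.arr 1 v = (l.take i).foldl (instruct G k) (fun _ => k) v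
    have hI : I K (iter ((digitCmd k).eval Γ) 4 K σ₀) := by
      refine iter_induction I ⟨hr₀, by simpa using h3, h3.le, fun v => hA₀ v⟩ ?_
      rintro i hi τ ⟨g1, g2, g3, g4⟩
      have hil : i < l.length := by omega
      have hd : l.drop i = l[i] :: l.drop (i + 1) := List.drop_eq_getElem_cons hil
      have hspec := digitCmd_spec (σ := τ.set 4 i) hΓ.toIsInstance hΓ.base (by exact g1) g4
        (y := l[i]) (x := Nat.ofDigits (numInstr k n) (l.drop (i + 1)))
        (hl' _ (List.getElem_mem hil))
        (by rw [Store.set_var, if_neg (by decide), g2, hd, Nat.ofDigits_cons])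
        (by rw [hΓ.num]; simpa using g3.trans hlt.le)
      refine ⟨fun u hu => ?_, hspec.1, ?_, fun v => ?_⟩
      · rw [Cmd.eval_arr _ (digitCmd_keepsArr (by omega) (by omega))]
        exact g1 u hu
      · rw [hspec.1]
        refine le_trans ?_ g3
        rw [g2, hd, Nat.ofDigits_cons]
        have hpos : 1 ≤ numInstr k n := by
          have := hl' _ (List.getElem_mem hil)
          omega
        nlinarith
      · rw [hspec.2 v, List.take_succ_eq_append_getElem hil, List.foldl_append]
        rfl
    exact ⟨hI.1, hI.2.2.2⟩
  have hA' : ∀ v : Fin n, ((Cmd.forTo 4 4 (digitCmd k)).eval Γ σ₀).arr 1 v = A v := by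
    intro v
    rw [key.2 v, ← hlA, ← hl, List.take_length]
  rw [completeCmd_spec H hΓ.toIsInstance key.1, if_pos]
  simp only [hA']
  exact hA.solved (Nat.le_add_left _ _) hφ

end RAM

namespace RAM

open LoopGraph ListColoring

/-! ### Exhaustive search for a certificate -/

theorem Env.setParam_le {Γ : Env} {N q x : ℕ} (h : ∀ p, Γ.param p ≤ N) (hx : x ≤ N) (p : ℕ) :
    (Γ.setParam q x).param p ≤ N := by
  rw [Env.setParam_param]
  split_ifs
  · exact hx
  · exact h p

theorem startEnv_le {n k N : ℕ} (G : SimpleGraph (Fin n)) (L : Fin n → Finset (Fin k))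
    (h : n + (n * n + n * k) ≤ N) (p : ℕ) : (startEnv G L).param p ≤ N := by
  simp only [startEnv]
  split_ifs <;> omega

/-- Compute the addresses of the rows of the adjacency matrix. -/
def rowsCmd : Cmd := .map 0 10 (.pmul 0 20 (.var 10))

theorem rowsCmd_spec {n : ℕ} {Γ : Env} (h : Γ.param 0 = n) (σ : Store) :
    HasRows n (rowsCmd.eval Γ σ) := by
  intro u hu
  have hnv : (Expr.var 10).NoVar 20 := by simp [Expr.NoVar]
  rw [rowsCmd, Cmd.eval_map (by trivial) _ (by rw [h]; exact hu), Expr.eval_pmul _ _ _ hnv, h,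
    mul_comm]
  simp [Expr.eval]

/-- The stage that computes the address of the first list. -/
def listsStage : Stage := ⟨.skip, .sum 0 0 (.param 0), 2⟩

/-- The stages of the search for a certificate whose length is computed by the command `kc` as
variable `2`. -/
noncomputable def certificateStages {k : ℕ} (H : LoopGraph (Fin k)) (kc : Cmd) : List Stage :=
  [listsStage, ⟨kc, .var 2, 4⟩, ⟨.skip, .smul (.param 0) (2 * k + 1), 5⟩,
    ⟨.seq (.assign 3 (.const 1)) (.forTo 4 4 (.assign 3 (.pmul 5 20 (.var 3)))), .var 3, 6⟩,
    ⟨.seq rowsCmd (.seq (.assign 0 (.const 0)) (.forTo 6 2 (certificateCmd H))), .var 0, 0⟩]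

theorem rowsCmd_ok (k : ℕ) : rowsCmd.Ok (7 + 3 * k) := by
  simp only [rowsCmd, Cmd.ok_map]
  exact ⟨by omega, trivial⟩

theorem certificateCmd_ok {k : ℕ} (H : LoopGraph (Fin k)) : (certificateCmd H).Ok (7 + 3 * k) := by
  have h0 : 0 < 7 + 3 * k := by omega
  have h1 : 1 < 7 + 3 * k := by omega
  have h2 : 2 < 7 + 3 * k := by omega
  simp only [certificateCmd, digitCmd, instructCmd, Cmd.Ok, Cmd.ok_map, completeCmd_ok, Expr.Ok,
    Expr.quot, Expr.lt, Expr.pmul, Expr.eq, Expr.and, Expr.not, Expr.adj, h0, h1, h2, and_true]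

theorem power_spec {Γ : Env} {p q v w : ℕ} (hvw : v ≠ w) (hv : v ≠ 20) (σ : Store) :
    ((Cmd.seq (.assign v (.const 1))
      (.forTo p w (.assign v (.pmul q 20 (.var v))))).eval Γ σ).var v = Γ.param q ^ Γ.param p := by
  have hnv : (Expr.var v).NoVar 20 := hv
  rw [Cmd.eval_seq, Cmd.eval]
  refine iter_induction (fun i τ => τ.var v = Γ.param q ^ i) (by simp [Expr.eval])
    fun i _ τ h => ?_
  rw [Cmd.eval_assign, Expr.eval_pmul _ _ _ hnv]
  simp [Expr.eval, hvw, h, pow_succ, mul_comm]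

/-- If every list homomorphism is determined by a certificate whose length `K n` can be computed,
then list colouring takes polynomial time in the number of certificates. -/
theorem solves_of_certificates {k : ℕ} (H : LoopGraph (Fin k)) (kc : Cmd) (K : ℕ → ℕ)
    (hok : kc.Ok (7 + 3 * k)) (hK : ∀ (Γ : Env) (σ : Store), (kc.eval Γ σ).var 2 = K (Γ.param 0))
    (hcert : ∀ (n : ℕ) (G : SimpleGraph (Fin n)) (φ : Fin n → Fin k), G.Connected → G.diam = 2 →
      (∀ u v, G.Adj u v → H.Adj (φ u) (φ v)) →
      ∃ A, Decisive G H φ A ∧ Obtainable G k (K n) A) :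
    ∃ (P : Program) (C d : ℕ), SolvesListColoringDiamTwo H P fun n =>
      ((C * (n + (n * n + n * k) + K n + numInstr k n + numInstr k n ^ K n + 1) ^ d : ℕ) : ℝ) := by
  have hstages : ∀ S ∈ certificateStages H kc, S.Ok (7 + 3 * k) := by
    have hsm : (Expr.smul (.param 0) (2 * k + 1)).Ok (7 + 3 * k) :=
      Expr.ok_smul (e := .param 0) trivial _
    simp only [certificateStages, listsStage, List.mem_cons, List.not_mem_nil, or_false,
      forall_eq_or_imp, forall_eq, Stage.Ok, Cmd.Ok, Cmd.skip, Expr.Ok, Expr.pmul, hok, hsm,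
      rowsCmd_ok, certificateCmd_ok, true_and, and_true]
    omega
  obtain ⟨P, C, d, h⟩ := exists_program k (7 + 3 * k) hstages
  refine ⟨P, C, d, fun n G L hG hdiam => ?_⟩
  have hn : 0 < n := by
    obtain ⟨v⟩ := hG.nonempty
    exact v.pos
  set N := n + (n * n + n * k) + K n + numInstr k n + numInstr k n ^ K n + 1 with hN
  -- the environments at the beginning of the stages
  let Γ₁ := (startEnv G L).setParam 2 (n * n)
  let Γ₂ := Γ₁.setParam 4 (K n)
  let Γ₃ := Γ₂.setParam 5 (numInstr k n)
  let Γ₄ := Γ₃.setParam 6 (numInstr k n ^ K n)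
  have hrun : ∀ σ : Store, ∃ σ₁ σ₂ σ₃ σ₄ : Store,
      listsStage.run (startEnv G L, σ) = (Γ₁, σ₁) ∧
      Stage.run ⟨kc, .var 2, 4⟩ (Γ₁, σ₁) = (Γ₂, σ₂) ∧
      Stage.run ⟨.skip, .smul (.param 0) (2 * k + 1), 5⟩ (Γ₂, σ₂) = (Γ₃, σ₃) ∧
      Stage.run ⟨.seq (.assign 3 (.const 1)) (.forTo 4 4 (.assign 3 (.pmul 5 20 (.var 3)))),
        .var 3, 6⟩ (Γ₃, σ₃) = (Γ₄, σ₄) := by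
    intro σ
    refine ⟨_, _, _, _, Prod.ext ?_ rfl, Prod.ext ?_ rfl, Prod.ext ?_ rfl, Prod.ext ?_ rfl⟩
    · simp [Stage.run, listsStage, Γ₁, Expr.eval, startEnv]
    · simp [Stage.run, Γ₂, Γ₁, Expr.eval, hK, startEnv, Env.setParam_param]
    · simp [Stage.run, Γ₃, Γ₂, Γ₁, Expr.eval, startEnv, Env.setParam_param, numInstr]
    · simp only [Stage.run, Expr.eval]
      rw [power_spec (by decide) (by decide)]
      simp [Γ₄, Γ₃, Γ₂, Env.setParam_param]
  have b₀ := startEnv_le (N := N) G L (by omega)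
  have b₁ := Env.setParam_le (q := 2) (x := n * n) b₀ (by omega)
  have b₂ := Env.setParam_le (q := 4) (x := K n) b₁ (by omega)
  have b₃ := Env.setParam_le (q := 5) (x := numInstr k n) b₂ (by omega)
  have b₄ := Env.setParam_le (q := 6) (x := numInstr k n ^ K n) b₃ (by omega)
  obtain ⟨σ, s, t, hr, ht, hs⟩ := h n G L N (by omega) (by omega) fun σ => by
    obtain ⟨σ₁, σ₂, σ₃, σ₄, h₁, h₂, h₃, h₄⟩ := hrun σ
    rw [certificateStages, ParamsLE, h₁, ParamsLE, h₂, ParamsLE, h₃, ParamsLE, h₄, ParamsLE]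
    exact ⟨b₀, b₁, b₂, b₃, b₄, trivial⟩
  refine ⟨s, t, hr, Nat.cast_le.2 ht, ?_⟩
  obtain ⟨σ₁, σ₂, σ₃, σ₄, h₁, h₂, h₃, h₄⟩ := hrun σ
  rw [certificateStages, runStages, h₁, runStages, h₂, runStages, h₃, runStages, h₄, runStages,
    runStages, Stage.run] at hs
  simp only [Expr.eval, Env.setParam_param, if_true] at hs
  have hΓ : CertEnv Γ₄ G L (K n) := by
    refine ⟨⟨?_, ?_, ?_, rfl⟩, ?_, ?_, ?_⟩ <;>
      simp [Γ₄, Γ₃, Γ₂, Γ₁, Env.setParam_param, startEnv]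
  rw [hs, Cmd.eval_seq, Cmd.eval_seq, Cmd.eval_for, hΓ.num]
  refine search_spec (HasRows n) (∃ φ, IsListHom G L H φ) ?_ (by simp [Cmd.eval, Expr.eval])
    (fun i _ τ hτ => ⟨fun u hu => ?_, ?_⟩) ?_
  · exact rowsCmd_spec hΓ.vertices _
  · rw [Cmd.eval_arr _ (certificateCmd_keepsArr H)]
    exact hτ u hu
  · simpa using certificateCmd_sound (σ := τ.set 2 i) H hΓ hτ
  · rintro ⟨φ, hφ⟩
    obtain ⟨A, hA, hob⟩ := hcert n G φ hG hdiam hφ.1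
    obtain ⟨l, hl, hl', hlA⟩ := hob.exists_length_eq hn
    refine ⟨Nat.ofDigits (numInstr k n) l, ?_, fun τ hτ =>
      certificateCmd_complete (σ := τ.set 2 _) H hΓ hτ hφ hA hl hl' hlA (by simp)⟩
    rw [← hl]
    exact ofDigits_lt hl'

end RAM

namespace ListColoring

open LoopGraph

/-! ### Graphs of diameter two -/

variable {n k : ℕ} {G : SimpleGraph (Fin n)} {H : LoopGraph (Fin k)} {φ : Fin n → Fin k}

theorem exists_common_neighbor (hG : G.Connected) (hd : G.diam = 2) {u v : Fin n} (huv : u ≠ v)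
    (hadj : ¬ G.Adj u v) : ∃ w, G.Adj u w ∧ G.Adj w v := by
  have hne : G.ediam ≠ ⊤ := by
    intro h
    rw [SimpleGraph.diam, h] at hd
    simp at hd
  have hle : G.dist u v ≤ 2 := hd ▸ SimpleGraph.dist_le_diam hne
  obtain ⟨p, hp⟩ := hG.exists_walk_length_eq_dist u v
  rw [← hp] at hle
  match p, hle with
  | .nil, _ => exact absurd rfl huv
  | .cons h .nil, _ => exact absurd h hadj
  | .cons h (.cons h' .nil), _ => exact ⟨_, h, h'⟩
  | .cons _ (.cons _ (.cons _ _)), h => simp at h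

theorem three_le_of_diam_eq_two (hd : G.diam = 2) : 3 ≤ n := by
  by_contra hn
  have hne : G.ediam ≠ ⊤ := by
    intro h
    rw [SimpleGraph.diam, h] at hd
    simp at hd
  have : Nonempty (Fin n) := by
    by_contra h
    rw [not_nonempty_iff] at h
    rw [SimpleGraph.diam, SimpleGraph.ediam_eq_zero_of_subsingleton] at hd
    simp at hd
  obtain ⟨u, v, huv⟩ := G.exists_dist_eq_diam
  rw [hd] at huv
  have hr : G.Reachable u v := SimpleGraph.Reachable.of_dist_ne_zero (by omega)
  obtain ⟨p, hp, hlen⟩ := hr.exists_path_of_dist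
  have := hp.length_lt
  rw [Fintype.card_fin] at this
  omega

theorem exists_neighbor (hG : G.Connected) (hd : G.diam = 2) (v : Fin n) : ∃ u, G.Adj v u := by
  have h3 := three_le_of_diam_eq_two hd
  have : Nontrivial (Fin n) := Fin.nontrivial_iff_two_le.2 (by omega)
  obtain ⟨u, hu⟩ := exists_ne v
  by_cases h : G.Adj v u
  · exact ⟨u, h⟩
  · obtain ⟨w, hw, -⟩ := exists_common_neighbor hG hd hu.symm h
    exact ⟨w, hw⟩

/-! ### Certificates of constant length -/

/-- A coloured neighbour leaves at most two colours to a vertex, so it suffices to colour a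
dominating set. -/
theorem decisive_of_dominating (hdeg : ∀ x, (H.neighborSet x).ncard ≤ 2) {A : Fin n → ℕ}
    (hA : ∀ v, A v < k → A v = φ v) (hdom : ∀ v, A v < k ∨ ∃ u, G.Adj v u ∧ A u < k) :
    Decisive G H φ A := by
  refine ⟨hA, fun Y hY hAC v => ?_⟩
  rcases hdom v with hv | ⟨u, hvu, hu⟩
  · have : Y v ⊆ {φ v} := fun c hc => by
      rw [Finset.mem_singleton, Fin.ext_iff, ← hA v hv, hY v c hc hv]
    exact (Finset.card_le_card this).trans (by simp)
  · have hsub : (Y v : Set (Fin k)) ⊆ H.neighborSet (φ u) := by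
      intro c hc
      obtain ⟨b, hb, hcb⟩ := hAC v c hc u hvu
      have hbu : b = φ u := Fin.ext (by rw [← hA u hu, hY u b hb hu])
      exact H.symm _ _ (hbu ▸ hcb)
    have := Set.ncard_le_ncard hsub (Set.toFinite _)
    rw [Set.ncard_coe_finset] at this
    exact this.trans (hdeg _)

/-- A nonempty set of colours that is closed under taking neighbours contains all colours. -/
theorem eq_univ_of_closed (hconn : H.Connected) {T : Set (Fin k)} {x : Fin k} (hx : x ∈ T)
    (hT : ∀ y ∈ T, ∀ z, H.Adj y z → z ∈ T) (z : Fin k) : z ∈ T := by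
  obtain ⟨p⟩ := hconn.preconnected x z
  induction p with
  | nil => exact hx
  | cons h _ ih =>
    rw [SimpleGraph.fromRel_adj] at h
    exact ih (hT _ hx _ (h.2.elim id (H.symm _ _)))

theorem isIso_cycle_three (hconn : H.Connected) {x y z : Fin k}
    (hx : ∀ w, H.Adj x w ↔ w = y ∨ w = z) (hy : ∀ w, H.Adj y w ↔ w = z ∨ w = x)
    (hz : ∀ w, H.Adj z w ↔ w = x ∨ w = y)
    (hxy : x ≠ y) (hyz : y ≠ z) (hxz : x ≠ z) : H.IsIso (cycle 3) := by
  have hall := eq_univ_of_closed hconn (T := {x, y, z}) (x := x) (by simp) (by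
    rintro w (rfl | rfl | rfl) u hu
    · rcases (hx u).1 hu with rfl | rfl <;> simp
    · rcases (hy u).1 hu with rfl | rfl <;> simp
    · rcases (hz u).1 hu with rfl | rfl <;> simp)
  have hbij : Function.Bijective ![x, y, z] := by
    constructor
    · intro i j h
      fin_cases i <;> fin_cases j <;> simp_all
    · intro w
      rcases hall w with rfl | rfl | rfl
      exacts [⟨0, rfl⟩, ⟨1, rfl⟩, ⟨2, rfl⟩]
  refine ⟨RelIso.symm ⟨Equiv.ofBijective _ hbij, ?_⟩⟩
  intro i j
  have hc : (cycle 3).Adj i j ↔ i ≠ j := by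
    simp only [cycle, ofSimpleGraph]
    revert i j; decide
  rw [hc]
  fin_cases i <;> fin_cases j <;>
    simp [hx, hy, hz, hxy, hyz, hxz, hxy.symm, hyz.symm, hxz.symm]

theorem isIso_pathLooped_three (hconn : H.Connected) {x y z : Fin k}
    (hx : ∀ w, H.Adj x w ↔ w = x ∨ w = y) (hy : ∀ w, H.Adj y w ↔ w = x ∨ w = z)
    (hz : ∀ w, H.Adj z w ↔ w = y ∨ w = z) (hxy : x ≠ y) (hyz : y ≠ z) (hxz : x ≠ z) :
    H.IsIso (pathLooped 3) := by
  have hall := eq_univ_of_closed hconn (T := {x, y, z}) (x := x) (by simp) (by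
    rintro w (rfl | rfl | rfl) u hu
    · rcases (hx u).1 hu with rfl | rfl <;> simp
    · rcases (hy u).1 hu with rfl | rfl <;> simp
    · rcases (hz u).1 hu with rfl | rfl <;> simp)
  have hbij : Function.Bijective ![x, y, z] := by
    constructor
    · intro i j h
      fin_cases i <;> fin_cases j <;> simp_all
    · intro w
      rcases hall w with rfl | rfl | rfl
      exacts [⟨0, rfl⟩, ⟨1, rfl⟩, ⟨2, rfl⟩]
  refine ⟨RelIso.symm ⟨Equiv.ofBijective _ hbij, ?_⟩⟩
  intro i j
  have hc : (pathLooped 3).Adj i j ↔ (i = 0 ∧ j = 0) ∨ (i = 0 ∧ j = 1) ∨ (i = 1 ∧ j = 0) ∨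
      (i = 1 ∧ j = 2) ∨ (i = 2 ∧ j = 1) ∨ (i = 2 ∧ j = 2) := by
    simp only [pathLooped, SimpleGraph.pathGraph_adj]
    revert i j; decide
  rw [hc]
  fin_cases i <;> fin_cases j <;>
    simp [hx, hy, hz, hxy, hyz, hxz, hxy.symm, hyz.symm, hxz.symm]

/-- If every vertex has neighbours of two colours, then the colour of a vertex has exactly two
neighbours in `H`, and the vertex has neighbours of both. -/
theorem exists_neighbor_of_adj (hdeg : ∀ x, (H.neighborSet x).ncard ≤ 2)
    (hφ : ∀ u v, G.Adj u v → H.Adj (φ u) (φ v))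
    (htwo : ∀ v, ∃ u u', G.Adj v u ∧ G.Adj v u' ∧ φ u ≠ φ u') (v : Fin n) :
    ∃ a b, a ≠ b ∧ (∀ c, H.Adj (φ v) c ↔ c = a ∨ c = b) ∧
      (∃ u, G.Adj v u ∧ φ u = a) ∧ ∃ u, G.Adj v u ∧ φ u = b := by
  obtain ⟨u, u', hu, hu', hne⟩ := htwo v
  refine ⟨φ u, φ u', hne, fun c => ?_, ⟨u, hu, rfl⟩, u', hu', rfl⟩
  have hsub : ({φ u, φ u'} : Set (Fin k)) ⊆ H.neighborSet (φ v) := by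
    rintro c (rfl | rfl)
    · exact hφ _ _ hu
    · exact hφ _ _ hu'
  have heq := Set.eq_of_subset_of_ncard_le hsub (by rw [Set.ncard_pair hne]; exact hdeg _)
  change c ∈ H.neighborSet (φ v) ↔ _
  rw [← heq]
  simp

/-- Outside the two exceptional cases there are certificates of constant length. -/
theorem exists_decisive (hconn : H.Connected) (hdeg : ∀ x, (H.neighborSet x).ncard ≤ 2)
    (hC : ¬ H.IsIso (cycle 3)) (hP : ¬ H.IsIso (pathLooped 3)) (hG : G.Connected)
    (hd : G.diam = 2) (hφ : ∀ u v, G.Adj u v → H.Adj (φ u) (φ v)) :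
    ∃ A, Decisive G H φ A ∧ Obtainable G k (k + 1) A := by
  classical
  by_cases hk : k ≤ 2
  · refine ⟨fun _ => k, ⟨fun v hv => absurd hv (by simp), fun Y _ _ v => ?_⟩,
      Obtainable.zero.mono (by omega)⟩
    exact (Finset.card_le_univ _).trans (by simpa using hk)
  by_cases hone : ∃ x c, ∀ u, G.Adj u x → φ u = c
  · obtain ⟨x, c, hx⟩ := hone
    refine ⟨_, decisive_of_dominating hdeg (fun v hv => ?_) fun v => ?_,
      (Obtainable.zero.nbrs x c).mono (by omega)⟩
    · split_ifs at hv ⊢ with h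
      · rw [hx v h]
      · omega
    · by_cases hv : G.Adj v x
      · left; simp [hv]
      · right
        by_cases hvx : v = x
        · obtain ⟨u, hu⟩ := exists_neighbor hG hd v
          exact ⟨u, hu, by simp [hvx ▸ hu.symm]⟩
        · obtain ⟨w, hw, hw'⟩ := exists_common_neighbor hG hd hvx hv
          exact ⟨w, hw, by simp [hw']⟩
  have htwo : ∀ v, ∃ u u', G.Adj v u ∧ G.Adj v u' ∧ φ u ≠ φ u' := by
    intro v
    by_contra hcon
    push Not at hcon
    obtain ⟨u, hu⟩ := exists_neighbor hG hd v
    exact hone ⟨v, φ u, fun u' hu' => hcon u' u hu'.symm hu⟩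
  have hnb := exists_neighbor_of_adj hdeg hφ htwo
  have hsurj : Function.Surjective φ := by
    have v₀ : Fin n := hG.nonempty.some
    intro z
    refine eq_univ_of_closed hconn (T := Set.range φ) ⟨v₀, rfl⟩ ?_ z
    rintro y ⟨v, rfl⟩ z hz
    obtain ⟨a, b, -, hab, ⟨u, -, hu⟩, u', -, hu'⟩ := hnb v
    rcases (hab z).1 hz with rfl | rfl
    exacts [⟨u, hu⟩, ⟨u', hu'⟩]
  have hdeg2 : ∀ x, ∃ a b, a ≠ b ∧ ∀ c, H.Adj x c ↔ c = a ∨ c = b := by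
    intro x
    obtain ⟨v, rfl⟩ := hsurj x
    obtain ⟨a, b, hab, h, -⟩ := hnb v
    exact ⟨a, b, hab, h⟩
  have hother : ∀ x a, H.Adj x a → ∃ b, b ≠ a ∧ ∀ c, H.Adj x c ↔ c = a ∨ c = b := by
    intro x a ha
    obtain ⟨c, d, hcd, h⟩ := hdeg2 x
    rcases (h a).1 ha with rfl | rfl
    · exact ⟨d, hcd.symm, h⟩
    · exact ⟨c, hcd, fun e => by rw [h, or_comm]⟩
  -- Starting at a loop on `a`, the colours form a path `a, b, c, d, …`. If it ends early, then `H`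
  -- has two vertices or is the looped path; otherwise vertices of the colours `a` and `d` have no
  -- common neighbour.
  have hloop : ∀ a, ¬ H.Adj a a := by
    intro a ha
    obtain ⟨b, hba, hNa⟩ := hother a a ha
    obtain ⟨c, hca, hNb⟩ := hother b a (H.symm _ _ ((hNa b).2 (Or.inr rfl)))
    by_cases hcb : c = b
    · have hall := eq_univ_of_closed hconn (T := {a, b}) (x := a) (by simp) (by
        rintro w (rfl | rfl) u hu
        · rcases (hNa u).1 hu with rfl | rfl <;> simp
        · rcases (hNb u).1 hu with rfl | rfl <;> simp [hcb])
      have : (Finset.univ : Finset (Fin k)) ⊆ {a, b} := fun w _ => by simpa using hall w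
      have := (Finset.card_le_card this).trans Finset.card_le_two
      simp at this
      omega
    obtain ⟨d, hdb, hNc⟩ := hother c b (H.symm _ _ ((hNb c).2 (Or.inr rfl)))
    by_cases hdc : d = c
    · exact hP (isIso_pathLooped_three hconn hNa hNb (fun w => by rw [hNc, hdc]) hba.symm
        (Ne.symm hcb) hca.symm)
    obtain ⟨v, hv⟩ := hsurj a
    obtain ⟨w, hw⟩ := hsurj d
    have hda : d ≠ a := by
      rintro rfl
      rcases (hNa c).1 (H.symm _ _ ((hNc d).2 (Or.inr rfl))) with h | h
      · exact hdc h.symm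
      · exact hcb h
    have hnd : ¬ H.Adj b d := fun h => by
      rcases (hNb d).1 h with h | h
      · exact hda h
      · exact hdc h
    have hnad : ¬ H.Adj a d := fun h => by
      rcases (hNa d).1 h with h | h
      · exact hda h
      · exact hdb h
    have hvw : v ≠ w := by rintro rfl; exact hda (hw.symm.trans hv)
    obtain ⟨u, hu, hu'⟩ := exists_common_neighbor hG hd hvw fun h => hnad (hv ▸ hw ▸ hφ _ _ h)
    have h1 := hφ _ _ hu
    have h2 := hφ _ _ hu'
    rw [hv, hNa] at h1
    rw [hw] at h2
    rcases h1 with h1 | h1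
    · exact hnad (h1 ▸ h2)
    · exact hnd (h1 ▸ h2)
  -- One vertex of each colour: these vertices form a dominating set. If `v` is not adjacent to the
  -- vertex chosen for a neighbour `y` of its colour, then it has a common neighbour with that
  -- vertex, whose colour is the other neighbour `z` of `φ v`; so `φ v`, `y`, `z` form a triangle.
  choose r hr using hsurj
  refine ⟨_, decisive_of_dominating hdeg (fun v hv => ?_) fun v => ?_,
    (Obtainable.zero.finset (Finset.univ.image r) φ).mono
      (by rw [zero_add]; exact Finset.card_image_le.trans (by simp))⟩
  · split_ifs at hv ⊢ with h
    · rfl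
    · omega
  · by_contra hcon
    push Not at hcon
    have hnr : ∀ y, ¬ G.Adj v (r y) := by
      intro y hy
      have := hcon.2 _ hy
      rw [if_pos (Finset.mem_image_of_mem r (Finset.mem_univ y))] at this
      have := (φ (r y)).2
      omega
    have hvr : ∀ y, v ≠ r y := by
      rintro y rfl
      have := hcon.1
      rw [if_pos (Finset.mem_image_of_mem r (Finset.mem_univ y))] at this
      have := (φ (r y)).2
      omega
    obtain ⟨y, z, hyz, hN⟩ := hdeg2 (φ v)
    have hy := (hN y).2 (Or.inl rfl)
    have hz := (hN z).2 (Or.inr rfl)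
    obtain ⟨u, hu, hu'⟩ := exists_common_neighbor hG hd (hvr y) (hnr y)
    have h1 := hφ _ _ hu
    have h2 := hφ _ _ hu'
    rw [hr] at h2
    have huz : φ u = z := by
      rcases (hN _).1 h1 with h | h
      · exact absurd (h ▸ h2) (hloop _)
      · exact h
    rw [huz] at h2
    have hvy : φ v ≠ y := fun h => hloop y (h ▸ hy)
    have hvz : φ v ≠ z := fun h => hloop z (h ▸ hz)
    obtain ⟨y', hy', hNy⟩ := hother y (φ v) (H.symm _ _ hy)
    obtain ⟨z', hz', hNz⟩ := hother z (φ v) (H.symm _ _ hz)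
    have e1 : z = y' := ((hNy z).1 (H.symm _ _ h2)).resolve_left hvz.symm
    have e2 : y = z' := ((hNz y).1 h2).resolve_left hvy.symm
    exact hC (isIso_cycle_three hconn hN (fun w => by rw [hNy, ← e1, or_comm])
      (fun w => by rw [hNz, ← e2]) hvy hyz hvz)

end ListColoring

namespace ListColoring

/-! ### Counting pairs -/

section Pairs

open Classical

variable {V : Type*}

/-- The number of partners of `v` in `X`. -/
noncomputable def partners (X : Finset V) (R : V → V → Prop) (v : V) : ℕ :=
  (X.filter fun w => R v w).card

theorem partners_le (X : Finset V) (R : V → V → Prop) (v : V) : partners X R v ≤ X.card :=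
  Finset.card_le_card (Finset.filter_subset _ _)

theorem card_le_partners {X S : Finset V} {R : V → V → Prop} {v : V}
    (h : ∀ w ∈ S, w ∈ X ∧ R v w) : S.card ≤ partners X R v :=
  Finset.card_le_card fun w hw => Finset.mem_filter.2 (h w hw)

theorem partners_le_card {X S : Finset V} {R : V → V → Prop} {v : V}
    (h : ∀ w ∈ X, R v w → w ∈ S) : partners X R v ≤ S.card :=
  Finset.card_le_card fun w hw => h w (Finset.mem_filter.1 hw).1 (Finset.mem_filter.1 hw).2

theorem partners_eq_zero {X : Finset V} {R : V → V → Prop} {v : V} (h : ∀ w ∈ X, ¬ R v w) :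
    partners X R v = 0 :=
  Nat.le_zero.1 (partners_le_card (S := ∅) fun w hw hR => absurd hR (h w hw))

theorem partners_mono {X : Finset V} {R R' : V → V → Prop} {v : V}
    (h : ∀ w ∈ X, R v w → R' v w) : partners X R v ≤ partners X R' v :=
  Finset.card_le_card fun w hw => by
    rw [Finset.mem_filter] at hw ⊢
    exact ⟨hw.1, h w hw.1 hw.2⟩

theorem partners_or_eq (X : Finset V) (R R' : V → V → Prop) (v : V) :
    partners X (fun v w => R v w ∨ R' v w) v =
      ((X.filter fun w => R v w) ∪ X.filter fun w => R' v w).card := by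
  rw [partners]
  congr 1
  ext w
  simp only [Finset.mem_filter, Finset.mem_union]
  tauto

theorem partners_or_le (X : Finset V) (R R' : V → V → Prop) (v : V) :
    partners X (fun v w => R v w ∨ R' v w) v ≤ partners X R v + partners X R' v := by
  rw [partners_or_eq]
  exact Finset.card_union_le _ _

theorem partners_or {X : Finset V} {R R' : V → V → Prop} {v : V}
    (h : ∀ w ∈ X, R v w → ¬ R' v w) :
    partners X (fun v w => R v w ∨ R' v w) v = partners X R v + partners X R' v := by
  rw [partners_or_eq, Finset.card_union_of_disjoint]
  · rfl
  · exact Finset.disjoint_filter.2 h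

theorem sum_partners_comm (X Y : Finset V) {R : V → V → Prop} (hR : ∀ v w, R v w → R w v) :
    ∑ v ∈ X, partners Y R v = ∑ w ∈ Y, partners X R w := by
  simp only [partners, Finset.card_filter]
  rw [Finset.sum_comm]
  refine Finset.sum_congr rfl fun w _ => Finset.sum_congr rfl fun v _ => ?_
  rw [propext (⟨hR v w, hR w v⟩ : R v w ↔ R w v)]

/-- Pairs of a symmetric relation either lie within `B` or have a member outside `B`. -/
theorem sum_partners_le {X B : Finset V} (hB : B ⊆ X) {R : V → V → Prop}
    (hR : ∀ v w, R v w → R w v) :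
    ∑ v ∈ X, partners X R v ≤ B.card * B.card + 2 * ∑ v ∈ X \ B, partners X R v := by
  have h1 : ∀ v, partners X R v = partners B R v + partners (X \ B) R v := by
    intro v
    rw [partners, partners, partners, ← Finset.card_union_of_disjoint, ← Finset.filter_union,
      Finset.union_sdiff_of_subset hB]
    exact Finset.disjoint_filter_filter Finset.disjoint_sdiff
  have h2 : ∑ v ∈ B, partners B R v ≤ B.card * B.card :=
    (Finset.sum_le_sum fun v _ => partners_le B R v).trans (by simp)
  have h3 : ∑ v ∈ X \ B, partners B R v ≤ ∑ v ∈ X \ B, partners X R v :=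
    Finset.sum_le_sum fun v _ => by rw [h1 v]; exact Nat.le_add_right _ _
  rw [← Finset.sum_sdiff hB, Finset.sum_congr rfl fun v (_ : v ∈ B) => h1 v,
    Finset.sum_add_distrib, sum_partners_comm B (X \ B) hR]
  omega

/-- A symmetric relation with many pairs has many pairs even if the count of each vertex is capped:
either the vertices at the cap suffice, or these are so few that by symmetry most pairs have a
member below the cap. -/
theorem capped_sum_ge {X : Finset V} {R : V → V → Prop} (hR : ∀ v w, R v w → R w v) {h : ℕ}
    (hX : 3 * X.card ^ 2 ≤ h ^ 2 * ∑ v ∈ X, partners X R v) :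
    X.card ^ 2 ≤ h * ∑ v ∈ X, min X.card (h * partners X R v) := by
  set N := X.card with hN
  set B := X.filter fun v => N ≤ h * partners X R v with hB
  have hBX : B ⊆ X := Finset.filter_subset _ _
  rw [← Finset.sum_sdiff hBX]
  have e1 : ∑ v ∈ X \ B, min N (h * partners X R v) = h * ∑ v ∈ X \ B, partners X R v := by
    rw [Finset.mul_sum]
    refine Finset.sum_congr rfl fun v hv => min_eq_right ?_
    rw [Finset.mem_sdiff, hB, Finset.mem_filter, not_and] at hv
    exact (not_le.1 (hv.2 hv.1)).le
  have e2 : ∑ v ∈ B, min N (h * partners X R v) = B.card * N := by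
    rw [Finset.sum_congr rfl fun v hv => min_eq_left (Finset.mem_filter.1 hv).2,
      Finset.sum_const, smul_eq_mul]
  have e3 : h * (h * ∑ v ∈ X \ B, partners X R v + B.card * N) =
      h ^ 2 * ∑ v ∈ X \ B, partners X R v + h * B.card * N := by ring
  rw [e1, e2, e3]
  by_cases hc : N ≤ h * B.card
  · have := Nat.mul_le_mul_right N hc
    rw [pow_two]
    omega
  · have h1 := sum_partners_le hBX hR
    have h2 : h ^ 2 * ∑ v ∈ X, partners X R v ≤
        (h * B.card) ^ 2 + 2 * (h ^ 2 * ∑ v ∈ X \ B, partners X R v) := by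
      calc _ ≤ h ^ 2 * (B.card * B.card + 2 * ∑ v ∈ X \ B, partners X R v) :=
            Nat.mul_le_mul_left _ h1
        _ = _ := by ring
    have h3 : (h * B.card) ^ 2 ≤ N ^ 2 := Nat.pow_le_pow_left (by omega) 2
    have h4 := Nat.zero_le (h * B.card * N)
    omega

/-- A few elements are partners of half of all elements, if all elements have many partners. -/
theorem exists_cover {X B : Finset V} (hB : B ⊆ X) {R : V → V → Prop}
    (hR : ∀ v w, R v w → R w v) {h : ℕ} (hdeg : ∀ v ∈ B, X.card ≤ h * partners X R v) :
    ∃ S ⊆ X, S.card ≤ 2 * h ∧ B.card ≤ 2 * (B.filter fun v => ∃ w ∈ S, R v w).card := by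
  rcases B.eq_empty_or_nonempty with rfl | hBne
  · exact ⟨∅, by simp, by simp, by simp⟩
  have hBpos := hBne.card_pos
  have hXpos : 0 < X.card := hBpos.trans_le (Finset.card_le_card hB)
  let cov : Finset V → Finset V := fun S => B.filter fun v => ∃ w ∈ S, R v w
  have hcov : ∀ S, (cov S).card ≤ B.card := fun S => Finset.card_le_card (Finset.filter_subset _ _)
  -- take a largest set that covers `|B| / (2 h)` elements per member
  obtain ⟨S, hS, hmax⟩ := (X.powerset.filter fun S =>
    S.card * B.card ≤ 2 * h * (cov S).card).exists_max_image Finset.card ⟨∅, by simp⟩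
  rw [Finset.mem_filter, Finset.mem_powerset] at hS
  have hS2 : S.card ≤ 2 * h := by
    have := hS.2.trans (Nat.mul_le_mul_left (2 * h) (hcov S))
    exact Nat.le_of_mul_le_mul_right this hBpos
  refine ⟨S, hS.1, hS2, ?_⟩
  change B.card ≤ 2 * (cov S).card
  by_contra hlt
  push Not at hlt
  set U := B \ cov S with hU
  have hUc : U.card + (cov S).card = B.card :=
    Finset.card_sdiff_add_card_eq_card (Finset.filter_subset _ _)
  have hsum : U.card * X.card ≤ ∑ w ∈ X, h * partners U R w := by
    rw [← Finset.mul_sum, ← sum_partners_comm U X hR, Finset.mul_sum, ← smul_eq_mul]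
    exact Finset.card_nsmul_le_sum _ _ _ fun v hv => hdeg v (Finset.mem_sdiff.1 hv).1
  obtain ⟨w, hw, hwU⟩ : ∃ w ∈ X, U.card ≤ h * partners U R w := by
    by_contra hcon
    push Not at hcon
    have : ∑ w ∈ X, h * partners U R w < ∑ _w ∈ X, U.card :=
      Finset.sum_lt_sum_of_nonempty (Finset.card_pos.1 hXpos) hcon
    rw [Finset.sum_const, smul_eq_mul] at this
    nlinarith
  have hcovw : (cov S).card + partners U R w ≤ (cov (insert w S)).card := by
    rw [partners, ← Finset.card_union_of_disjoint]
    · refine Finset.card_le_card (Finset.union_subset (fun v hv => ?_) fun v hv => ?_)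
      · obtain ⟨h1, y, hy, h2⟩ := Finset.mem_filter.1 hv
        exact Finset.mem_filter.2 ⟨h1, y, Finset.mem_insert_of_mem hy, h2⟩
      · obtain ⟨h1, h2⟩ := Finset.mem_filter.1 hv
        exact Finset.mem_filter.2 ⟨(Finset.mem_sdiff.1 h1).1, w, Finset.mem_insert_self _ _,
          hR _ _ h2⟩
    · exact Finset.disjoint_of_subset_right (Finset.filter_subset _ _) Finset.disjoint_sdiff
  have hwS : w ∉ S := by
    intro hwS
    have hpos : 0 < partners U R w := by
      by_contra h0
      have : partners U R w = 0 := by omega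
      rw [this] at hwU
      omega
    rw [Finset.insert_eq_of_mem hwS] at hcovw
    omega
  have := hmax (insert w S) (by
    rw [Finset.mem_filter, Finset.mem_powerset, Finset.card_insert_of_notMem hwS]
    refine ⟨Finset.insert_subset hw hS.1, ?_⟩
    nlinarith [hS.2])
  rw [Finset.card_insert_of_notMem hwS] at this
  omega

end Pairs

end ListColoring

namespace ListColoring

open LoopGraph

/-! ### Reaching a share of a colour class, for three colours -/

section Reaching

open Classical

variable {V : Type*} {G : SimpleGraph V} {f : V → Fin 3}

/-- Some neighbour of `v` has neighbours of two colours in `S`. In a colouring with three colours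
the colours on `S` then determine the colour of that neighbour. -/
def Reached (G : SimpleGraph V) (f : V → Fin 3) (S : Finset V) (v : V) : Prop :=
  ∃ u, G.Adj u v ∧ ∃ z ∈ S, ∃ z' ∈ S, G.Adj u z ∧ G.Adj u z' ∧ f z ≠ f z'

/-- Some vertex of colour `j` is a common neighbour of `v`, `w` and a vertex in `Z`. -/
def Seen (G : SimpleGraph V) (f : V → Fin 3) (j : Fin 3) (Z : Finset V) (v w : V) : Prop :=
  ∃ z ∈ Z, ∃ u, f u = j ∧ G.Adj u v ∧ G.Adj u w ∧ G.Adj u z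

/-- Some vertex of colour `j` is a common neighbour of `v` and `w`. -/
def Linked (G : SimpleGraph V) (f : V → Fin 3) (j : Fin 3) (v w : V) : Prop :=
  ∃ u, f u = j ∧ G.Adj u v ∧ G.Adj u w

theorem Seen.symm {j : Fin 3} {Z : Finset V} {v w : V} (h : Seen G f j Z v w) :
    Seen G f j Z w v := by
  obtain ⟨z, hz, u, h1, h2, h3, h4⟩ := h
  exact ⟨z, hz, u, h1, h3, h2, h4⟩

theorem Seen.mono {j : Fin 3} {Z Z' : Finset V} (hZ : Z ⊆ Z') {v w : V} (h : Seen G f j Z v w) :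
    Seen G f j Z' v w := by
  obtain ⟨z, hz, h⟩ := h
  exact ⟨z, hZ hz, h⟩

theorem partners_eq_sum {X : Finset V} {R : V → V → Prop} {v : V} :
    partners X R v = ∑ w ∈ X, if R v w then 1 else 0 := by
  rw [partners, Finset.card_filter]

/-- Half of all pairs of vertices in a colour class are linked by vertices of one colour. -/
theorem exists_linking_color (hf : ∀ u v, G.Adj u v → f u ≠ f v)
    (hcommon : ∀ u v, u ≠ v → ¬ G.Adj u v → ∃ w, G.Adj u w ∧ G.Adj w v)
    (hnb : ∀ u j, j ≠ f u → ∃ z, G.Adj u z ∧ f z = j) {i : Fin 3} {X : Finset V}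
    (hX : ∀ v ∈ X, f v = i) :
    ∃ j l : Fin 3, j ≠ i ∧ l ≠ i ∧ l ≠ j ∧
      X.card ^ 2 ≤ 2 * ∑ v ∈ X, partners X (Linked G f j) v := by
  have hcol : ∀ i : Fin 3, ∃ j l : Fin 3, j ≠ i ∧ l ≠ i ∧ l ≠ j ∧
      ∀ c, c ≠ i → c = j ∨ c = l := by decide
  obtain ⟨j, l, hj, hl, hlj, hall⟩ := hcol i
  have hpair : ∀ v ∈ X, ∀ w ∈ X, Linked G f j v w ∨ Linked G f l v w := by
    intro v hv w hw
    by_cases hvw : v = w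
    · subst hvw
      obtain ⟨z, hz, hzj⟩ := hnb v j (by rw [hX v hv]; exact hj)
      exact Or.inl ⟨z, hzj, hz.symm, hz.symm⟩
    · obtain ⟨u, hu, hu'⟩ := hcommon v w hvw fun h => hf _ _ h (by rw [hX v hv, hX w hw])
      rcases hall (f u) (by rw [← hX v hv]; exact (hf _ _ hu).symm) with h | h
      · exact Or.inl ⟨u, h, hu.symm, hu'⟩
      · exact Or.inr ⟨u, h, hu.symm, hu'⟩
  have hsum : X.card ^ 2 ≤ ∑ v ∈ X, partners X (Linked G f j) v +
      ∑ v ∈ X, partners X (Linked G f l) v := by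
    rw [← Finset.sum_add_distrib, pow_two, ← smul_eq_mul]
    refine Finset.card_nsmul_le_sum _ _ _ fun v hv => ?_
    refine le_trans ?_ (partners_or_le X _ _ v)
    exact card_le_partners fun w hw => ⟨hw, hpair v hv w hw⟩
  by_cases h : X.card ^ 2 ≤ 2 * ∑ v ∈ X, partners X (Linked G f j) v
  · exact ⟨j, l, hj, hl, hlj, h⟩
  · exact ⟨l, j, hl, hj, hlj.symm, by omega⟩

/-- If few vertices have many partners that are seen by `Z`, then many linked pairs outside are not
seen by `Z`, and some further vertex sees a large share of them. -/
theorem exists_seeing_vertex [Fintype V] {m h : ℕ} (hm : 1 ≤ m) (hh : 8 ≤ h)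
    (hmh : 24 * Fintype.card V ≤ m * h ^ 2)
    (hmin : ∀ u j, j ≠ f u → m ≤ (Finset.univ.filter fun z => G.Adj u z ∧ f z = j).card)
    {j l : Fin 3} (hlj : l ≠ j) {X Z U : Finset V} (hXne : X.Nonempty)
    (hX2 : X.card ^ 2 ≤ 2 * ∑ v ∈ X, partners X (Linked G f j) v) (hUX : U ⊆ X)
    (hU : ∀ v ∈ U, h * partners X (Seen G f j Z) v < X.card)
    (hsat : 8 * (X \ U).card < X.card) :
    ∃ z, f z = l ∧ 3 * X.card ^ 2 ≤ h ^ 2 * ∑ v ∈ X, partners X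
      (fun v w => v ∈ U ∧ w ∈ U ∧ Seen G f j {z} v w ∧ ¬ Seen G f j Z v w) v := by
  set N := X.card with hN
  have hNpos : 0 < N := hXne.card_pos
  let F' : V → V → Prop := fun v w => v ∈ U ∧ w ∈ U ∧ Linked G f j v w ∧ ¬ Seen G f j Z v w
  let Q : V → V → V → Prop := fun z v w =>
    v ∈ U ∧ w ∈ U ∧ Seen G f j {z} v w ∧ ¬ Seen G f j Z v w
  have hF' : N ^ 2 ≤ 8 * ∑ v ∈ X, partners X F' v := by
    have h1 : ∀ v ∈ U, 8 * partners X (Linked G f j) v ≤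
        8 * (X \ U).card + 8 * partners X F' v + N := by
      intro v hv
      have h2 : partners X (Linked G f j) v ≤
          (X \ U).card + partners X F' v + partners X (Seen G f j Z) v := by
        refine (partners_le_card (S := (X \ U ∪ X.filter (F' v)) ∪ X.filter (Seen G f j Z v))
          fun w hwX hw => ?_).trans ?_
        swap
        · have e1 := Finset.card_union_le (X \ U ∪ X.filter (F' v)) (X.filter (Seen G f j Z v))
          have e2 := Finset.card_union_le (X \ U) (X.filter (F' v))
          have e3 : (X.filter (F' v)).card = partners X F' v := by unfold partners; congr!
          have e4 : (X.filter (Seen G f j Z v)).card = partners X (Seen G f j Z) v := by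
            unfold partners; congr!
          omega
        simp only [Finset.mem_union, Finset.mem_sdiff, Finset.mem_filter, hwX, true_and, F', hv,
          hw]
        tauto
      have h3 : 8 * partners X (Seen G f j Z) v ≤ h * partners X (Seen G f j Z) v :=
        Nat.mul_le_mul_right _ hh
      have := hU v hv
      omega
    have h4 : 8 * ∑ v ∈ U, partners X (Linked G f j) v ≤
        U.card * (8 * (X \ U).card + N) + 8 * ∑ v ∈ X, partners X F' v := by
      have h5 : ∑ v ∈ U, partners X F' v ≤ ∑ v ∈ X, partners X F' v :=
        Finset.sum_le_sum_of_subset hUX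
      have h6 : ∑ v ∈ U, 8 * partners X (Linked G f j) v ≤
          ∑ v ∈ U, ((8 * (X \ U).card + N) + 8 * partners X F' v) :=
        Finset.sum_le_sum fun v hv => by have := h1 v hv; omega
      rw [Finset.sum_add_distrib, Finset.sum_const, smul_eq_mul, ← Finset.mul_sum,
        ← Finset.mul_sum] at h6
      omega
    have h7 : ∑ v ∈ X \ U, partners X (Linked G f j) v ≤ (X \ U).card * N := by
      rw [← smul_eq_mul]
      exact Finset.sum_le_card_nsmul _ _ _ fun v _ => partners_le X _ v
    have h8 : U.card + (X \ U).card = N := by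
      rw [add_comm]; exact Finset.card_sdiff_add_card_eq_card hUX
    rw [← Finset.sum_sdiff hUX] at hX2
    have h9 : U.card * (8 * (X \ U).card + N) ≤ N * (8 * (X \ U).card + N) :=
      Nat.mul_le_mul_right _ (by omega)
    nlinarith
  set C := Finset.univ.filter fun z => f z = l with hC
  have hcount : m * ∑ v ∈ X, partners X F' v ≤ ∑ z ∈ C, ∑ v ∈ X, partners X (Q z) v := by
    have h1 : ∀ v w, (if F' v w then m else 0) ≤ ∑ z ∈ C, if Q z v w then 1 else 0 := by
      intro v w
      split_ifs with hF
      · obtain ⟨hv, hw, ⟨u, hu, huv, huw⟩, hns⟩ := hF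
        rw [← Finset.card_filter]
        refine (hmin u l (by rw [hu]; exact hlj)).trans (Finset.card_le_card fun z hz => ?_)
        obtain ⟨-, hz, hzl⟩ := Finset.mem_filter.1 hz
        rw [Finset.mem_filter, hC, Finset.mem_filter]
        exact ⟨⟨Finset.mem_univ _, hzl⟩, hv, hw,
          ⟨z, Finset.mem_singleton_self z, u, hu, huv, huw, hz⟩, hns⟩
      · exact Nat.zero_le _
    calc m * ∑ v ∈ X, partners X F' v = ∑ v ∈ X, ∑ w ∈ X, if F' v w then m else 0 := by
          rw [Finset.mul_sum]
          refine Finset.sum_congr rfl fun v _ => ?_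
          rw [partners_eq_sum, Finset.mul_sum]
          simp
      _ ≤ ∑ v ∈ X, ∑ w ∈ X, ∑ z ∈ C, if Q z v w then 1 else 0 :=
          Finset.sum_le_sum fun v _ => Finset.sum_le_sum fun w _ => h1 v w
      _ = ∑ z ∈ C, ∑ v ∈ X, partners X (Q z) v := by
          simp only [partners_eq_sum]
          rw [Finset.sum_comm (s := C)]
          refine Finset.sum_congr rfl fun v _ => ?_
          rw [Finset.sum_comm]
          congr!
  have hFpos : 0 < ∑ v ∈ X, partners X F' v := by
    have := Nat.pow_pos (n := 2) hNpos
    omega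
  obtain ⟨z, hz, hzQ⟩ : ∃ z ∈ C, m * ∑ v ∈ X, partners X F' v ≤
      Fintype.card V * ∑ v ∈ X, partners X (Q z) v := by
    by_contra hcon
    push Not at hcon
    rcases C.eq_empty_or_nonempty with hCe | hCne
    · rw [hCe, Finset.sum_empty] at hcount
      have := Nat.mul_pos (show 0 < m by omega) hFpos
      omega
    · have h1 := Finset.sum_lt_sum_of_nonempty hCne hcon
      rw [← Finset.mul_sum, Finset.sum_const, smul_eq_mul] at h1
      have h2 : C.card ≤ Fintype.card V := Finset.card_le_univ _
      have h3 := Nat.mul_le_mul_left (Fintype.card V) hcount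
      have h4 := Nat.mul_le_mul_right (m * ∑ v ∈ X, partners X F' v) h2
      omega
  refine ⟨z, (Finset.mem_filter.1 hz).2, ?_⟩
  have hnpos : 0 < Fintype.card V := Fintype.card_pos_iff.2 ⟨z⟩
  refine Nat.le_of_mul_le_mul_left (c := 8 * Fintype.card V) ?_ (by omega)
  calc 8 * Fintype.card V * (3 * N ^ 2) = 24 * Fintype.card V * N ^ 2 := by ring
    _ ≤ m * h ^ 2 * N ^ 2 := Nat.mul_le_mul_right _ hmh
    _ ≤ m * h ^ 2 * (8 * ∑ v ∈ X, partners X F' v) := Nat.mul_le_mul_left _ hF'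
    _ = 8 * h ^ 2 * (m * ∑ v ∈ X, partners X F' v) := by ring
    _ ≤ 8 * h ^ 2 * (Fintype.card V * ∑ v ∈ X, partners X (Q z) v) := Nat.mul_le_mul_left _ hzQ
    _ = _ := by ring

/-- A small set reaches a constant fraction of a colour class `X`. Vertices `z` of the third colour
`l` are collected as long as each of them sees many new pairs, with the contribution of each vertex
to the count capped. In the end many vertices have many partners that are seen by the collected set
`Z`, so a few of these partners, together with `Z`, reach half of those vertices. -/
theorem exists_reaching [Fintype V] (hf : ∀ u v, G.Adj u v → f u ≠ f v)
    (hcommon : ∀ u v, u ≠ v → ¬ G.Adj u v → ∃ w, G.Adj u w ∧ G.Adj w v)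
    {m h : ℕ} (hm : 1 ≤ m) (hh : 8 ≤ h) (hmh : 24 * Fintype.card V ≤ m * h ^ 2)
    (hmin : ∀ u j, j ≠ f u → m ≤ (Finset.univ.filter fun z => G.Adj u z ∧ f z = j).card)
    {i : Fin 3} {X : Finset V} (hX : ∀ v ∈ X, f v = i) (hXne : X.Nonempty) :
    ∃ S : Finset V, S.card ≤ 4 * h ∧ X.card ≤ 16 * (X.filter (Reached G f S)).card := by
  have hnb : ∀ u j, j ≠ f u → ∃ z, G.Adj u z ∧ f z = j := fun u j hj => by
    obtain ⟨z, hz⟩ := Finset.card_pos.1 (lt_of_lt_of_le hm (hmin u j hj))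
    exact ⟨z, (Finset.mem_filter.1 hz).2⟩
  obtain ⟨j, l, hj, hl, hlj, hX2⟩ := exists_linking_color hf hcommon hnb hX
  set N := X.card with hN
  have hNpos : 0 < N := hXne.card_pos
  -- the cap `2 * N` is twice what makes a vertex count as saturated, so a vertex that is not
  -- saturated can still gain up to `N`
  let Ψ : Finset V → ℕ := fun Z => ∑ v ∈ X, min (2 * N) (h * partners X (Seen G f j Z) v)
  have hΨ : ∀ Z, Ψ Z ≤ N * (2 * N) := fun Z => by
    rw [← smul_eq_mul]
    exact Finset.sum_le_card_nsmul _ _ _ fun v _ => min_le_left _ _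
  -- take a largest set of colour `l` that contributes `N ^ 2 / h` to `Ψ` per member
  obtain ⟨Z, hZ, hmax⟩ := ((Finset.univ.filter fun z => f z = l).powerset.filter fun Z =>
    Z.card * N ^ 2 ≤ h * Ψ Z).exists_max_image Finset.card ⟨∅, by simp⟩
  rw [Finset.mem_filter, Finset.mem_powerset] at hZ
  have hZ2 : Z.card ≤ 2 * h := by
    have h1 := hZ.2.trans (Nat.mul_le_mul_left h (hΨ Z))
    have h2 : h * (N * (2 * N)) = 2 * h * N ^ 2 := by ring
    exact Nat.le_of_mul_le_mul_right (h2 ▸ h1) (Nat.pow_pos hNpos)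
  set B := X.filter fun v => N ≤ h * partners X (Seen G f j Z) v with hB
  have hBX : B ⊆ X := Finset.filter_subset _ _
  by_cases hbig : N ≤ 8 * B.card
  · obtain ⟨S, hSX, hS, hcov⟩ := exists_cover hBX (R := Seen G f j Z) (fun _ _ => Seen.symm)
      (h := h) fun v hv => (Finset.mem_filter.1 hv).2
    refine ⟨Z ∪ S, (Finset.card_union_le _ _).trans (by omega), ?_⟩
    have : (B.filter fun v => ∃ w ∈ S, Seen G f j Z v w).card ≤
        (X.filter (Reached G f (Z ∪ S))).card := by
      refine Finset.card_le_card fun v hv => ?_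
      obtain ⟨hvB, w, hw, z, hz, u, -, huv, huw, huz⟩ := Finset.mem_filter.1 hv
      refine Finset.mem_filter.2 ⟨hBX hvB, u, huv, z, Finset.mem_union_left _ hz, w,
        Finset.mem_union_right _ hw, huz, huw, ?_⟩
      rw [hX w (hSX hw), (Finset.mem_filter.1 (hZ.1 hz)).2]
      exact hl
    omega
  · exfalso
    set U := X \ B with hU
    have hXU : X \ U = B := by rw [hU, Finset.sdiff_sdiff_eq_self hBX]
    have hUlt : ∀ v ∈ U, h * partners X (Seen G f j Z) v < N := by
      intro v hv
      rw [hU, Finset.mem_sdiff, hB, Finset.mem_filter, not_and] at hv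
      exact not_le.1 (hv.2 hv.1)
    obtain ⟨z, hzl, hzQ⟩ := exists_seeing_vertex hm hh hmh hmin hlj hXne hX2
      (Finset.sdiff_subset : U ⊆ X) hUlt (by rw [hXU]; omega)
    set Q : V → V → Prop := fun v w =>
      v ∈ U ∧ w ∈ U ∧ Seen G f j {z} v w ∧ ¬ Seen G f j Z v w with hQ
    have hQsymm : ∀ v w, Q v w → Q w v := fun v w hq =>
      ⟨hq.2.1, hq.1, hq.2.2.1.symm, fun hs => hq.2.2.2 hs.symm⟩
    have hcap := capped_sum_ge hQsymm hzQ
    rw [← hN] at hzQ hcap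
    have hzZ : z ∉ Z := by
      intro hzZ
      have h0 : ∑ v ∈ X, partners X Q v = 0 := by
        refine Finset.sum_eq_zero fun v _ => ?_
        exact partners_eq_zero fun w _ hq =>
          hq.2.2.2 (hq.2.2.1.mono (Finset.singleton_subset_iff.2 hzZ))
      rw [h0, Nat.mul_zero] at hzQ
      have := Nat.pow_pos (n := 2) hNpos
      omega
    have hgain : Ψ Z + ∑ v ∈ X, min N (h * partners X Q v) ≤ Ψ (insert z Z) := by
      rw [← Finset.sum_add_distrib]
      refine Finset.sum_le_sum fun v hv => ?_
      by_cases hvU : v ∈ U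
      · have h1 : partners X (Seen G f j Z) v + partners X Q v ≤
            partners X (Seen G f j (insert z Z)) v := by
          rw [← partners_or (R := Seen G f j Z) (R' := Q) fun w _ hs hq => hq.2.2.2 hs]
          refine partners_mono fun w _ hw => ?_
          rcases hw with hw | hw
          · exact hw.mono (Finset.subset_insert _ _)
          · exact hw.2.2.1.mono (by simp)
        have h2 := Nat.mul_le_mul_left h h1
        rw [Nat.mul_add] at h2
        have h3 := hUlt v hvU
        omega
      · have h0 : partners X Q v = 0 := partners_eq_zero fun w _ hq => hvU hq.1
        have h1 := Nat.mul_le_mul_left h (partners_mono (X := X) (v := v)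
          fun w _ (hw : Seen G f j Z v w) => hw.mono (Finset.subset_insert z Z))
        rw [h0, Nat.mul_zero]
        omega
    have := hmax (insert z Z) (by
      rw [Finset.mem_filter, Finset.mem_powerset, Finset.card_insert_of_notMem hzZ]
      refine ⟨Finset.insert_subset (by simp [hzl]) hZ.1, ?_⟩
      have h1 := Nat.mul_le_mul_left h hgain
      rw [Nat.mul_add] at h1
      have h2 := hZ.2
      rw [Nat.add_mul, Nat.one_mul]
      omega)
    rw [Finset.card_insert_of_notMem hzZ] at this
    omega

end Reaching

end ListColoring

namespace ListColoring

open LoopGraph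

/-! ### Certificates from reaching sets -/

section ThreeColors

open Classical

theorem Reached.mono {V : Type*} {G : SimpleGraph V} {f : V → Fin 3} {S S' : Finset V}
    (hS : S ⊆ S') {v : V} (h : Reached G f S v) : Reached G f S' v := by
  obtain ⟨u, hu, z, hz, z', hz', h⟩ := h
  exact ⟨u, hu, z, hS hz, z', hS hz', h⟩

/-- Repeated use of `exists_reaching` for the most frequent colour among the vertices that are not
yet reached: that colour class has a third of these vertices, and a sixteenth of it gets reached. -/
theorem exists_reaching_rounds {V : Type*} [Fintype V] {G : SimpleGraph V} {f : V → Fin 3}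
    (hf : ∀ u v, G.Adj u v → f u ≠ f v)
    (hcommon : ∀ u v, u ≠ v → ¬ G.Adj u v → ∃ w, G.Adj u w ∧ G.Adj w v)
    {m h : ℕ} (hm : 1 ≤ m) (hh : 8 ≤ h) (hmh : 24 * Fintype.card V ≤ m * h ^ 2)
    (hmin : ∀ u j, j ≠ f u → m ≤ (Finset.univ.filter fun z => G.Adj u z ∧ f z = j).card) (r : ℕ) :
    ∃ S : Finset V, S.card ≤ r * (4 * h) ∧
      48 ^ r * (Finset.univ.filter fun v => ¬ Reached G f S v).card ≤ 47 ^ r * Fintype.card V := by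
  induction r with
  | zero => exact ⟨∅, by simp, by simpa using Finset.card_le_univ _⟩
  | succ r ih =>
    obtain ⟨S, hS, hW⟩ := ih
    set W := Finset.univ.filter fun v => ¬ Reached G f S v with hWdef
    obtain ⟨i, hi⟩ : ∃ i : Fin 3, W.card ≤ 3 * (W.filter fun v => f v = i).card := by
      by_contra hcon
      push Not at hcon
      have h1 := Finset.card_eq_sum_card_fiberwise (s := W) (t := Finset.univ) (f := f)
        fun _ _ => Finset.mem_coe.2 (Finset.mem_univ _)
      rw [Fin.sum_univ_three] at h1
      have h2 := hcon 0
      have h3 := hcon 1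
      have h4 := hcon 2
      omega
    rcases (W.filter fun v => f v = i).eq_empty_or_nonempty with hX | hX
    · rw [hX, Finset.card_empty] at hi
      have h0 : W.card = 0 := by omega
      exact ⟨S, hS.trans (Nat.mul_le_mul_right _ (by omega)), by rw [h0]; simp⟩
    · obtain ⟨S', hS', hX'⟩ := exists_reaching hf hcommon hm hh hmh hmin (i := i)
        (fun v hv => (Finset.mem_filter.1 hv).2) hX
      refine ⟨S ∪ S', (Finset.card_union_le _ _).trans ?_, ?_⟩
      · rw [Nat.add_mul, Nat.one_mul]
        omega
      · set X := W.filter fun v => f v = i with hXdef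
        have hsub : (Finset.univ.filter fun v => ¬ Reached G f (S ∪ S') v) ⊆
            W \ X.filter (Reached G f S') := by
          intro v hv
          have hv' := (Finset.mem_filter.1 hv).2
          refine Finset.mem_sdiff.2 ⟨Finset.mem_filter.2 ⟨Finset.mem_univ _, fun hr =>
            hv' (hr.mono Finset.subset_union_left)⟩, fun hr =>
            hv' ((Finset.mem_filter.1 hr).2.mono Finset.subset_union_right)⟩
        have hc := Finset.card_le_card hsub
        have hc2 := Finset.card_sdiff_add_card_eq_card
          (((Finset.filter_subset (Reached G f S') X).trans (Finset.filter_subset _ W)))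
        have h48 : 48 * (Finset.univ.filter fun v => ¬ Reached G f (S ∪ S') v).card ≤
            47 * W.card := by omega
        calc _ = 48 ^ r * (48 * (Finset.univ.filter fun v =>
              ¬ Reached G f (S ∪ S') v).card) := by rw [pow_succ]; ring
          _ ≤ 48 ^ r * (47 * W.card) := Nat.mul_le_mul_left _ h48
          _ = 47 * (48 ^ r * W.card) := by ring
          _ ≤ 47 * (47 ^ r * Fintype.card V) := Nat.mul_le_mul_left _ hW
          _ = _ := by rw [pow_succ]; ring

variable {n : ℕ} {G : SimpleGraph (Fin n)} {H : LoopGraph (Fin 3)} {φ : Fin n → Fin 3}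

/-- The colours of a set that reaches all vertices are decisive. -/
theorem decisive_of_reached (hH : ∀ x y, H.Adj x y ↔ x ≠ y)
    (hφ : ∀ u v, G.Adj u v → H.Adj (φ u) (φ v)) {S : Finset (Fin n)}
    (hS : ∀ v, Reached G φ S v) :
    Decisive G H φ fun v => if v ∈ S then (φ v : ℕ) else 3 := by
  refine ⟨fun v hv => ?_, fun Y hY hAC v => ?_⟩
  · dsimp only at hv ⊢
    split_ifs at hv ⊢ with h
    · rfl
    · omega
  have hYS : ∀ z ∈ S, ∀ c ∈ Y z, c = φ z := fun z hz c hc => by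
    have := hY z c hc
    simp only [if_pos hz] at this
    exact (Fin.ext (this (φ z).2)).symm
  obtain ⟨u, huv, z, hz, z', hz', huz, huz', hne⟩ := hS v
  have hu : ∀ c ∈ Y u, c = φ u := by
    intro c hc
    obtain ⟨b, hb, hcb⟩ := hAC u c hc z huz
    obtain ⟨b', hb', hcb'⟩ := hAC u c hc z' huz'
    rw [hYS z hz b hb, hH] at hcb
    rw [hYS z' hz' b' hb', hH] at hcb'
    have h1 := (hH _ _).1 (hφ _ _ huz)
    have h2 := (hH _ _).1 (hφ _ _ huz')
    generalize φ u = a at *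
    generalize φ z = b at *
    generalize φ z' = b' at *
    omega
  have hsub : Y v ⊆ Finset.univ.erase (φ u) := by
    intro c hc
    obtain ⟨b, hb, hcb⟩ := hAC v c hc u huv.symm
    rw [hu b hb, hH] at hcb
    exact Finset.mem_erase.2 ⟨hcb, Finset.mem_univ _⟩
  refine (Finset.card_le_card hsub).trans ?_
  rw [Finset.card_erase_of_mem (Finset.mem_univ _)]
  simp

/-- Three-colourings have certificates of length `O(n ^ (1/3) log n)`. If all vertices have at least
`t` neighbours of each colour that they may see, then `34 * (l + 1)` rounds, each of which adds
`4 * (8 * t)` vertices, suffice to reach all vertices. -/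
theorem exists_decisive_three (hH : ∀ x y, H.Adj x y ↔ x ≠ y) (hG : G.Connected)
    (hd : G.diam = 2) (hφ : ∀ u v, G.Adj u v → H.Adj (φ u) (φ v)) {t l : ℕ} (ht : n ≤ t ^ 3)
    (hl : n ≤ 2 ^ l) :
    ∃ A, Decisive G H φ A ∧ Obtainable G 3 (1088 * (t * (l + 1))) A := by
  have hn := three_le_of_diam_eq_two hd
  have htpos : 1 ≤ t := by
    rcases Nat.eq_zero_or_pos t with rfl | h
    · simp at ht; omega
    · exact h
  have hK : t ≤ 1088 * (t * (l + 1)) := by nlinarith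
  have hf : ∀ u v, G.Adj u v → φ u ≠ φ v := fun u v h => (hH _ _).1 (hφ u v h)
  have hdeg : ∀ x, (H.neighborSet x).ncard ≤ 2 := by
    intro x
    have hs : H.neighborSet x = ((Finset.univ.erase x : Finset (Fin 3)) : Set (Fin 3)) := by
      ext y
      simp [neighborSet, hH, eq_comm]
    rw [hs, Set.ncard_coe_finset, Finset.card_erase_of_mem (Finset.mem_univ _)]
    simp
  by_cases hmin : ∀ u j, j ≠ φ u →
      t ≤ (Finset.univ.filter fun z => G.Adj u z ∧ φ z = j).card
  · obtain ⟨S, hS, hW⟩ := exists_reaching_rounds hf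
      (fun u v h h' => exists_common_neighbor hG hd h h') htpos (h := 8 * t) (by omega)
      (by rw [Fintype.card_fin]; nlinarith) hmin (34 * (l + 1))
    refine ⟨_, decisive_of_reached hH hφ (S := S) fun v => ?_,
      (Obtainable.zero.finset S φ).mono (by rw [zero_add]; refine hS.trans (le_of_eq ?_); ring)⟩
    by_contra hv
    have hpos : 1 ≤ (Finset.univ.filter fun v => ¬ Reached G φ S v).card :=
      Finset.card_pos.2 ⟨v, Finset.mem_filter.2 ⟨Finset.mem_univ _, hv⟩⟩
    rw [Fintype.card_fin] at hW
    -- thirty-four rounds halve the number of vertices that are not reached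
    have h34 : 2 ^ (l + 1) * 47 ^ (34 * (l + 1)) ≤ 48 ^ (34 * (l + 1)) := by
      rw [pow_mul, pow_mul, ← mul_pow]
      exact Nat.pow_le_pow_left (by norm_num) _
    have h1 : 48 ^ (34 * (l + 1)) ≤ 47 ^ (34 * (l + 1)) * 2 ^ l :=
      calc 48 ^ (34 * (l + 1)) = 48 ^ (34 * (l + 1)) * 1 := (Nat.mul_one _).symm
        _ ≤ _ := Nat.mul_le_mul_left _ hpos
        _ ≤ _ := hW
        _ ≤ _ := Nat.mul_le_mul_left _ hl
    have h2 : 0 < 47 ^ (34 * (l + 1)) * 2 ^ l := by positivity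
    rw [pow_succ] at h34
    have h3 : 2 ^ l * 2 * 47 ^ (34 * (l + 1)) = 2 * (47 ^ (34 * (l + 1)) * 2 ^ l) := by ring
    omega
  · -- a vertex with few neighbours of some colour: colour all its neighbours
    push Not at hmin
    obtain ⟨u, j, hj, hlt⟩ := hmin
    have hthird : ∀ a b : Fin 3, b ≠ a → ∃ c : Fin 3, ∀ d, d ≠ a → d ≠ b → d = c := by decide
    obtain ⟨c, hc⟩ := hthird _ _ hj
    refine ⟨_, decisive_of_dominating hdeg (fun v hv => ?_) fun v => ?_,
      ((Obtainable.zero.nbrs u c).finset (Finset.univ.filter fun z => G.Adj u z ∧ φ z = j)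
        φ).mono (by omega)⟩
    · split_ifs at hv ⊢ with h1 h2
      · rfl
      · rw [hc (φ v) (hf _ _ h2) fun hvj => h1 (by simp [h2.symm, hvj])]
      · omega
    · have hnb : ∀ w, G.Adj w u → (if w ∈ Finset.univ.filter fun z => G.Adj u z ∧ φ z = j then
          (φ w : ℕ) else if G.Adj w u then (c : ℕ) else 3) < 3 := by
        intro w hw
        rw [if_pos hw]
        split_ifs
        · exact (φ w).2
        · exact c.2
      by_cases hv : G.Adj v u
      · exact Or.inl (hnb v hv)
      · right
        by_cases hvu : v = u
        · obtain ⟨w, hw⟩ := exists_neighbor hG hd v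
          exact ⟨w, hw, hnb w (hvu ▸ hw.symm)⟩
        · obtain ⟨w, hw, hw'⟩ := exists_common_neighbor hG hd hvu hv
          exact ⟨w, hw, hnb w hw'⟩

end ThreeColors

end ListColoring

namespace ListColoring

open LoopGraph

/-! ### Greedy dominating sets -/

section Domination

open Classical

variable {n : ℕ} {G : SimpleGraph (Fin n)}

/-- The closed neighbourhood of a vertex. -/
noncomputable def closedNeighbors (G : SimpleGraph (Fin n)) (v : Fin n) : Finset (Fin n) :=
  Finset.univ.filter fun w => v = w ∨ G.Adj v w

/-- The vertices that are not in the closed neighbourhood of a vertex in `D`. -/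
noncomputable def undominated (G : SimpleGraph (Fin n)) (D : Finset (Fin n)) : Finset (Fin n) :=
  Finset.univ.filter fun w => ∀ v ∈ D, w ∉ closedNeighbors G v

theorem mem_closedNeighbors {v w : Fin n} : w ∈ closedNeighbors G v ↔ v = w ∨ G.Adj v w := by
  simp [closedNeighbors]

theorem mem_undominated {D : Finset (Fin n)} {w : Fin n} :
    w ∈ undominated G D ↔ ∀ v ∈ D, w ∉ closedNeighbors G v := by
  simp [undominated]

theorem closedNeighbors_comm {v w : Fin n} :
    w ∈ closedNeighbors G v ↔ v ∈ closedNeighbors G w := by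
  simp [closedNeighbors, eq_comm, G.adj_comm]

theorem undominated_insert (D : Finset (Fin n)) (v : Fin n) :
    undominated G (insert v D) = undominated G D \ closedNeighbors G v := by
  ext w
  simp only [mem_undominated, Finset.mem_insert, forall_eq_or_imp, Finset.mem_sdiff]
  tauto

/-- A vertex that dominates as many new vertices as possible dominates at least the share `s / n`
of them, if `s` is at most the size of all closed neighbourhoods. -/
theorem card_undominated_insert {D : Finset (Fin n)} {v : Fin n} {s : ℕ}
    (hs : ∀ w, s ≤ (closedNeighbors G w).card)
    (hv : ∀ w, (undominated G D ∩ closedNeighbors G w).card ≤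
      (undominated G D ∩ closedNeighbors G v).card) :
    n * (undominated G (insert v D)).card ≤ (n - s) * (undominated G D).card := by
  set U := undominated G D with hU
  have h1 : (undominated G (insert v D)).card + (U ∩ closedNeighbors G v).card = U.card := by
    rw [undominated_insert, ← hU]
    exact Finset.card_sdiff_add_card_inter _ _
  have h2 : U.card * s ≤ n * (U ∩ closedNeighbors G v).card := by
    calc U.card * s ≤ ∑ w ∈ U, (closedNeighbors G w).card := by
          rw [← smul_eq_mul]
          exact Finset.card_nsmul_le_sum _ _ _ fun w _ => hs w
      _ = ∑ w ∈ U, ∑ x, if w ∈ closedNeighbors G x then 1 else 0 := by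
          refine Finset.sum_congr rfl fun w _ => ?_
          rw [← Finset.card_filter]
          congr 1
          ext x
          rw [Finset.mem_filter, closedNeighbors_comm]
          simp
      _ = ∑ x, (U ∩ closedNeighbors G x).card := by
          rw [Finset.sum_comm]
          refine Finset.sum_congr rfl fun x _ => ?_
          rw [← Finset.card_filter, Finset.filter_mem_eq_inter]
      _ ≤ ∑ _x : Fin n, (U ∩ closedNeighbors G v).card := Finset.sum_le_sum fun x _ => hv x
      _ = _ := by simp
  rw [Nat.sub_mul]
  have h3 : n * (undominated G (insert v D)).card + n * (U ∩ closedNeighbors G v).card =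
      n * U.card := by rw [← Nat.mul_add, h1]
  have h4 : U.card * s = s * U.card := Nat.mul_comm _ _
  omega

/-- What is known after `i` rounds of the greedy procedure, if `s` is at most the size of all
closed neighbourhoods. -/
def GreedyInv (G : SimpleGraph (Fin n)) (s i : ℕ) (D : Finset (Fin n)) : Prop :=
  (undominated G D = ∅ ∨ (D.card ≤ i ∧ (undominated G D).card * n ^ i ≤ n * (n - s) ^ i ∧
    (undominated G D).card + i ≤ n)) ∧ ∃ j, D.card ≤ j + 1 ∧ n ^ j ≤ n * (n - s) ^ j

theorem greedyInv_empty {s : ℕ} (hn : 0 < n) : GreedyInv G s 0 ∅ := by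
  have : (undominated G (∅ : Finset (Fin n))).card ≤ n := by
    simpa using Finset.card_le_univ (undominated G (∅ : Finset (Fin n)))
  exact ⟨Or.inr ⟨by simp, by simpa using this, by simpa using this⟩, 0, by simp, by simp; omega⟩

theorem GreedyInv.next {s i : ℕ} {D : Finset (Fin n)} {v : Fin n}
    (hs : ∀ w, s ≤ (closedNeighbors G w).card)
    (hv : ∀ w, (undominated G D ∩ closedNeighbors G w).card ≤
      (undominated G D ∩ closedNeighbors G v).card) (hne : (undominated G D).Nonempty)
    (h : GreedyInv G s i D) : GreedyInv G s (i + 1) (insert v D) := by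
  obtain ⟨h1, h2, h3⟩ := h.1.resolve_left hne.ne_empty
  have hc := Finset.card_insert_le v D
  have hpos := hne.card_pos
  refine ⟨Or.inr ⟨by omega, ?_, ?_⟩, i, by omega, ?_⟩
  · calc (undominated G (insert v D)).card * n ^ (i + 1)
        = n * (undominated G (insert v D)).card * n ^ i := by rw [pow_succ]; ring
      _ ≤ (n - s) * (undominated G D).card * n ^ i :=
          Nat.mul_le_mul_right _ (card_undominated_insert hs hv)
      _ = (n - s) * ((undominated G D).card * n ^ i) := by ring
      _ ≤ (n - s) * (n * (n - s) ^ i) := Nat.mul_le_mul_left _ h2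
      _ = _ := by rw [pow_succ]; ring
  · obtain ⟨w, hw⟩ := hne
    have hw1 : 0 < (undominated G D ∩ closedNeighbors G w).card :=
      Finset.card_pos.2 ⟨w, Finset.mem_inter.2 ⟨hw, mem_closedNeighbors.2 (Or.inl rfl)⟩⟩
    have hw2 := hv w
    have : (undominated G (insert v D)).card + (undominated G D ∩ closedNeighbors G v).card =
        (undominated G D).card := by
      rw [undominated_insert]
      exact Finset.card_sdiff_add_card_inter _ _
    omega
  · exact (Nat.le_mul_of_pos_left _ hpos).trans h2

theorem GreedyInv.of_dominating {s i i' : ℕ} {D : Finset (Fin n)} (h : GreedyInv G s i D)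
    (hD : undominated G D = ∅) : GreedyInv G s i' D := ⟨Or.inl hD, h.2⟩

theorem GreedyInv.dominating {s : ℕ} {D : Finset (Fin n)} (h : GreedyInv G s n D) :
    undominated G D = ∅ := by
  rcases h.1 with h | ⟨-, -, h⟩
  · exact h
  · rw [← Finset.card_eq_zero]; omega

theorem undominated_closedNeighbors (hG : G.Connected) (hd : G.diam = 2) (v : Fin n) :
    undominated G (closedNeighbors G v) = ∅ := by
  rw [Finset.eq_empty_iff_forall_notMem]
  intro w hw
  rw [mem_undominated] at hw
  by_cases hvw : w ∈ closedNeighbors G v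
  · exact hw w hvw (mem_closedNeighbors.2 (Or.inl rfl))
  · rw [mem_closedNeighbors, not_or] at hvw
    obtain ⟨u, hu, hu'⟩ := exists_common_neighbor hG hd hvw.1 hvw.2
    exact hw u (mem_closedNeighbors.2 (Or.inr hu)) (mem_closedNeighbors.2 (Or.inr hu'))

end Domination

end ListColoring

namespace RAM

open LoopGraph ListColoring

/-! ### Greedy dominating sets as commands -/

section Greedy

open Classical

variable {n k : ℕ} {G : SimpleGraph (Fin n)} {L : Fin n → Finset (Fin k)} {Γ : Env} {σ : Store}

/-- The number of vertices with a property. -/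
def Expr.count (v : ℕ) (c : Expr) : Expr := .sum 0 v (.cond c (.const 1) (.const 0))

theorem Expr.eval_count (hn : Γ.param 0 = n) (v : ℕ) (c : Expr) :
    (Expr.count v c).eval Γ σ =
      (Finset.univ.filter fun u : Fin n => c.Holds Γ (σ.set v u)).card := by
  rw [Expr.count, Expr.eval, hn, Finset.card_filter, ← Fin.sum_univ_eq_sum_range
    (fun i => (Expr.cond c (.const 1) (.const 0)).eval Γ (σ.set v i))]
  exact Finset.sum_congr rfl fun u _ => by rw [Expr.eval_cond]; rfl

/-- The set of vertices whose entry in array `3` is not zero. -/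
noncomputable def flagged (n : ℕ) (σ : Store) : Finset (Fin n) :=
  Finset.univ.filter fun v => σ.arr 3 v ≠ 0

theorem mem_flagged {v : Fin n} : v ∈ flagged n σ ↔ σ.arr 3 v ≠ 0 := by simp [flagged]

theorem flagged_congr {τ : Store} (h : τ.arr 3 = σ.arr 3) : flagged n τ = flagged n σ := by
  rw [flagged, h, flagged]

/-- `w` is in the closed neighbourhood of `v`. -/
def Expr.near (v w : ℕ) : Expr := .or (.eq (.var v) (.var w)) (.adj (.var v) (.var w))

theorem holds_near (hΓ : IsInstance Γ G L) (hσ : HasRows n σ) {a b : ℕ} (v w : Fin n)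
    (ha : σ.var a = v) (hb : σ.var b = w) :
    (Expr.near a b).Holds Γ σ ↔ w ∈ closedNeighbors G v := by
  rw [Expr.near, Expr.holds_or, Expr.holds_eq,
    holds_adj hΓ hσ v w (by simp [Expr.eval, ha]) (by simp [Expr.eval, hb]), mem_closedNeighbors]
  simp [Expr.eval, ha, hb, Fin.ext_iff]

/-- The vertex in variable `w` is not dominated by the flagged vertices. -/
def Expr.undom (w : ℕ) : Expr := .not (.ex 0 12 (.and (.arr 3 (.var 12)) (.near 12 w)))

theorem holds_undom (hΓ : IsInstance Γ G L) (hσ : HasRows n σ) {a : ℕ} (ha : a ≠ 12) (w : Fin n)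
    (hw : σ.var a = w) : (Expr.undom a).Holds Γ σ ↔ w ∈ undominated G (flagged n σ) := by
  rw [Expr.undom, Expr.holds_not, holds_ex_vertex hΓ.vertices, mem_undominated, not_exists]
  refine forall_congr' fun v => ?_
  rw [Expr.holds_and, holds_near hΓ (σ := σ.set 12 v) hσ v w (by simp) (by simp [ha, hw]),
    mem_flagged, not_and]
  exact imp_congr_left (by simp [Expr.holds_arr, Expr.eval])

/-- If there are undominated vertices, then flag a vertex that dominates as many of them as
possible. -/
def greedyCmd : Cmd :=
  .ite (.ex 0 10 (.undom 10))
    (.seq (.map 1 10 (.count 11 (.and (.undom 11) (.near 10 11))))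
      (.seq (.assign 3 (.const 0))
        (.seq
          (.forTo 0 4 (.ite (.lt (.arr 1 (.var 3)) (.arr 1 (.var 4))) (.assign 3 (.var 4)) .skip))
          (.store 3 (.var 3) (.const 1)))))
    .skip

theorem greedyCmd_keepsArr : greedyCmd.KeepsArr 0 := by
  simp [greedyCmd, Cmd.KeepsArr, Cmd.skip]

theorem greedyCmd_spec (hΓ : IsInstance Γ G L) (hσ : HasRows n σ) :
    (undominated G (flagged n σ) = ∅ ∧ flagged n (greedyCmd.eval Γ σ) = flagged n σ) ∨
      (undominated G (flagged n σ)).Nonempty ∧ ∃ v,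
        flagged n (greedyCmd.eval Γ σ) = insert v (flagged n σ) ∧
        ∀ w, (undominated G (flagged n σ) ∩ closedNeighbors G w).card ≤
          (undominated G (flagged n σ) ∩ closedNeighbors G v).card := by
  set U := undominated G (flagged n σ) with hU
  have hex : (Expr.ex 0 10 (.undom 10)).Holds Γ σ ↔ U.Nonempty := by
    rw [holds_ex_vertex hΓ.vertices]
    exact exists_congr fun w => holds_undom hΓ (σ := σ.set 10 w) hσ (by decide) w (by simp)
  rcases U.eq_empty_or_nonempty with hUe | hUne
  · left
    refine ⟨hUe, ?_⟩
    rw [greedyCmd, Cmd.eval_ite_neg (by rw [hex, hUe]; simp)]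
    rfl
  · right
    refine ⟨hUne, ?_⟩
    rw [greedyCmd, Cmd.eval_ite_pos (hex.2 hUne), Cmd.eval_seq, Cmd.eval_seq, Cmd.eval_seq]
    set σ₁ := (Cmd.map 1 10 (.count 11 (.and (.undom 11) (.near 10 11)))).eval Γ σ with hσ₁
    have hgain : ∀ v : Fin n, σ₁.arr 1 v = (U ∩ closedNeighbors G v).card := by
      intro v
      rw [hσ₁, Cmd.eval_map _ _ (by rw [hΓ.vertices]; exact v.2)]
      · rw [Expr.eval_count hΓ.vertices]
        congr 1
        ext w
        have hrow : HasRows n ((σ.set 10 v).set 11 w) := hσ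
        rw [Finset.mem_filter, Finset.mem_inter, Expr.holds_and,
          holds_undom hΓ hrow (by decide) w (by simp), holds_near hΓ hrow v w (by simp) (by simp)]
        simp only [Finset.mem_univ, true_and]
        exact Iff.rfl
      · simp [Expr.count, Expr.and, Expr.undom, Expr.near, Expr.or, Expr.eq, Expr.not, Expr.ex,
          Expr.adj, Expr.NoArr]
    have hf₁ : σ₁.arr 3 = σ.arr 3 := Cmd.eval_arr _ (by simp) _
    have hnpos : 0 < n := hUne.choose.pos
    let I : ℕ → Store → Prop := fun i τ => τ.arr = σ₁.arr ∧ τ.var 3 < n ∧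
      ∀ j < i, σ₁.arr 1 j ≤ σ₁.arr 1 (τ.var 3)
    have hI : I n ((Cmd.forTo 0 4 (.ite (.lt (.arr 1 (.var 3)) (.arr 1 (.var 4)))
        (.assign 3 (.var 4)) .skip)).eval Γ ((Cmd.assign 3 (.const 0)).eval Γ σ₁)) := by
      rw [Cmd.eval_for, hΓ.vertices]
      refine iter_induction I ⟨rfl, by simpa [Cmd.eval_assign, Expr.eval] using hnpos,
        fun j hj => absurd hj (by omega)⟩ ?_
      rintro i hi τ ⟨g1, g2, g3⟩
      by_cases hc : (Expr.lt (.arr 1 (.var 3)) (.arr 1 (.var 4))).Holds Γ (τ.set 4 i)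
      · rw [Cmd.eval_ite_pos hc]
        simp only [Expr.holds_lt, Expr.eval, Store.set_arr, Store.set_var, g1] at hc
        refine ⟨g1, by simpa [Cmd.eval_assign, Expr.eval] using hi, fun j hj => ?_⟩
        simp only [Cmd.eval_assign, Expr.eval, Store.set_var, if_true]
        rcases Nat.lt_succ_iff_lt_or_eq.1 hj with hj | rfl
        · have := g3 j hj
          simp at hc
          omega
        · exact le_rfl
      · rw [Cmd.eval_ite_neg hc]
        simp only [Expr.holds_lt, Expr.eval, Store.set_arr, Store.set_var, g1] at hc
        refine ⟨g1, by simpa [Cmd.skip, Cmd.eval_assign] using g2, fun j hj => ?_⟩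
        have hv : (Cmd.skip.eval Γ (τ.set 4 i)).var 3 = τ.var 3 := by
          simp [Cmd.skip, Cmd.eval_assign]
        rw [hv]
        rcases Nat.lt_succ_iff_lt_or_eq.1 hj with hj | rfl
        · exact g3 j hj
        · simpa using hc
    set σ₂ := (Cmd.forTo 0 4 (.ite (.lt (.arr 1 (.var 3)) (.arr 1 (.var 4)))
        (.assign 3 (.var 4)) .skip)).eval Γ ((Cmd.assign 3 (.const 0)).eval Γ σ₁) with hσ₂
    obtain ⟨g1, g2, g3⟩ := hI
    refine ⟨⟨σ₂.var 3, g2⟩, ?_, fun w => ?_⟩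
    · ext w
      rw [mem_flagged, Finset.mem_insert, mem_flagged, Cmd.eval]
      simp only [Expr.eval, Store.put, Function.update_self, g1, hf₁, Function.update_apply,
        Fin.ext_iff]
      by_cases hw : (w : ℕ) = σ₂.var 3 <;> simp [hw]
    · rw [← hgain, ← hgain]
      exact g3 w w.2

/-- If some closed neighbourhood has fewer vertices than there are flagged ones, then flag the
vertices of that neighbourhood instead. -/
def improveCmd : Cmd :=
  .forTo 0 5 (.ite (.lt (.count 10 (.near 5 10)) (.count 10 (.arr 3 (.var 10))))
    (.map 3 10 (.near 5 10)) .skip)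

theorem improveCmd_keepsArr : improveCmd.KeepsArr 0 := by
  simp [improveCmd, Cmd.KeepsArr, Cmd.skip]

theorem improveCmd_spec (hG : G.Connected) (hd : G.diam = 2) (hΓ : IsInstance Γ G L)
    (hσ : HasRows n σ) (hdom : undominated G (flagged n σ) = ∅) :
    undominated G (flagged n (improveCmd.eval Γ σ)) = ∅ ∧
      (flagged n (improveCmd.eval Γ σ)).card ≤ (flagged n σ).card ∧
      ∀ v, (flagged n (improveCmd.eval Γ σ)).card ≤ (closedNeighbors G v).card := by
  let I : ℕ → Store → Prop := fun i τ => HasRows n τ ∧ undominated G (flagged n τ) = ∅ ∧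
    (flagged n τ).card ≤ (flagged n σ).card ∧
    ∀ v : Fin n, (v : ℕ) < i → (flagged n τ).card ≤ (closedNeighbors G v).card
  have hI : I n (improveCmd.eval Γ σ) := by
    rw [improveCmd, Cmd.eval_for, hΓ.vertices]
    refine iter_induction I ⟨hσ, hdom, le_rfl, fun v hv => absurd hv (by omega)⟩ ?_
    rintro i hi τ ⟨g1, g2, g3, g4⟩
    have e1 : (Expr.count 10 (.near 5 10)).eval Γ (τ.set 5 i) =
        (closedNeighbors G ⟨i, hi⟩).card := by
      rw [Expr.eval_count hΓ.vertices]
      congr 1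
      ext w
      rw [Finset.mem_filter, holds_near hΓ (σ := (τ.set 5 i).set 10 w) g1 ⟨i, hi⟩ w (by simp)
        (by simp)]
      simp
    have e2 : (Expr.count 10 (.arr 3 (.var 10))).eval Γ (τ.set 5 i) = (flagged n τ).card := by
      rw [Expr.eval_count hΓ.vertices]
      congr 1
      ext w
      rw [Finset.mem_filter, mem_flagged, Expr.holds_arr]
      simp [Expr.eval]
    by_cases hc : (closedNeighbors G ⟨i, hi⟩).card < (flagged n τ).card
    · rw [Cmd.eval_ite_pos (by rw [Expr.holds_lt, e1, e2]; exact hc)]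
      have hfl : flagged n ((Cmd.map 3 10 (.near 5 10)).eval Γ (τ.set 5 i)) =
          closedNeighbors G ⟨i, hi⟩ := by
        ext w
        rw [mem_flagged, Cmd.eval_map _ _ (by rw [hΓ.vertices]; exact w.2)]
        · exact holds_near hΓ (σ := (τ.set 5 i).set 10 w) g1 ⟨i, hi⟩ w (by simp) (by simp)
        · simp [Expr.near, Expr.or, Expr.eq, Expr.not, Expr.adj, Expr.NoArr]
      refine ⟨fun u hu => ?_, ?_, ?_, fun v hv => ?_⟩
      · rw [Cmd.eval_arr _ (by simp)]
        exact g1 u hu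
      · rw [hfl, undominated_closedNeighbors hG hd]
      · rw [hfl]; omega
      · rw [hfl]
        rcases Nat.lt_succ_iff_lt_or_eq.1 hv with hv | hv
        · have := g4 v hv
          omega
        · have : v = ⟨i, hi⟩ := Fin.ext hv
          rw [this]
    · rw [Cmd.eval_ite_neg (by rw [Expr.holds_lt, e1, e2]; exact hc)]
      refine ⟨g1, g2, g3, fun v hv => ?_⟩
      change (flagged n τ).card ≤ _
      rcases Nat.lt_succ_iff_lt_or_eq.1 hv with hv | hv
      · exact g4 v hv
      · have : v = ⟨i, hi⟩ := Fin.ext hv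
        rw [this]
        omega
  exact ⟨hI.2.1, hI.2.2.1, fun v => hI.2.2.2 v v.2⟩

/-- Flag a small dominating set. -/
def dominateCmd : Cmd :=
  .seq rowsCmd (.seq (.map 3 10 (.const 0)) (.seq (.forTo 0 2 greedyCmd) improveCmd))

theorem dominateCmd_spec (hG : G.Connected) (hd : G.diam = 2) (hΓ : IsInstance Γ G L)
    (σ : Store) : HasRows n (dominateCmd.eval Γ σ) ∧
      undominated G (flagged n (dominateCmd.eval Γ σ)) = ∅ ∧
      ∃ j, (flagged n (dominateCmd.eval Γ σ)).card ≤ j + 1 ∧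
        n ^ j ≤ n * (n - (flagged n (dominateCmd.eval Γ σ)).card) ^ j := by
  have hn : 0 < n := hG.nonempty.some.pos
  rw [dominateCmd, Cmd.eval_seq, Cmd.eval_seq, Cmd.eval_seq]
  set σ₁ := (Cmd.map 3 10 (.const 0)).eval Γ (rowsCmd.eval Γ σ) with hσ₁
  have hr₁ : HasRows n σ₁ := by
    intro u hu
    rw [hσ₁, Cmd.eval_arr _ (by simp)]
    exact rowsCmd_spec hΓ.vertices σ u hu
  have hf₁ : flagged n σ₁ = ∅ := by
    rw [Finset.eq_empty_iff_forall_notMem]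
    intro v
    rw [mem_flagged, hσ₁, Cmd.eval_map (by trivial) _ (by rw [hΓ.vertices]; exact v.2)]
    simp [Expr.eval]
  set σ₂ := (Cmd.forTo 0 2 greedyCmd).eval Γ σ₁ with hσ₂
  have h₂ : ∀ s, (∀ w, s ≤ (closedNeighbors G w).card) →
      HasRows n σ₂ ∧ GreedyInv G s n (flagged n σ₂) := by
    intro s hs
    rw [hσ₂, Cmd.eval_for, hΓ.vertices]
    refine iter_induction (fun i τ => HasRows n τ ∧ GreedyInv G s i (flagged n τ))
      ⟨hr₁, by rw [hf₁]; exact greedyInv_empty hn⟩ ?_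
    rintro i hi τ ⟨g1, g2⟩
    refine ⟨fun u hu => ?_, ?_⟩
    · rw [Cmd.eval_arr _ greedyCmd_keepsArr]
      exact g1 u hu
    · rcases greedyCmd_spec (σ := τ.set 2 i) hΓ g1 with ⟨h1, h2⟩ | ⟨h1, v, h2, h3⟩
      · rw [h2]
        exact g2.of_dominating h1
      · rw [h2]
        exact g2.next hs h3 h1
  obtain ⟨hr₂, hg₂⟩ := h₂ 0 fun _ => Nat.zero_le _
  obtain ⟨h1, h2, h3⟩ := improveCmd_spec hG hd hΓ hr₂ hg₂.dominating
  refine ⟨fun u hu => ?_, h1, ?_⟩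
  · rw [Cmd.eval_arr _ improveCmd_keepsArr]
    exact hr₂ u hu
  · obtain ⟨j, hj, hj'⟩ := (h₂ _ h3).2.2
    exact ⟨j, h2.trans hj, hj'⟩

end Greedy

end RAM

namespace RAM

open LoopGraph ListColoring

/-! ### Colouring a dominating set -/

section Domination

open Classical

variable {n k : ℕ} {G : SimpleGraph (Fin n)} {L : Fin n → Finset (Fin k)} {Γ : Env} {σ : Store}

/-- The number whose digits in base `k`, the least significant one first, are the values of `ψ` at
those of the numbers `i, …, i + r - 1` that satisfy `p`. -/
noncomputable def code (k : ℕ) (p : ℕ → Prop) (ψ : ℕ → ℕ) : ℕ → ℕ → ℕ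
  | 0, _ => 0
  | r + 1, i => if p i then ψ i + k * code k p ψ r (i + 1) else code k p ψ r (i + 1)

theorem code_lt {p : ℕ → Prop} {ψ : ℕ → ℕ} (r i : ℕ) (hψ : ∀ j < i + r, ψ j < k) :
    code k p ψ r i < ∏ j ∈ Finset.range r, if p (i + j) then k else 1 := by
  induction r generalizing i with
  | zero => simp [code]
  | succ r ih =>
    have h := ih (i + 1) fun j hj => hψ j (by omega)
    have e : (∏ j ∈ Finset.range r, if p (i + (j + 1)) then k else 1) =
        ∏ j ∈ Finset.range r, if p (i + 1 + j) then k else 1 :=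
      Finset.prod_congr rfl fun j _ => by rw [show i + (j + 1) = i + 1 + j by omega]
    rw [Finset.prod_range_succ', code, e]
    by_cases hp : p i
    · simp only [Nat.add_zero, hp, if_true]
      have := hψ i (by omega)
      nlinarith
    · simpa [hp] using h

theorem prod_flagged : (∏ j ∈ Finset.range n, if σ.arr 3 j ≠ 0 then k else 1) =
    k ^ (flagged n σ).card := by
  rw [← Fin.prod_univ_eq_prod_range (fun j => if σ.arr 3 j ≠ 0 then k else 1), flagged,
    ← Finset.prod_filter, Finset.prod_const]

/-- Give the flagged vertices the colours that are encoded in variable `2`, and complete the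
partial colouring. -/
noncomputable def colorCmd (H : LoopGraph (Fin k)) : Cmd :=
  .seq (.assign 3 (.var 2)) (.seq
    (.forTo 0 4 (.ite (.arr 3 (.var 4))
      (.seq (.assign 5 (.sum 6 20 (.cond (.lt (.var 3) (.smul (.add (.var 20) (.const 1)) k))
          (.const 0) (.const 1))))
        (.seq (.store 1 (.var 4) (.sub (.var 3) (.smul (.var 5) k))) (.assign 3 (.var 5))))
      (.store 1 (.var 4) (.const k))))
    (completeCmd H))

theorem colorCmd_keepsArr (H : LoopGraph (Fin k)) {a : ℕ} (ha : a ≠ 1) (ha' : a < 4) :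
    (colorCmd H).KeepsArr a := by
  simp only [colorCmd, Cmd.KeepsArr, completeCmd_keepsArr H ha', true_and, and_true]
  omega

theorem colorCmd_sound (H : LoopGraph (Fin k)) (hΓ : IsInstance Γ G L) (hσ : HasRows n σ) :
    ((colorCmd H).eval Γ σ).var 0 = σ.var 0 ∨
      ((colorCmd H).eval Γ σ).var 0 = 1 ∧ ∃ φ, IsListHom G L H φ := by
  rw [colorCmd, Cmd.eval_seq, Cmd.eval_seq]
  rw [completeCmd_spec H hΓ]
  · split_ifs with h
    · exact Or.inr ⟨rfl, h.exists_isListHom⟩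
    · left
      rw [Cmd.eval_var _ (by simp [Cmd.KeepsVar]), Cmd.eval_var _ (by simp [Cmd.KeepsVar])]
  · intro u hu
    rw [Cmd.eval_arr _ (by simp [Cmd.KeepsArr]), Cmd.eval_arr _ (by simp [Cmd.KeepsArr]), hσ u hu]

theorem colorCmd_complete (H : LoopGraph (Fin k)) (hdeg : ∀ x, (H.neighborSet x).ncard ≤ 2)
    (hΓ : IsInstance Γ G L) (hdom : undominated G (flagged n σ) = ∅)
    (hM : Γ.param 6 = k ^ (flagged n σ).card) {φ : Fin n → Fin k} (hφ : IsListHom G L H φ) :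
    ∃ x < Γ.param 6, ∀ ρ : Store, HasRows n ρ → ρ.arr 3 = σ.arr 3 → ρ.var 2 = x →
      ((colorCmd H).eval Γ ρ).var 0 = 1 := by
  let ψ : ℕ → ℕ := fun i => if h : i < n then φ ⟨i, h⟩ else 0
  have hψ : ∀ j < n, ψ j < k := fun j hj => by
    simp only [ψ, dif_pos hj]
    exact (φ ⟨j, hj⟩).2
  have hψφ : ∀ v : Fin n, ψ v = φ v := fun v => by simp [ψ]
  let p : ℕ → Prop := fun j => σ.arr 3 j ≠ 0
  have hlt : code k p ψ n 0 < Γ.param 6 := by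
    rw [hM, ← prod_flagged]
    simpa [p] using code_lt (p := p) (ψ := ψ) n 0 fun j hj => hψ j (by omega)
  refine ⟨_, hlt, fun ρ hρ hρ3 h2 => ?_⟩
  rw [colorCmd, Cmd.eval_seq, Cmd.eval_seq]
  set c : Cmd := .ite (.arr 3 (.var 4))
    (.seq (.assign 5 (.sum 6 20 (.cond (.lt (.var 3) (.smul (.add (.var 20) (.const 1)) k))
        (.const 0) (.const 1))))
      (.seq (.store 1 (.var 4) (.sub (.var 3) (.smul (.var 5) k))) (.assign 3 (.var 5))))
    (.store 1 (.var 4) (.const k)) with hc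
  let I : ℕ → Store → Prop := fun i τ => HasRows n τ ∧ τ.arr 3 = σ.arr 3 ∧
    τ.var 3 = code k p ψ (n - i) i ∧ τ.var 3 ≤ Γ.param 6 ∧
    ∀ j < i, τ.arr 1 j = if p j then ψ j else k
  have hI : I n ((Cmd.forTo 0 4 c).eval Γ ((Cmd.assign 3 (.var 2)).eval Γ ρ)) := by
    have h3 : ((Cmd.assign 3 (.var 2)).eval Γ ρ).var 3 = code k p ψ n 0 := by
      rw [← h2]
      simp [Cmd.eval_assign, Expr.eval]
    rw [Cmd.eval_for, hΓ.vertices]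
    refine iter_induction I ⟨hρ, hρ3, h3, by rw [h3]; exact hlt.le,
      fun j hj => absurd hj (by omega)⟩ ?_
    rintro i hi τ ⟨g1, g2, g3, g4, g5⟩
    obtain ⟨r, hr⟩ : ∃ r, n - i = r + 1 := ⟨n - i - 1, by omega⟩
    have hr' : n - (i + 1) = r := by omega
    have hrow : ∀ c' : Cmd, c'.KeepsArr 0 → HasRows n (c'.eval Γ (τ.set 4 i)) :=
      fun c' hc' u hu => by rw [Cmd.eval_arr _ hc']; exact g1 u hu
    have hcond : (Expr.arr 3 (.var 4)).Holds Γ (τ.set 4 i) ↔ p i := by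
      rw [Expr.holds_arr, Store.set_arr, g2]
      simp [Expr.eval, p]
    have hI' : I (i + 1) (c.eval Γ (τ.set 4 i)) := by
      by_cases hp : p i
      · rw [hr, code, if_pos hp] at g3
        have hki := hψ i hi
        have hkpos : 0 < k := by omega
        rw [hc, Cmd.eval_ite_pos (hcond.2 hp), Cmd.eval_seq, Cmd.eval_seq]
        have hq : (Expr.sum 6 20 (.cond (.lt (.var 3) (.smul (.add (.var 20) (.const 1)) k))
            (.const 0) (.const 1))).eval Γ (τ.set 4 i) = code k p ψ r (i + 1) := by
          have hdiv : τ.var 3 / k = code k p ψ r (i + 1) := by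
            rw [g3, Nat.add_mul_div_left _ _ hkpos, Nat.div_eq_of_lt hki, zero_add]
          rw [← hdiv, ← card_filter_mul_le hkpos ((Nat.div_le_self _ _).trans g4), Expr.eval]
          refine Finset.sum_congr rfl fun j _ => ?_
          rw [Expr.eval_cond]
          simp only [Expr.holds_lt, Expr.eval_smul, Expr.eval, Store.set_var]
          simp only [if_true, show (3 : ℕ) ≠ 20 by decide, show (3 : ℕ) ≠ 4 by decide, if_false]
          split_ifs <;> omega
        rw [Cmd.eval_assign 5, hq]
        set x := code k p ψ r (i + 1) with hx
        refine ⟨fun u hu => ?_, ?_, ?_, ?_, fun j hj => ?_⟩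
        · simp only [Cmd.eval]
          rw [Store.set_arr, Store.put_arr_of_ne _ _ _ (by decide)]
          exact g1 u hu
        · simp only [Cmd.eval]
          rw [Store.set_arr, Store.put_arr_of_ne _ _ _ (by decide)]
          exact g2
        · rw [hr', ← hx]
          simp [Cmd.eval, Expr.eval]
        · have : x ≤ τ.var 3 := by
            rw [g3]
            nlinarith
          simp only [Cmd.eval, Expr.eval, Store.set_var, if_true, Store.put_var]
          omega
        · simp only [Cmd.eval, Expr.eval_smul, Expr.eval, Store.set_arr, Store.set_var, Store.put,
            Function.update_self, Function.update_apply]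
          simp only [show (4 : ℕ) ≠ 5 by decide, show (3 : ℕ) ≠ 5 by decide,
            show (3 : ℕ) ≠ 4 by decide, if_false, if_true]
          by_cases hji : j = i
          · subst hji
            simp [hp, g3]
          · rw [if_neg hji]
            exact g5 j (by omega)
      · rw [hr, code, if_neg hp] at g3
        rw [hc, Cmd.eval_ite_neg (mt hcond.1 hp)]
        refine ⟨hrow _ (by simp [Cmd.KeepsArr]), ?_, ?_, ?_, fun j hj => ?_⟩
        · rw [Cmd.eval_arr _ (by simp [Cmd.KeepsArr])]
          exact g2
        · rw [hr', ← g3]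
          simp [Cmd.eval]
        · simpa [Cmd.eval] using g4
        · simp only [Cmd.eval, Expr.eval, Store.put, Store.set_var, if_true, Function.update_self,
            Function.update_apply]
          by_cases hji : j = i
          · subst hji
            simp [hp]
          · rw [if_neg hji]
            exact g5 j (by omega)
    exact hI'
  set σ₁ := (Cmd.forTo 0 4 c).eval Γ ((Cmd.assign 3 (.var 2)).eval Γ ρ) with hσ₁
  obtain ⟨g1, -, -, -, g5⟩ := hI
  have hA : ∀ v : Fin n, σ₁.arr 1 v = if v ∈ flagged n σ then (φ v : ℕ) else k := by
    intro v
    rw [g5 v v.2, hψφ]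
    simp only [mem_flagged, p]
  rw [completeCmd_spec H hΓ g1, if_pos]
  simp only [hA]
  refine Decisive.solved (Nat.le_add_left _ _) hφ (decisive_of_dominating hdeg (fun v hv => ?_)
    fun v => ?_)
  · split_ifs at hv ⊢ with h
    · rfl
    · omega
  · have hv : v ∉ undominated G (flagged n σ) := by rw [hdom]; simp
    rw [mem_undominated] at hv
    push Not at hv
    obtain ⟨w, hw, hwv⟩ := hv
    rcases mem_closedNeighbors.1 hwv with rfl | h
    · left; rw [if_pos hw]; exact (φ w).2
    · right; exact ⟨w, h.symm, by rw [if_pos hw]; exact (φ w).2⟩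

/-- Compute the number of colourings of the flagged vertices. -/
def numColoringsCmd (k : ℕ) : Cmd :=
  .seq (.assign 3 (.const 1))
    (.forTo 0 4 (.ite (.arr 3 (.var 4)) (.assign 3 (.smul (.var 3) k)) .skip))

theorem numColoringsCmd_spec (hn : Γ.param 0 = n) (σ : Store) :
    ((numColoringsCmd k).eval Γ σ).var 3 = k ^ (flagged n σ).card ∧
      ((numColoringsCmd k).eval Γ σ).arr = σ.arr := by
  rw [numColoringsCmd, Cmd.eval_seq, Cmd.eval_for, hn, ← prod_flagged]
  refine iter_induction (fun i τ => τ.var 3 =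
    (∏ j ∈ Finset.range i, if σ.arr 3 j ≠ 0 then k else 1) ∧ τ.arr = σ.arr)
    ⟨by simp [Cmd.eval_assign, Expr.eval], rfl⟩ ?_
  rintro i hi τ ⟨g1, g2⟩
  have hcond : (Expr.arr 3 (.var 4)).Holds Γ (τ.set 4 i) ↔ σ.arr 3 i ≠ 0 := by
    rw [Expr.holds_arr, Store.set_arr, g2]
    simp [Expr.eval]
  rw [Finset.prod_range_succ, ← g1]
  by_cases h : σ.arr 3 i ≠ 0
  · rw [Cmd.eval_ite_pos (hcond.2 h), if_pos h, Cmd.eval_assign, Expr.eval_smul]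
    exact ⟨by simp [Expr.eval, mul_comm], g2⟩
  · rw [Cmd.eval_ite_neg (mt hcond.1 h), if_neg h]
    exact ⟨by simp [Cmd.skip, Cmd.eval_assign], g2⟩

/-- The stages of the search for colourings of a dominating set. -/
noncomputable def dominationStages (H : LoopGraph (Fin k)) : List Stage :=
  [listsStage, ⟨.seq dominateCmd (numColoringsCmd k), .var 3, 6⟩,
    ⟨.seq (.assign 0 (.const 0)) (.forTo 6 2 (colorCmd H)), .var 0, 0⟩]

theorem dominationStages_ok (H : LoopGraph (Fin k)) :
    ∀ S ∈ dominationStages H, S.Ok (7 + 3 * k) := by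
  have h0 : 0 < 7 + 3 * k := by omega
  have h1 : 1 < 7 + 3 * k := by omega
  have h3 : 3 < 7 + 3 * k := by omega
  have hsm : ∀ e : Expr, e.Ok (7 + 3 * k) → (Expr.smul e k).Ok (7 + 3 * k) :=
    fun e he => Expr.ok_smul he k
  have s1 := hsm (.var 3) trivial
  have s2 := hsm (.var 5) trivial
  have s3 := hsm (.add (.var 20) (.const 1)) ⟨trivial, trivial⟩
  simp only [dominationStages, listsStage, List.mem_cons, List.not_mem_nil, or_false,
    forall_eq_or_imp, forall_eq, Stage.Ok, Cmd.Ok, Cmd.skip, Expr.Ok, dominateCmd, greedyCmd,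
    improveCmd, numColoringsCmd, colorCmd, rowsCmd_ok, completeCmd_ok, Cmd.ok_map, Expr.count,
    Expr.near, Expr.undom, Expr.ex, Expr.not, Expr.and, Expr.or, Expr.eq, Expr.lt, Expr.adj,
    h0, h1, h3, s1, s2, s3, and_true, true_and]
  omega

/-- Trying all colourings of a dominating set solves list colouring. Up to polynomial factors, the
running time is the number of these colourings. -/
theorem solves_of_domination (H : LoopGraph (Fin k)) (hk : 0 < k)
    (hdeg : ∀ x, (H.neighborSet x).ncard ≤ 2) (d : ℕ → ℕ)
    (hd : ∀ n s j : ℕ, 3 ≤ n → s ≤ j + 1 → n ^ j ≤ n * (n - s) ^ j → s ≤ d n) :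
    ∃ (P : Program) (C e : ℕ), SolvesListColoringDiamTwo H P fun n =>
      ((C * (n + (n * n + n * k) + k ^ d n) ^ e : ℕ) : ℝ) := by
  obtain ⟨P, C, e, h⟩ := exists_program k (7 + 3 * k) (dominationStages_ok H)
  refine ⟨P, C, e, fun n G L hG hdiam => ?_⟩
  have hn := three_le_of_diam_eq_two hdiam
  set N := n + (n * n + n * k) + k ^ d n with hN
  let Γ₁ := (startEnv G L).setParam 2 (n * n)
  have hΓ₁ : IsInstance Γ₁ G L := by
    refine ⟨?_, ?_, ?_, rfl⟩ <;> simp [Γ₁, Env.setParam_param, startEnv]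
  have hrun : ∀ σ : Store, ∃ σ₁ σ₂ : Store, ∃ M,
      listsStage.run (startEnv G L, σ) = (Γ₁, σ₁) ∧
      Stage.run ⟨.seq dominateCmd (numColoringsCmd k), .var 3, 6⟩ (Γ₁, σ₁) =
        (Γ₁.setParam 6 M, σ₂) ∧ M ≤ k ^ d n ∧ M = k ^ (flagged n σ₂).card ∧ HasRows n σ₂ ∧
        undominated G (flagged n σ₂) = ∅ := by
    intro σ
    obtain ⟨h1, h2, j, h3, h4⟩ :=
      dominateCmd_spec hG hdiam hΓ₁ (listsStage.cmd.eval (startEnv G L) σ)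
    obtain ⟨h5, h6⟩ := numColoringsCmd_spec (k := k) hΓ₁.vertices
      (dominateCmd.eval Γ₁ (listsStage.cmd.eval (startEnv G L) σ))
    have h7 := flagged_congr (n := n) (congrFun h6 3)
    refine ⟨_, _, _, Prod.ext ?_ rfl, rfl, ?_, ?_, fun u hu => ?_, ?_⟩
    · simp [Stage.run, listsStage, Γ₁, Expr.eval, startEnv]
    · simp only [Expr.eval, Cmd.eval_seq]
      refine le_trans (le_of_eq h5) (Nat.pow_le_pow_right hk (hd n _ j hn h3 h4))
    · simp only [Expr.eval, Cmd.eval_seq]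
      refine h5.trans (congrArg (k ^ ·) (congrArg _ h7.symm))
    · simp only [Cmd.eval_seq]
      exact (congrFun (congrFun h6 0) u).trans (h1 u hu)
    · simp only [Cmd.eval_seq]
      exact (congrArg _ h7).trans h2
  have hkd : 0 < k ^ d n := Nat.pow_pos hk
  have b₀ := startEnv_le (N := N) G L (by omega)
  have b₁ := Env.setParam_le (q := 2) (x := n * n) b₀ (by omega)
  obtain ⟨σ, s, t, hr, ht, hs⟩ := h n G L N (by omega) (by omega) fun σ => by
    obtain ⟨σ₁, σ₂, M, h₁, h₂, hM, -⟩ := hrun σ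
    rw [dominationStages, ParamsLE, h₁, ParamsLE, h₂, ParamsLE]
    exact ⟨b₀, b₁, Env.setParam_le b₁ (by omega), trivial⟩
  refine ⟨s, t, hr, Nat.cast_le.2 ht, ?_⟩
  obtain ⟨σ₁, σ₂, M, h₁, h₂, -, hM, hrow, hdom⟩ := hrun σ
  rw [dominationStages, runStages, h₁, runStages, h₂, runStages, runStages, Stage.run] at hs
  simp only [Expr.eval, Env.setParam_param, if_true] at hs
  set Γ₂ := Γ₁.setParam 6 M with hΓ₂def
  have hΓ₂ : IsInstance Γ₂ G L := by
    refine ⟨?_, ?_, ?_, rfl⟩ <;> simp [Γ₂, Γ₁, Env.setParam_param, startEnv]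
  have h6 : Γ₂.param 6 = M := by simp [Γ₂, Env.setParam_param]
  rw [hs, Cmd.eval_seq, Cmd.eval_for]
  refine search_spec (fun τ => HasRows n τ ∧ τ.arr 3 = σ₂.arr 3) (∃ φ, IsListHom G L H φ)
    ⟨hrow, rfl⟩ (by simp [Cmd.eval_assign, Expr.eval])
    (fun i _ τ hτ => ⟨⟨fun u hu => ?_, ?_⟩, ?_⟩) ?_
  · rw [Cmd.eval_arr _ (colorCmd_keepsArr H (by decide) (by decide))]
    exact hτ.1 u hu
  · rw [Cmd.eval_arr _ (colorCmd_keepsArr H (by decide) (by decide))]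
    exact hτ.2
  · simpa using colorCmd_sound (σ := τ.set 2 i) H hΓ₂ hτ.1
  · rintro ⟨φ, hφ⟩
    obtain ⟨x, hx, hx'⟩ := colorCmd_complete (σ := σ₂) H hdeg hΓ₂ hdom (by rw [h6, hM]) hφ
    exact ⟨x, hx, fun τ hτ => hx' (τ.set 2 x) hτ.1 hτ.2 (by simp)⟩

end Domination

end RAM

namespace RAM

/-! ### Computing the length of certificates -/

/-- The least `t` with `n ≤ t ^ 3`. -/
def cubeRoot (n : ℕ) : ℕ := Nat.find (⟨n, Nat.le_self_pow (by decide) n⟩ : ∃ t, n ≤ t ^ 3)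

theorem le_cubeRoot_pow (n : ℕ) : n ≤ cubeRoot n ^ 3 :=
  Nat.find_spec (⟨n, Nat.le_self_pow (by decide) n⟩ : ∃ t, n ≤ t ^ 3)

theorem cubeRoot_le (n : ℕ) : cubeRoot n ≤ n :=
  Nat.find_min' _ (Nat.le_self_pow (by decide) n)

theorem lt_cubeRoot {n t : ℕ} : t < cubeRoot n ↔ t ^ 3 < n := by
  refine ⟨fun h => not_le.1 (Nat.find_min
    (⟨n, Nat.le_self_pow (by decide) n⟩ : ∃ t, n ≤ t ^ 3) h), fun h => ?_⟩
  by_contra hcon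
  have := (le_cubeRoot_pow n).trans (Nat.pow_le_pow_left (not_lt.1 hcon) 3)
  omega

/-- The product of a variable, whose value is at most `param 0`, and an expression in which the
variable `w` does not occur. -/
def Expr.varMul (w v : ℕ) (e : Expr) : Expr :=
  .sum 0 w (.cond (.lt (.var w) (.var v)) e (.const 0))

theorem Expr.eval_varMul {Γ : Env} {σ : Store} {w v : ℕ} (hvw : v ≠ w) {e : Expr} (he : e.NoVar w)
    (hv : σ.var v ≤ Γ.param 0) : (Expr.varMul w v e).eval Γ σ = σ.var v * e.eval Γ σ := by
  classical
  have h : ∀ i, (Expr.cond (.lt (.var w) (.var v)) e (.const 0)).eval Γ (σ.set w i) =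
      if i < σ.var v then e.eval Γ σ else 0 := by
    intro i
    have h1 : e.eval Γ (σ.set w i) = e.eval Γ σ :=
      eval_congr_var e he (fun x hx => by simp [Store.set, hx]) rfl
    rw [eval_cond, h1]
    simp [eval, hvw]
  rw [varMul, eval, Finset.sum_congr rfl fun i _ => h i, ← Finset.sum_filter,
    Finset.sum_const, smul_eq_mul]
  congr 1
  rw [show (Finset.range (Γ.param 0)).filter (fun i => i < σ.var v) = Finset.range (σ.var v) by
    ext i; simp only [Finset.mem_filter, Finset.mem_range]; omega, Finset.card_range]

/-- Compute `cubeRoot (param 0)` as variable `2`. -/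
def cubeRootCmd : Cmd :=
  .seq (.assign 2 (.const 0)) (.forTo 0 4 (.ite
    (.lt (.varMul 20 2 (.varMul 21 2 (.var 2))) (.param 0))
    (.assign 2 (.add (.var 2) (.const 1))) .skip))

theorem cubeRootCmd_spec (Γ : Env) (σ : Store) :
    (cubeRootCmd.eval Γ σ).var 2 = cubeRoot (Γ.param 0) := by
  rw [cubeRootCmd, Cmd.eval_seq, Cmd.eval_for]
  have hI := iter_induction (f := (Cmd.ite
    (.lt (.varMul 20 2 (.varMul 21 2 (.var 2))) (.param 0))
    (.assign 2 (.add (.var 2) (.const 1))) .skip).eval Γ) (v := 4)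
    (fun i τ => τ.var 2 = min i (cubeRoot (Γ.param 0))) (N := Γ.param 0)
    (σ := (Cmd.assign 2 (.const 0)).eval Γ σ) (by simp [Cmd.eval_assign, Expr.eval]) ?_
  · rw [hI, min_eq_right (cubeRoot_le _)]
  · intro i hi τ hτ
    have hle : (τ.set 4 i).var 2 ≤ Γ.param 0 := by
      rw [Store.set_var, if_neg (by decide), hτ]
      exact (min_le_left _ _).trans hi.le
    have hnv : (Expr.varMul 21 2 (.var 2)).NoVar 20 := by
      simp [Expr.varMul, Expr.NoVar, Expr.lt]
    have hnv' : (Expr.var 2).NoVar 21 := by simp [Expr.NoVar]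
    have hcond : (Expr.lt (.varMul 20 2 (.varMul 21 2 (.var 2))) (.param 0)).Holds Γ (τ.set 4 i) ↔
        τ.var 2 < cubeRoot (Γ.param 0) := by
      rw [Expr.holds_lt, Expr.eval_varMul (by decide) hnv hle,
        Expr.eval_varMul (by decide) hnv' hle, lt_cubeRoot]
      simp only [Expr.eval, Store.set_var, show (2 : ℕ) ≠ 4 by decide, if_false]
      rw [show τ.var 2 ^ 3 = τ.var 2 * (τ.var 2 * τ.var 2) by ring]
    by_cases h : τ.var 2 < cubeRoot (Γ.param 0)
    · rw [Cmd.eval_ite_pos (hcond.2 h)]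
      simp [Cmd.eval_assign, Expr.eval]
      omega
    · rw [Cmd.eval_ite_neg (mt hcond.1 h)]
      simp [Cmd.skip, Cmd.eval_assign]
      omega

/-- Compute the logarithm of `param 0` to the base two, rounded up, as variable `6`. -/
def logCmd : Cmd :=
  .seq (.assign 6 (.const 0)) (.seq (.assign 5 (.const 1)) (.forTo 0 4 (.ite
    (.lt (.var 5) (.param 0))
    (.seq (.assign 6 (.add (.var 6) (.const 1))) (.assign 5 (.add (.var 5) (.var 5)))) .skip)))

theorem logCmd_spec (Γ : Env) (σ : Store) :
    (logCmd.eval Γ σ).var 6 = Nat.clog 2 (Γ.param 0) := by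
  rw [logCmd, Cmd.eval_seq, Cmd.eval_seq, Cmd.eval_for]
  have hI := iter_induction (f := (Cmd.ite (.lt (.var 5) (.param 0))
    (.seq (.assign 6 (.add (.var 6) (.const 1))) (.assign 5 (.add (.var 5) (.var 5))))
    .skip).eval Γ) (v := 4)
    (fun i τ => τ.var 5 = 2 ^ τ.var 6 ∧ τ.var 6 = min i (Nat.clog 2 (Γ.param 0))) (N := Γ.param 0)
    (σ := (Cmd.assign 5 (.const 1)).eval Γ ((Cmd.assign 6 (.const 0)).eval Γ σ))
    (by simp [Cmd.eval_assign, Expr.eval]) ?_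
  · rw [hI.2, min_eq_right]
    exact Nat.clog_le_of_le_pow (Nat.lt_two_pow_self).le
  · rintro i hi τ ⟨h5, h6⟩
    have hcond : (Expr.lt (.var 5) (.param 0)).Holds Γ (τ.set 4 i) ↔
        τ.var 6 < Nat.clog 2 (Γ.param 0) := by
      rw [Nat.lt_clog_iff_pow_lt (by decide), ← h5]
      simp [Expr.eval]
    by_cases h : τ.var 6 < Nat.clog 2 (Γ.param 0)
    · rw [Cmd.eval_ite_pos (hcond.2 h)]
      simp [Cmd.eval_seq, Cmd.eval_assign, Expr.eval, h5, pow_succ]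
      omega
    · rw [Cmd.eval_ite_neg (mt hcond.1 h)]
      simp [Cmd.skip, Cmd.eval_assign, h5]
      omega

/-- The length of the certificates for three-colourings. -/
def threeLength (n : ℕ) : ℕ := 1088 * (cubeRoot n * (Nat.clog 2 n + 1))

/-- Compute `threeLength (param 0)` as variable `2`. -/
def threeLengthCmd : Cmd :=
  .seq logCmd (.seq cubeRootCmd
    (.assign 2 (.smul (.varMul 20 2 (.add (.var 6) (.const 1))) 1088)))

theorem threeLengthCmd_spec (Γ : Env) (σ : Store) :
    (threeLengthCmd.eval Γ σ).var 2 = threeLength (Γ.param 0) := by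
  rw [threeLengthCmd, Cmd.eval_seq, Cmd.eval_seq, Cmd.eval_assign, Expr.eval_smul]
  have h2 := cubeRootCmd_spec Γ (logCmd.eval Γ σ)
  have h6 : (cubeRootCmd.eval Γ (logCmd.eval Γ σ)).var 6 = Nat.clog 2 (Γ.param 0) := by
    rw [Cmd.eval_var _ (by simp [cubeRootCmd, Cmd.KeepsVar, Cmd.skip]), logCmd_spec]
  rw [Expr.eval_varMul (by decide) (by simp [Expr.NoVar]) (by rw [h2]; exact cubeRoot_le _)]
  simp [Expr.eval, h2, h6, threeLength]

theorem threeLengthCmd_ok (A : ℕ) : threeLengthCmd.Ok A := by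
  have hsm : (Expr.smul (.varMul 20 2 (.add (.var 6) (.const 1))) 1088).Ok A :=
    Expr.ok_smul (by simp [Expr.varMul, Expr.Ok, Expr.lt]) _
  simp [threeLengthCmd, logCmd, cubeRootCmd, Cmd.Ok, Expr.Ok, Expr.varMul, Expr.lt, Cmd.skip]
  exact hsm

end RAM

/-! ### Running times -/

open LoopGraph ListColoring RAM

theorem SolvesListColoringDiamTwo.mono {k : ℕ} {H : LoopGraph (Fin k)} {P : Program}
    {T T' : ℕ → ℝ} (h : SolvesListColoringDiamTwo H P T) (hT : ∀ n, 3 ≤ n → T n ≤ T' n) :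
    SolvesListColoringDiamTwo H P T' := by
  intro n G L hG hd
  obtain ⟨s, t, hr, ht, hs⟩ := h n G L hG hd
  exact ⟨s, t, hr, ht.trans (hT n (three_le_of_diam_eq_two hd)), hs⟩

/-- The function `f` is bounded by `2 ^ O(E)`. Graphs of diameter two have at least three
vertices. -/
def ExpBounded (E : ℕ → ℝ) (f : ℕ → ℕ) : Prop :=
  ∃ c : ℝ, 0 ≤ c ∧ ∀ n, 3 ≤ n → (f n : ℝ) ≤ 2 ^ (c * E n)

namespace ExpBounded

variable {E : ℕ → ℝ} {f g : ℕ → ℕ}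

theorem of_le_mul {c : ℝ} (hc : 0 ≤ c) {r : ℕ → ℝ}
    (hf : ∀ n, 3 ≤ n → (f n : ℝ) ≤ 2 ^ r n) (hr : ∀ n, 3 ≤ n → r n ≤ c * E n) : ExpBounded E f :=
  ⟨c, hc, fun n hn => (hf n hn).trans (Real.rpow_le_rpow_of_exponent_le one_le_two (hr n hn))⟩

theorem const (hE : ∀ n, 3 ≤ n → 1 ≤ E n) (a : ℕ) : ExpBounded E fun _ => a := by
  refine of_le_mul (c := a) (Nat.cast_nonneg a) (r := fun _ => a) (fun n _ => ?_) fun n hn => ?_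
  · rw [Real.rpow_natCast]
    exact_mod_cast (Nat.lt_two_pow_self (n := a)).le
  · exact le_mul_of_one_le_right (Nat.cast_nonneg a) (hE n hn)

theorem mul (hf : ExpBounded E f) (hg : ExpBounded E g) : ExpBounded E fun n => f n * g n := by
  obtain ⟨c, hc, hf⟩ := hf
  obtain ⟨c', hc', hg⟩ := hg
  refine ⟨c + c', add_nonneg hc hc', fun n hn => ?_⟩
  rw [add_mul, Real.rpow_add two_pos, Nat.cast_mul]
  exact mul_le_mul (hf n hn) (hg n hn) (Nat.cast_nonneg _) (Real.rpow_nonneg two_pos.le _)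

theorem pow (hE : ∀ n, 3 ≤ n → 1 ≤ E n) (hf : ExpBounded E f) (d : ℕ) :
    ExpBounded E fun n => f n ^ d := by
  induction d with
  | zero => simpa using const hE 1
  | succ d ih => simpa only [pow_succ] using ih.mul hf

theorem add (hE : ∀ n, 3 ≤ n → 1 ≤ E n) (hf : ExpBounded E f) (hg : ExpBounded E g) :
    ExpBounded E fun n => f n + g n := by
  obtain ⟨c, hc, hf⟩ := hf
  obtain ⟨c', hc', hg⟩ := hg
  refine ⟨1 + max c c', by positivity, fun n hn => ?_⟩
  have h1 := hE n hn
  have h0 : 0 ≤ E n := zero_le_one.trans h1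
  have hf' := (hf n hn).trans (Real.rpow_le_rpow_of_exponent_le one_le_two
    (mul_le_mul_of_nonneg_right (le_max_left c c') h0))
  have hg' := (hg n hn).trans (Real.rpow_le_rpow_of_exponent_le one_le_two
    (mul_le_mul_of_nonneg_right (le_max_right c c') h0))
  have h2 : (2 : ℝ) ≤ 2 ^ (1 * E n) := by
    rw [one_mul]
    simpa using Real.rpow_le_rpow_of_exponent_le one_le_two h1
  have h3 : (0 : ℝ) ≤ 2 ^ (max c c' * E n) := Real.rpow_nonneg two_pos.le _
  rw [add_mul, Real.rpow_add two_pos, Nat.cast_add]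
  nlinarith

end ExpBounded

theorem one_le_log {n : ℕ} (hn : 3 ≤ n) : 1 ≤ Real.log n := by
  rw [Real.le_log_iff_exp_le (by positivity)]
  have : (3 : ℝ) ≤ n := by exact_mod_cast hn
  linarith [Real.exp_one_lt_d9]

theorem natCast_le_two_rpow {n : ℕ} (hn : 3 ≤ n) : (n : ℝ) ≤ 2 ^ (2 * Real.log n) := by
  have hpos : (0 : ℝ) < n := by positivity
  rw [Real.rpow_def_of_pos two_pos, ← Real.log_le_iff_le_exp hpos]
  nlinarith [Real.log_two_gt_d9, one_le_log hn]

theorem expBounded_id {E : ℕ → ℝ} (hE : ∀ n : ℕ, 3 ≤ n → Real.log n ≤ E n) :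
    ExpBounded E fun n => n :=
  ExpBounded.of_le_mul zero_le_two (fun _ => natCast_le_two_rpow) fun n hn =>
    mul_le_mul_of_nonneg_left (hE n hn) zero_le_two

/-- The exponent for cycles of length three. -/
noncomputable def cubeExponent (n : ℕ) : ℝ := (n : ℝ) ^ (1 / 3 : ℝ) * Real.log n ^ 2

theorem one_le_cbrt {n : ℕ} (hn : 3 ≤ n) : 1 ≤ (n : ℝ) ^ (1 / 3 : ℝ) :=
  Real.one_le_rpow (by exact_mod_cast (by omega : 1 ≤ n)) (by norm_num)

theorem log_le_cubeExponent {n : ℕ} (hn : 3 ≤ n) : Real.log n ≤ cubeExponent n := by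
  have h1 := one_le_log hn
  have h2 := one_le_cbrt hn
  rw [cubeExponent, pow_two]
  nlinarith [mul_le_mul h2 h1 zero_le_one (by linarith)]

theorem cubeRoot_le_rpow {n : ℕ} (hn : 3 ≤ n) :
    (cubeRoot n : ℝ) ≤ 2 * (n : ℝ) ^ (1 / 3 : ℝ) := by
  have h1 := one_le_cbrt hn
  rcases Nat.eq_zero_or_pos (cubeRoot n) with h0 | hpos
  · rw [h0]
    simp only [Nat.cast_zero]
    linarith
  · obtain ⟨t, ht⟩ : ∃ t, cubeRoot n = t + 1 := ⟨cubeRoot n - 1, by omega⟩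
    have h2 : t ^ 3 < n := lt_cubeRoot.1 (by omega)
    have h3 : (t : ℝ) ≤ (n : ℝ) ^ (1 / 3 : ℝ) := by
      have h4 : ((t : ℝ) ^ 3) ^ (1 / 3 : ℝ) ≤ (n : ℝ) ^ (1 / 3 : ℝ) :=
        Real.rpow_le_rpow (by positivity) (by exact_mod_cast h2.le) (by norm_num)
      rwa [← Real.rpow_natCast, ← Real.rpow_mul (Nat.cast_nonneg t),
        show ((3 : ℕ) : ℝ) * (1 / 3) = 1 by norm_num, Real.rpow_one] at h4
    rw [ht]
    push_cast
    linarith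

theorem clog_le_log {n : ℕ} (hn : 3 ≤ n) : (Nat.clog 2 n : ℝ) + 1 ≤ 4 * Real.log n := by
  have h1 := one_le_log hn
  rcases Nat.eq_zero_or_pos (Nat.clog 2 n) with h0 | hpos
  · rw [h0]
    simp only [Nat.cast_zero]
    linarith
  · obtain ⟨l, hl⟩ : ∃ l, Nat.clog 2 n = l + 1 := ⟨Nat.clog 2 n - 1, by omega⟩
    have h2 : 2 ^ l < n := (Nat.lt_clog_iff_pow_lt (by decide)).1 (by omega)
    have h3 : (l : ℝ) * Real.log 2 ≤ Real.log n := by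
      rw [← Real.log_pow]
      exact Real.log_le_log (by positivity) (by exact_mod_cast h2.le)
    rw [hl]
    push_cast
    nlinarith [Real.log_two_gt_d9]

theorem threeLength_le {n : ℕ} (hn : 3 ≤ n) :
    (threeLength n : ℝ) ≤ 8704 * ((n : ℝ) ^ (1 / 3 : ℝ) * Real.log n) := by
  rw [threeLength]
  push_cast
  have h := mul_le_mul (cubeRoot_le_rpow hn) (clog_le_log hn) (by positivity) (by positivity)
  linarith

theorem expBounded_numCertificates :
    ExpBounded cubeExponent fun n => numInstr 3 n ^ threeLength n := by
  refine ExpBounded.of_le_mul (c := 52224) (by norm_num)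
    (r := fun n => 6 * Real.log n * threeLength n) (fun n hn => ?_) fun n hn => ?_
  · have h1 : ((numInstr 3 n : ℕ) : ℝ) ≤ 2 ^ (6 * Real.log n) := by
      have h2 : numInstr 3 n ≤ n ^ 3 := by
        rw [numInstr]
        nlinarith [Nat.mul_le_mul hn hn]
      calc ((numInstr 3 n : ℕ) : ℝ) ≤ (n : ℝ) ^ 3 := by exact_mod_cast h2
        _ ≤ ((2 : ℝ) ^ (2 * Real.log n)) ^ 3 :=
            pow_le_pow_left₀ (Nat.cast_nonneg n) (natCast_le_two_rpow hn) 3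
        _ = 2 ^ (6 * Real.log n) := by
            rw [← Real.rpow_natCast, ← Real.rpow_mul two_pos.le]
            congr 1
            push_cast
            ring
    rw [Real.rpow_mul two_pos.le, Real.rpow_natCast, Nat.cast_pow]
    exact pow_le_pow_left₀ (Nat.cast_nonneg _) h1 _
  · have h1 := threeLength_le hn
    have h2 := one_le_log hn
    rw [cubeExponent]
    calc 6 * Real.log n * threeLength n
        ≤ 6 * Real.log n * (8704 * ((n : ℝ) ^ (1 / 3 : ℝ) * Real.log n)) :=
          mul_le_mul_of_nonneg_left h1 (by linarith)
      _ = _ := by ring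

/-- The exponent for the looped path with three vertices. -/
noncomputable def sqrtExponent (n : ℕ) : ℝ := (n : ℝ) ^ (1 / 2 : ℝ) * Real.log n ^ (1 / 2 : ℝ)

theorem sqrtExponent_eq (n : ℕ) : sqrtExponent n = √(n * Real.log n) := by
  rw [sqrtExponent, ← Real.sqrt_eq_rpow, ← Real.sqrt_eq_rpow, Real.sqrt_mul (Nat.cast_nonneg n)]

theorem log_le_sqrtExponent {n : ℕ} (hn : 3 ≤ n) : Real.log n ≤ sqrtExponent n := by
  have h1 := one_le_log hn
  have h2 := Real.log_le_self (Nat.cast_nonneg n)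
  rw [sqrtExponent_eq]
  refine Real.le_sqrt_of_sq_le ?_
  nlinarith

/-- The bound for the size of dominating sets. -/
noncomputable def dominationBound (n : ℕ) : ℕ := ⌊sqrtExponent n⌋₊ + 1

/-- The inequality `n ^ j ≤ n * (n - s) ^ j` says that a share `s / n` could be removed `j` times
before less than one of `n` vertices was left. It gives `s * j ≤ n * log n`, since
`1 - s / n ≤ exp (-s / n)`. -/
theorem le_dominationBound {n s j : ℕ} (hn : 3 ≤ n) (hs : s ≤ j + 1)
    (h : n ^ j ≤ n * (n - s) ^ j) : s ≤ dominationBound n := by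
  have hpos : (0 : ℝ) < n := by positivity
  have h1 : ((n - s : ℕ) : ℝ) ≤ n * Real.exp (-(s / n)) := by
    rcases le_or_gt s n with hsn | hsn
    · rw [Nat.cast_sub hsn]
      have h2 := Real.add_one_le_exp (-((s : ℝ) / n))
      calc (n : ℝ) - s = n * (-(s / n) + 1) := by field_simp; ring
        _ ≤ _ := mul_le_mul_of_nonneg_left h2 hpos.le
    · rw [Nat.sub_eq_zero_of_le hsn.le]
      simp only [Nat.cast_zero]
      positivity
  have h2 : (n : ℝ) ^ j ≤ n * (n * Real.exp (-(s / n))) ^ j := by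
    calc (n : ℝ) ^ j ≤ n * ((n - s : ℕ) : ℝ) ^ j := by exact_mod_cast h
      _ ≤ _ := mul_le_mul_of_nonneg_left (pow_le_pow_left₀ (Nat.cast_nonneg _) h1 j) hpos.le
  have h3 : (s : ℝ) * j ≤ n * Real.log n := by
    rw [mul_pow, ← Real.exp_nat_mul] at h2
    have h4 : 1 ≤ (n : ℝ) * Real.exp (j * -(s / n)) := by
      have h5 : (0 : ℝ) < n ^ j := by positivity
      refine le_of_mul_le_mul_left ?_ h5
      linarith
    have h5 := Real.log_le_log one_pos h4
    rw [Real.log_one, Real.log_mul hpos.ne' (Real.exp_pos _).ne', Real.log_exp] at h5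
    have h6 : (j : ℝ) * (s / n) ≤ Real.log n := by linarith
    calc (s : ℝ) * j = n * (j * (s / n)) := by field_simp
      _ ≤ _ := mul_le_mul_of_nonneg_left h6 hpos.le
  rcases Nat.eq_zero_or_pos s with rfl | hs0
  · exact Nat.zero_le _
  obtain ⟨r, rfl⟩ : ∃ r, s = r + 1 := ⟨s - 1, by omega⟩
  refine Nat.succ_le_succ (Nat.le_floor ?_)
  rw [sqrtExponent_eq]
  refine Real.le_sqrt_of_sq_le (le_trans ?_ h3)
  have h4 : (r : ℝ) ≤ j := by exact_mod_cast (by omega : r ≤ j)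
  push_cast
  nlinarith [Nat.cast_nonneg (α := ℝ) r]

theorem expBounded_numColorings (k : ℕ) :
    ExpBounded sqrtExponent fun n => k ^ dominationBound n := by
  refine ExpBounded.of_le_mul (c := 2 * k) (by positivity) (r := fun n => k * dominationBound n)
    (fun n hn => ?_) fun n hn => ?_
  · rw [Real.rpow_mul two_pos.le, Real.rpow_natCast, Real.rpow_natCast, Nat.cast_pow]
    exact pow_le_pow_left₀ (Nat.cast_nonneg _) (by exact_mod_cast (Nat.lt_two_pow_self).le) _
  · have h1 : 1 ≤ sqrtExponent n := (one_le_log hn).trans (log_le_sqrtExponent hn)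
    have h2 : (dominationBound n : ℝ) ≤ 2 * sqrtExponent n := by
      rw [dominationBound]
      push_cast
      linarith [Nat.floor_le (zero_le_one.trans h1)]
    calc (k : ℝ) * dominationBound n ≤ k * (2 * sqrtExponent n) :=
          mul_le_mul_of_nonneg_left h2 (Nat.cast_nonneg k)
      _ = _ := by ring

/-! ### The trichotomy -/

theorem adj_iff_of_isIso_cycle_three {H : LoopGraph (Fin 3)} (h : H.IsIso (cycle 3)) (x y : Fin 3) :
    H.Adj x y ↔ x ≠ y := by
  obtain ⟨e⟩ := h
  have hc : ∀ a b : Fin 3, (cycle 3).Adj a b ↔ a ≠ b := by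
    simp only [cycle, ofSimpleGraph]
    decide
  rw [← e.map_rel_iff, hc]
  exact e.injective.ne_iff

theorem eq_of_isIso {k m : ℕ} {H : LoopGraph (Fin k)} {H' : LoopGraph (Fin m)}
    (h : H.IsIso H') : k = m := by
  obtain ⟨e⟩ := h
  exact Fin.equiv_iff_eq.1 ⟨e.toEquiv⟩

/-- In the unexceptional cases, and for cycles of length five, the running time is polynomial. -/
theorem exists_polynomial_program {k : ℕ} {H : LoopGraph (Fin k)} (hconn : H.Connected)
    (hdeg : ∀ x, (H.neighborSet x).ncard ≤ 2) (hC : ¬ H.IsIso (cycle 3))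
    (hP : ¬ H.IsIso (pathLooped 3)) : ∃ (P : Program) (p : Polynomial ℕ),
      SolvesListColoringDiamTwo H P fun n => ((p.eval n : ℕ) : ℝ) := by
  obtain ⟨P, C, d, h⟩ := solves_of_certificates H (.assign 2 (.const (k + 1))) (fun _ => k + 1)
    trivial (fun _ _ => by simp [Cmd.eval_assign, Expr.eval])
    fun n G φ hG hd hφ => exists_decisive hconn hdeg hC hP hG hd hφ
  let B : Polynomial ℕ := .C (2 * k + 1) * .X
  refine ⟨P, .C C * (.X + (.X * .X + .X * .C k) + .C (k + 1) + B + B ^ (k + 1) + 1) ^ d,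
    h.mono fun n _ => le_of_eq ?_⟩
  simp [B, numInstr]

theorem expBounded_of_polynomial {E : ℕ → ℝ} (hE : ∀ n : ℕ, 3 ≤ n → Real.log n ≤ E n)
    (p : Polynomial ℕ) : ExpBounded E fun n => p.eval n := by
  have hE1 : ∀ n, 3 ≤ n → 1 ≤ E n := fun n hn => (one_le_log hn).trans (hE n hn)
  induction p using Polynomial.induction_on' with
  | add p q hp hq => simpa only [Polynomial.eval_add] using hp.add hE1 hq
  | monomial d a =>
    simpa only [Polynomial.eval_monomial] using
      (ExpBounded.const hE1 a).mul ((expBounded_id hE).pow hE1 d)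

theorem ExpBounded.exists_solves {k : ℕ} {H : LoopGraph (Fin k)} {P : Program} {E : ℕ → ℝ}
    {f : ℕ → ℕ} (hf : ExpBounded E f) (h : SolvesListColoringDiamTwo H P fun n => (f n : ℝ)) :
    ∃ (P : Program) (C : ℝ), SolvesListColoringDiamTwo H P fun n => (2 : ℝ) ^ (C * E n) := by
  obtain ⟨c, -, hc⟩ := hf
  exact ⟨P, c, h.mono hc⟩

theorem mainTheorem4 (k : ℕ) (H : LoopGraph (Fin k)) (hconn : H.Connected)
    (hdeg : ∀ x, (H.neighborSet x).ncard ≤ 2) :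
    (¬ H.IsIso (LoopGraph.cycle 3) → ¬ H.IsIso (LoopGraph.cycle 5) →
      ¬ H.IsIso (LoopGraph.pathLooped 3) →
        ∃ (P : RAM.Program) (p : Polynomial ℕ),
          SolvesListColoringDiamTwo H P (fun n => ((p.eval n : ℕ) : ℝ))) ∧
    (H.IsIso (LoopGraph.cycle 3) ∨ H.IsIso (LoopGraph.cycle 5) →
        ∃ (P : RAM.Program) (C : ℝ),
          SolvesListColoringDiamTwo H P
            (fun n => (2 : ℝ) ^ (C * ((n : ℝ) ^ (1 / 3 : ℝ) * Real.log n ^ 2)))) ∧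
    (H.IsIso (LoopGraph.pathLooped 3) →
        ∃ (P : RAM.Program) (C : ℝ),
          SolvesListColoringDiamTwo H P
            (fun n => (2 : ℝ) ^ (C * ((n : ℝ) ^ (1 / 2 : ℝ) * Real.log n ^ (1 / 2 : ℝ))))) := by
  refine ⟨fun h3 _ hP => exists_polynomial_program hconn hdeg h3 hP, fun h => ?_, fun h => ?_⟩
  · have hE := fun n (hn : 3 ≤ n) => log_le_cubeExponent hn
    have hE1 : ∀ n, 3 ≤ n → 1 ≤ cubeExponent n := fun n hn => (one_le_log hn).trans (hE n hn)
    rcases h with h | h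
    · obtain rfl := eq_of_isIso h
      have hH := adj_iff_of_isIso_cycle_three h
      obtain ⟨P, C, d, hP⟩ := solves_of_certificates H threeLengthCmd threeLength
        (threeLengthCmd_ok _) threeLengthCmd_spec fun n G φ hG hd hφ =>
          exists_decisive_three hH hG hd hφ (le_cubeRoot_pow n) (Nat.le_pow_clog (by decide) n)
      refine ExpBounded.exists_solves (E := cubeExponent) ?_ hP
      have hid := expBounded_id hE
      have hlen : ExpBounded cubeExponent threeLength := by
        refine ExpBounded.of_le_mul (c := 8704) (by norm_num) (r := fun n => threeLength n)
          (fun n _ => ?_) fun n hn => (threeLength_le hn).trans ?_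
        · rw [Real.rpow_natCast]
          exact_mod_cast (Nat.lt_two_pow_self).le
        · rw [cubeExponent, pow_two, ← mul_assoc]
          have h1 := one_le_log hn
          have h2 := one_le_cbrt hn
          have h3 : 0 ≤ (n : ℝ) ^ (1 / 3 : ℝ) * Real.log n := by positivity
          nlinarith
      have hinstr : ExpBounded cubeExponent (numInstr 3) :=
        (ExpBounded.const hE1 (2 * 3 + 1)).mul hid
      exact (ExpBounded.const hE1 C).mul ((((((hid.add hE1 ((hid.mul hid).add hE1
        (hid.mul (ExpBounded.const hE1 3)))).add hE1 hlen).add hE1 hinstr).add hE1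
          expBounded_numCertificates).add hE1 (ExpBounded.const hE1 1)).pow hE1 d)
    · -- cycles of length five are not exceptional
      obtain rfl := eq_of_isIso h
      obtain ⟨P, p, hP⟩ := exists_polynomial_program hconn hdeg
        (fun h3 => absurd (eq_of_isIso h3) (by decide))
        (fun h3 => absurd (eq_of_isIso h3) (by decide))
      exact (expBounded_of_polynomial hE p).exists_solves hP
  · have hE := fun n (hn : 3 ≤ n) => log_le_sqrtExponent hn
    have hE1 : ∀ n, 3 ≤ n → 1 ≤ sqrtExponent n := fun n hn => (one_le_log hn).trans (hE n hn)
    have hk : 0 < k := by rw [eq_of_isIso h]; decide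
    obtain ⟨P, C, e, hP⟩ := solves_of_domination H hk hdeg dominationBound
      fun n s j hn hs hj => le_dominationBound hn hs hj
    refine ExpBounded.exists_solves (E := sqrtExponent) ?_ hP
    have hid := expBounded_id hE
    exact (ExpBounded.const hE1 C).mul (((hid.add hE1 ((hid.mul hid).add hE1
      (hid.mul (ExpBounded.const hE1 k)))).add hE1 (expBounded_numColorings k)).pow hE1 e)
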